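/- All algebras are associative, not necessarily unital, over $\mathbb{C}$. For an algebra $B$ with non-degenerate product (i.e. $b=0$ as soon as $bB=0$ or $Bb=0$), $M(B)$ denotes its multiplier algebra. Let $(A,\Delta)$ be a regular weak multiplier Hopf algebra (in the sense of Van Daele and Wang), with counit $\varepsilon$ and canonical idempotent $E\in M(A\otimes A)$; write $\Delta(a)=\sum a_{(1)}\otimes a_{(2)}$ and $E=E_{(1)}\otimes E_{(2)}$. For $c\in A$ let $\varepsilon_t(c)=(\varepsilon\otimes\iota)(E(c\otimes 1))$ and $\varepsilon'_s(c)=(\iota\otimes\varepsilon)(E(1\otimes c))$ in $M(A)$. Let $R$ be an algebra with non-degenerate product that is a left $A$-module algebra: $R$ is a left $A$-module with action $\rhd$, the module is unital (the span of all $a\rhd r$ is $R$), and $a\rhd(xy)=\sum(a_{(1)}\rhd x)(a_{(2)}\rhd y)$ for $a\in A$ and $x,y\in R$. Unital actions are extended to multipliers by $m\rhd\sum_i a_i\rhd r_i=\sum_i (ma_i)\rhd r_i$; in particular $M(A\otimes A)$ acts on $R\otimes A$, extending $(b\otimes c)\rhd(r\otimes a)=(b\rhd r)\otimes ca$. Let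 $R\# A$ be the vector space $R\otimes A$ with the product $(r\otimes a)(s\otimes b)=\sum r(a_{(1)}\rhd s)\otimes a_{(2)}b$, where $\sum a_{(1)}\otimes a_{(2)}b=\Delta(a)(1\otimes b)\in A\otimes A$. The smash product $R\#_E A$ is the subspace $E\rhd(R\otimes A)$ of $R\# A$ with the product of $R\# A$. Let $R\otimes_{\varepsilon_t(A)}A$ be the balanced tensor product for the right action $r\cdot\varepsilon_t(c)=\varepsilon'_s(c)\rhd r$ of $\varepsilon_t(A)$ on $R$ and left multiplication on $A$, i.e. the quotient of $R\otimes A$ by the span of all $(\varepsilon'_s(c)\rhd r)\otimes a-r\otimes\varepsilon_t(c)a$ with $r\in R$ and $a,c\in A$. Then the formula $$(r\otimes a)(s\otimes b)=\sum r(a_{(1)}\rhd s)\otimes a_{(2)}b\qquad (r,s\in R,\ a,b\in A)$$ gives a well-defined associative and non-degenerate product on $R\otimes_{\varepsilon_t(A)}A$, and $$r\otimes a\longmapsto E\rhd(r\otimes a)=E_{(1)}\rhd r\otimes E_{(2)}a$$ (so that $r\otimes xa\mapsto E_{(1)}\rhd r\otimes E_{(2)}xa$ for $x\in\varepsilon_t(A)$)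 is a well-defined isomorphism of algebras from $R\otimes_{\varepsilon_t(A)}A$ onto $R\#_E A$. -/

import Mathlib

open scoped TensorProduct

/-- The product of `A` is non-degenerate. -/
def NonDegenerateProduct (A : Type*) [NonUnitalRing A] : Prop :=
  (∀ a : A, (∀ b : A, a * b = 0) → a = 0) ∧ (∀ a : A, (∀ b : A, b * a = 0) → a = 0)

/-- The multiplier algebra `M(A)`: pairs `(l, r)` of a left multiplier `l` (the map `a ↦ m a`) and a
right multiplier `r` (the map `a ↦ a m`) with `r(a) b = a l(b)`. The product is
`(l, r)(l', r') = (l ∘ l', r' ∘ r)`, which is why `r` lives in the opposite algebra. -/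
def MultiplierAlgebra (A : Type*) [NonUnitalRing A] [Module ℂ A] [IsScalarTower ℂ A A]
    [SMulCommClass ℂ A A] : Subalgebra ℂ (Module.End ℂ A × (Module.End ℂ A)ᵐᵒᵖ) where
  carrier := {m | (∀ a b : A, m.1 (a * b) = m.1 a * b) ∧
    (∀ a b : A, m.2.unop (a * b) = a * m.2.unop b) ∧
    (∀ a b : A, m.2.unop a * b = a * m.1 b)}
  mul_mem' := by
    rintro x y ⟨h1, h2, h3⟩ ⟨k1, k2, k3⟩
    refine ⟨fun a b => ?_, fun a b => ?_, fun a b => ?_⟩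
    · simp [h1, k1]
    · simp [h2, k2]
    · simp [h3, k3]
  add_mem' := by
    rintro x y ⟨h1, h2, h3⟩ ⟨k1, k2, k3⟩
    refine ⟨fun a b => ?_, fun a b => ?_, fun a b => ?_⟩
    · simp [h1, k1, add_mul]
    · simp [h2, k2, mul_add]
    · simp [h3, k3, mul_add, add_mul]
  algebraMap_mem' := by
    intro c
    refine ⟨fun a b => ?_, fun a b => ?_, fun a b => ?_⟩ <;>
      simp [Prod.algebraMap_apply, MulOpposite.algebraMap_apply, Module.algebraMap_end_apply,
        smul_mul_assoc, mul_smul_comm]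

namespace MultiplierAlgebra

section

variable {A : Type*} [NonUnitalRing A] [Module ℂ A] [IsScalarTower ℂ A A] [SMulCommClass ℂ A A]
variable {B : Type*} [NonUnitalRing B] [Module ℂ B] [IsScalarTower ℂ B B] [SMulCommClass ℂ B B]

/-- The map `a ↦ m a`. -/
def left (m : MultiplierAlgebra A) : A →ₗ[ℂ] A := m.1.1

/-- The map `a ↦ a m`. -/
def right (m : MultiplierAlgebra A) : A →ₗ[ℂ] A := m.1.2.unop

/-- The canonical map `A → M(A)`; it is injective when the product of `A` is non-degenerate. -/
def incl : A →ₗ[ℂ] MultiplierAlgebra A where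
  toFun a := ⟨(LinearMap.mulLeft ℂ a, MulOpposite.op (LinearMap.mulRight ℂ a)),
    fun x y => by simp [mul_assoc], fun x y => by simp [mul_assoc],
    fun x y => by simp [mul_assoc]⟩
  map_add' a b := by
    apply Subtype.ext
    apply Prod.ext
    · ext x; simp [add_mul]
    · apply MulOpposite.unop_injective; ext x; simp [mul_add]
  map_smul' c a := by
    apply Subtype.ext
    apply Prod.ext
    · ext x; simp [smul_mul_assoc]
    · apply MulOpposite.unop_injective; ext x; simp [mul_smul_comm]

/-- The natural bilinear map `M(A) × M(B) → M(A ⊗ B)`, written `m ⊗ n`. -/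
noncomputable def tensor :
    MultiplierAlgebra A →ₗ[ℂ] MultiplierAlgebra B →ₗ[ℂ] MultiplierAlgebra (A ⊗[ℂ] B) :=
  LinearMap.mk₂ ℂ
    (fun m n => ⟨(TensorProduct.map (left m) (left n),
        MulOpposite.op (TensorProduct.map (right m) (right n))), by
      have hm := m.2
      have hn := n.2
      refine ⟨fun x y => ?_, fun x y => ?_, fun x y => ?_⟩
      · induction x with
        | zero => simp
        | add x₁ x₂ h₁ h₂ => simp only [add_mul, map_add, h₁, h₂]
        | tmul a b =>
          induction y with
          | zero => simp
          | add y₁ y₂ h₁ h₂ => simp only [mul_add, map_add, h₁, h₂]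
          | tmul c d =>
            have e₁ := hm.1 a c
            have e₂ := hn.1 b d
            simp only [Algebra.TensorProduct.tmul_mul_tmul, TensorProduct.map_tmul, left, e₁, e₂]
      · induction x with
        | zero => simp
        | add x₁ x₂ h₁ h₂ => simp only [add_mul, map_add, h₁, h₂]
        | tmul a b =>
          induction y with
          | zero => simp
          | add y₁ y₂ h₁ h₂ => simp only [mul_add, map_add, h₁, h₂]
          | tmul c d =>
            have e₁ := hm.2.1 a c
            have e₂ := hn.2.1 b d
            simp only [Algebra.TensorProduct.tmul_mul_tmul, TensorProduct.map_tmul, right,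
              MulOpposite.unop_op, e₁, e₂]
      · induction x with
        | zero => simp
        | add x₁ x₂ h₁ h₂ => simp only [add_mul, map_add, h₁, h₂]
        | tmul a b =>
          induction y with
          | zero => simp
          | add y₁ y₂ h₁ h₂ => simp only [mul_add, map_add, h₁, h₂]
          | tmul c d =>
            have e₁ := hm.2.2 a c
            have e₂ := hn.2.2 b d
            simp only [Algebra.TensorProduct.tmul_mul_tmul, TensorProduct.map_tmul, left, right,
              MulOpposite.unop_op, e₁, e₂]⟩)
    (fun m m' n => Subtype.ext (Prod.ext (TensorProduct.map_add_left _ _ _)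
      (MulOpposite.unop_injective (TensorProduct.map_add_left _ _ _))))
    (fun c m n => Subtype.ext (Prod.ext (TensorProduct.map_smul_left _ _ _)
      (MulOpposite.unop_injective (TensorProduct.map_smul_left _ _ _))))
    (fun m n n' => Subtype.ext (Prod.ext (TensorProduct.map_add_right _ _ _)
      (MulOpposite.unop_injective (TensorProduct.map_add_right _ _ _))))
    (fun c m n => Subtype.ext (Prod.ext (TensorProduct.map_smul_right _ _ _)
      (MulOpposite.unop_injective (TensorProduct.map_smul_right _ _ _))))

/-- Transport of multipliers along an isomorphism of algebras. -/
def transport (e : A ≃ₗ[ℂ] B) (he : ∀ x y, e (x * y) = e x * e y) (m : MultiplierAlgebra A) :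
    MultiplierAlgebra B :=
  ⟨(e.toLinearMap ∘ₗ left m ∘ₗ e.symm.toLinearMap,
      MulOpposite.op (e.toLinearMap ∘ₗ right m ∘ₗ e.symm.toLinearMap)), by
    have hs : ∀ x y, e.symm (x * y) = e.symm x * e.symm y := fun x y => by
      apply e.injective; simp [he]
    have h1 : ∀ x y, left m (x * y) = left m x * y := m.2.1
    have h2 : ∀ x y, right m (x * y) = x * right m y := m.2.2.1
    have h3 : ∀ x y, right m x * y = x * left m y := m.2.2.2
    refine ⟨fun x y => ?_, fun x y => ?_, fun x y => ?_⟩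
    · simp [hs, h1, he]
    · simp [hs, h2, he]
    · apply e.symm.injective
      simp [hs, h3]⟩

theorem assoc_mul (x y : (A ⊗[ℂ] A) ⊗[ℂ] A) :
    TensorProduct.assoc ℂ A A A (x * y) =
      TensorProduct.assoc ℂ A A A x * TensorProduct.assoc ℂ A A A y := by
  induction x with
  | zero => simp
  | add x₁ x₂ h₁ h₂ => simp only [add_mul, map_add, h₁, h₂]
  | tmul p c =>
    induction p with
    | zero => simp
    | add x₁ x₂ h₁ h₂ => simp only [TensorProduct.add_tmul, add_mul, map_add, h₁, h₂]
    | tmul a b =>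
      induction y with
      | zero => simp
      | add x₁ x₂ h₁ h₂ => simp only [mul_add, map_add, h₁, h₂]
      | tmul q d =>
        induction q with
        | zero => simp
        | add x₁ x₂ h₁ h₂ => simp only [TensorProduct.add_tmul, mul_add, map_add, h₁, h₂]
        | tmul a' b' => simp [Algebra.TensorProduct.tmul_mul_tmul]

theorem comm_mul (x y : A ⊗[ℂ] A) :
    TensorProduct.comm ℂ A A (x * y) = TensorProduct.comm ℂ A A x * TensorProduct.comm ℂ A A y := by
  induction x with
  | zero => simp
  | add x₁ x₂ h₁ h₂ => simp only [add_mul, map_add, h₁, h₂]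
  | tmul a b =>
    induction y with
    | zero => simp
    | add x₁ x₂ h₁ h₂ => simp only [mul_add, map_add, h₁, h₂]
    | tmul c d => simp [Algebra.TensorProduct.tmul_mul_tmul]

/-- The flip on `M(A ⊗ A)`. -/
def flip (m : MultiplierAlgebra (A ⊗[ℂ] A)) : MultiplierAlgebra (A ⊗[ℂ] A) :=
  transport (TensorProduct.comm ℂ A A) comm_mul m

/-- `m ⊗ 1` in `M(A ⊗ A ⊗ A)`, for `m` in `M(A ⊗ A)`. -/
noncomputable def inLegs₁₂ (m : MultiplierAlgebra (A ⊗[ℂ] A)) :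
    MultiplierAlgebra (A ⊗[ℂ] (A ⊗[ℂ] A)) :=
  transport (A := (A ⊗[ℂ] A) ⊗[ℂ] A) (B := A ⊗[ℂ] (A ⊗[ℂ] A))
    (TensorProduct.assoc ℂ A A A) assoc_mul
    (tensor m (1 : MultiplierAlgebra A))

/-- `1 ⊗ m` in `M(A ⊗ A ⊗ A)`, for `m` in `M(A ⊗ A)`. -/
noncomputable def inLegs₂₃ (m : MultiplierAlgebra (A ⊗[ℂ] A)) :
    MultiplierAlgebra (A ⊗[ℂ] (A ⊗[ℂ] A)) :=
  tensor (1 : MultiplierAlgebra A) m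

/-- `ι ⊗ Δ : A ⊗ A → M(A ⊗ A ⊗ A)`. -/
noncomputable def idTensor (Δ : A →ₙₐ[ℂ] MultiplierAlgebra (A ⊗[ℂ] A)) :
    A ⊗[ℂ] A →ₗ[ℂ] MultiplierAlgebra (A ⊗[ℂ] (A ⊗[ℂ] A)) :=
  TensorProduct.lift (tensor.compl₁₂ incl (Δ : A →ₗ[ℂ] MultiplierAlgebra (A ⊗[ℂ] A)))

/-- `F = (ι ⊗ Δ)(m)`, where `ι ⊗ Δ` is extended to the homomorphism `M(A ⊗ A) → M(A ⊗ A ⊗ A)`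
that maps `1` to `1 ⊗ E`. When `Δ(A)(A ⊗ A) = E(A ⊗ A)` and `(A ⊗ A)Δ(A) = (A ⊗ A)E`, at most one
`F` has these properties. -/
def IsIdTensorExtension (Δ : A →ₙₐ[ℂ] MultiplierAlgebra (A ⊗[ℂ] A))
    (E m : MultiplierAlgebra (A ⊗[ℂ] A)) (F : MultiplierAlgebra (A ⊗[ℂ] (A ⊗[ℂ] A))) : Prop :=
  inLegs₂₃ E * F = F ∧ F * inLegs₂₃ E = F ∧
  ∀ p : A ⊗[ℂ] A, F * idTensor Δ p = idTensor Δ (left m p) ∧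
    idTensor Δ p * F = idTensor Δ (right m p)

end

end MultiplierAlgebra

open MultiplierAlgebra in
/-- A weak multiplier Hopf algebra structure on the algebra `A`. The canonical maps `T₁`, `T₂`, the
counit `ε` and the canonical idempotent `E` are all uniquely determined by `Δ`. -/
structure WeakMultiplierHopfAlgebra (A : Type*) [NonUnitalRing A] [Module ℂ A]
    [IsScalarTower ℂ A A] [SMulCommClass ℂ A A] where
  nondegenerate : NonDegenerateProduct A
  /-- `A² = A`. -/
  idempotent : Function.Surjective (LinearMap.mul' ℂ A)
  /-- The coproduct, a homomorphism of algebras. -/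
  Δ : A →ₙₐ[ℂ] MultiplierAlgebra (A ⊗[ℂ] A)
  T₁ : A ⊗[ℂ] A →ₗ[ℂ] A ⊗[ℂ] A
  T₂ : A ⊗[ℂ] A →ₗ[ℂ] A ⊗[ℂ] A
  /-- `Δ(a)(1 ⊗ b)` is in `A ⊗ A`, and is `T₁(a ⊗ b)`. -/
  T₁_spec : ∀ a b : A, incl (T₁ (a ⊗ₜ b)) = Δ a * tensor 1 (incl b)
  /-- `(a ⊗ 1)Δ(b)` is in `A ⊗ A`, and is `T₂(a ⊗ b)`. -/
  T₂_spec : ∀ a b : A, incl (T₂ (a ⊗ₜ b)) = tensor (incl a) 1 * Δ b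
  /-- `(c ⊗ 1 ⊗ 1)(Δ ⊗ ι)(Δ(a)(1 ⊗ b)) = (ι ⊗ Δ)((c ⊗ 1)Δ(a))(1 ⊗ 1 ⊗ b)`. -/
  coassoc : ∀ a b c : A,
    TensorProduct.assoc ℂ A A A
        (T₂.rTensor A ((TensorProduct.assoc ℂ A A A).symm (c ⊗ₜ[ℂ] T₁ (a ⊗ₜ b)))) =
      T₁.lTensor A (TensorProduct.assoc ℂ A A A (T₂ (c ⊗ₜ a) ⊗ₜ[ℂ] b))
  /-- The coproduct is full: the left leg. -/
  full_left : ∀ V : Submodule ℂ A,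
    LinearMap.range T₁ ≤ LinearMap.range (V.subtype.rTensor A) → V = ⊤
  /-- The coproduct is full: the right leg. -/
  full_right : ∀ W : Submodule ℂ A,
    LinearMap.range T₂ ≤ LinearMap.range (W.subtype.lTensor A) → W = ⊤
  /-- The counit. -/
  ε : A →ₗ[ℂ] ℂ
  counit_left : ∀ a b : A, TensorProduct.lid ℂ A (ε.rTensor A (T₁ (a ⊗ₜ b))) = a * b
  counit_right : ∀ a b : A, TensorProduct.rid ℂ A (ε.lTensor A (T₂ (a ⊗ₜ b))) = a * b
  /-- The canonical idempotent. -/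
  E : MultiplierAlgebra (A ⊗[ℂ] A)
  E_idempotent : E * E = E
  /-- `E(A ⊗ A) = T₁(A ⊗ A)`. -/
  range_T₁ : LinearMap.range (left E) = LinearMap.range T₁
  /-- `(A ⊗ A)E = T₂(A ⊗ A)`. -/
  range_T₂ : LinearMap.range (right E) = LinearMap.range T₂
  /-- `(ι ⊗ Δ)E = (E ⊗ 1)(1 ⊗ E)`. -/
  idTensor_E : IsIdTensorExtension Δ E E (inLegs₁₂ E * inLegs₂₃ E)
  /-- `(E ⊗ 1)(1 ⊗ E) = (1 ⊗ E)(E ⊗ 1)`. -/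
  E_comm : inLegs₁₂ E * inLegs₂₃ E = inLegs₂₃ E * inLegs₁₂ E
  /-- `Ker T₁ = (1 - G₁)(A ⊗ A)`, where
  `(G₁ ⊗ ι)(Δ₁₃(a)(1 ⊗ b ⊗ c)) = Δ₁₃(a)(1 ⊗ E)(1 ⊗ b ⊗ c)`. Here `D₁₃(a ⊗ b ⊗ c)` is
  `Δ₁₃(a)(1 ⊗ b ⊗ c)`, that is, `T₁(a ⊗ c)` with `b` inserted in the middle. -/
  ker_T₁ : ∃ G₁ : A ⊗[ℂ] A →ₗ[ℂ] A ⊗[ℂ] A,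
    let D₁₃ : A ⊗[ℂ] (A ⊗[ℂ] A) →ₗ[ℂ] A ⊗[ℂ] (A ⊗[ℂ] A) :=
      (TensorProduct.leftComm ℂ A A A).toLinearMap ∘ₗ T₁.lTensor A ∘ₗ
        (TensorProduct.leftComm ℂ A A A).toLinearMap
    (∀ a b c : A,
      TensorProduct.assoc ℂ A A A
          (G₁.rTensor A ((TensorProduct.assoc ℂ A A A).symm (D₁₃ (a ⊗ₜ (b ⊗ₜ c))))) =
        D₁₃ (a ⊗ₜ left E (b ⊗ₜ c))) ∧
    LinearMap.ker T₁ = LinearMap.range (LinearMap.id - G₁)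
  /-- `Ker T₂ = (1 - G₂)(A ⊗ A)`, where
  `(ι ⊗ G₂)((a ⊗ b ⊗ 1)Δ₁₃(c)) = (a ⊗ b ⊗ 1)(E ⊗ 1)Δ₁₃(c)`. Here `D₁₃(a ⊗ b ⊗ c)` is
  `(a ⊗ b ⊗ 1)Δ₁₃(c)`, that is, `T₂(a ⊗ c)` with `b` inserted in the middle. -/
  ker_T₂ : ∃ G₂ : A ⊗[ℂ] A →ₗ[ℂ] A ⊗[ℂ] A,
    let D₁₃ : (A ⊗[ℂ] A) ⊗[ℂ] A →ₗ[ℂ] (A ⊗[ℂ] A) ⊗[ℂ] A :=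
      (TensorProduct.rightComm ℂ A A A).toLinearMap ∘ₗ T₂.rTensor A ∘ₗ
        (TensorProduct.rightComm ℂ A A A).toLinearMap
    (∀ a b c : A,
      (TensorProduct.assoc ℂ A A A).symm
          (G₂.lTensor A (TensorProduct.assoc ℂ A A A (D₁₃ ((a ⊗ₜ b) ⊗ₜ c)))) =
        D₁₃ (right E (a ⊗ₜ b) ⊗ₜ c)) ∧
    LinearMap.ker T₂ = LinearMap.range (LinearMap.id - G₂)

section ExtendedAction

variable {A : Type*} [AddCommGroup A] [Module ℂ A]
variable {V : Type*} [AddCommGroup V] [Module ℂ V] {W : Type*} [AddCommGroup W] [Module ℂ W]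

/-- A bilinear action of `A` on `V` is unital if `A V = V` (the span of all `a v` is `V`). -/
def IsUnitalAction (act : A →ₗ[ℂ] V →ₗ[ℂ] V) : Prop :=
  Function.Surjective (TensorProduct.lift act)

/-- The extension of a unital action of `A` to (left) multipliers: write `v = ∑ aᵢ vᵢ`
and put `m v = ∑ (m aᵢ) vᵢ`. The result does not depend on how `v` is written if `A` has local
units. A multiplier enters through its map `a ↦ m a`. -/
noncomputable def extendedAction (act : A →ₗ[ℂ] V →ₗ[ℂ] V) (h : IsUnitalAction act)
    (m : A →ₗ[ℂ] A) (v : V) : V :=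
  TensorProduct.lift act (m.rTensor V (Function.surjInv h v))

/-- The componentwise action `(a ⊗ b)(v ⊗ w) = a v ⊗ b w` of `A ⊗ A` on `V ⊗ W` is unital. -/
theorem IsUnitalAction.tensor {act : A →ₗ[ℂ] V →ₗ[ℂ] V} {act' : A →ₗ[ℂ] W →ₗ[ℂ] W}
    (h : IsUnitalAction act) (h' : IsUnitalAction act') :
    IsUnitalAction (TensorProduct.map₂ act act') := by
  intro t
  induction t with
  | zero => exact ⟨0, map_zero _⟩
  | add x y hx hy =>
    obtain ⟨p, rfl⟩ := hx
    obtain ⟨q, rfl⟩ := hy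
    exact ⟨p + q, map_add _ _ _⟩
  | tmul v w =>
    obtain ⟨p, rfl⟩ := h v
    obtain ⟨q, rfl⟩ := h' w
    refine ⟨TensorProduct.tensorTensorTensorComm ℂ A V A W (p ⊗ₜ q), ?_⟩
    induction p with
    | zero => simp
    | add x y hx hy => simp only [TensorProduct.add_tmul, map_add, hx, hy]
    | tmul a v =>
      induction q with
      | zero => simp
      | add x y hx hy => simp only [TensorProduct.tmul_add, map_add, hx, hy]
      | tmul b w => simp

end ExtendedAction

namespace WeakMultiplierHopfAlgebra

variable {A : Type*} [NonUnitalRing A] [Module ℂ A] [IsScalarTower ℂ A A] [SMulCommClass ℂ A A]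

open MultiplierAlgebra in
/-- `(A, Δ)` is regular: `Δ(a)(b ⊗ 1)` and `(1 ⊗ a)Δ(b)` are in `A ⊗ A`, and `(A, Δ^cop)` is a weak
multiplier Hopf algebra as well. -/
def IsRegular (H : WeakMultiplierHopfAlgebra A) : Prop :=
  (∀ a b : A, H.Δ a * tensor (incl b) 1 ∈ LinearMap.range (incl (A := A ⊗[ℂ] A))) ∧
  (∀ a b : A, tensor 1 (incl a) * H.Δ b ∈ LinearMap.range (incl (A := A ⊗[ℂ] A))) ∧
  ∃ H' : WeakMultiplierHopfAlgebra A, ∀ a : A, H'.Δ a = flip (H.Δ a)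

/-- `ε_t(a) = (ε ⊗ ι)(E(a ⊗ 1))`, as the map `b ↦ ε_t(a) b = (ε ⊗ ι)(E(a ⊗ b))` on `A`. -/
noncomputable def targetMap (H : WeakMultiplierHopfAlgebra A) (a : A) : A →ₗ[ℂ] A :=
  (TensorProduct.lid ℂ A).toLinearMap ∘ₗ H.ε.rTensor A ∘ₗ
    MultiplierAlgebra.left H.E ∘ₗ TensorProduct.mk ℂ A A a

/-- `ε'_s(a) = (ι ⊗ ε)(E(1 ⊗ a))`, as the map `b ↦ ε'_s(a) b = (ι ⊗ ε)(E(b ⊗ a))` on `A`. -/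
noncomputable def sourceMap' (H : WeakMultiplierHopfAlgebra A) (a : A) : A →ₗ[ℂ] A :=
  (TensorProduct.rid ℂ A).toLinearMap ∘ₗ H.ε.lTensor A ∘ₗ
    MultiplierAlgebra.left H.E ∘ₗ (TensorProduct.mk ℂ A A).flip a

/-- The structure of a left `A`-module algebra on the algebra `R`. -/
structure ModuleAlgebra (H : WeakMultiplierHopfAlgebra A) (R : Type*) [NonUnitalRing R]
    [Module ℂ R] [IsScalarTower ℂ R R] [SMulCommClass ℂ R R] where
  /-- The action `act a r = a ▷ r`. -/
  act : A →ₗ[ℂ] R →ₗ[ℂ] R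
  mul_act : ∀ (a b : A) (r : R), act (a * b) r = act a (act b r)
  unital : IsUnitalAction act
  /-- `a ▷ (x y) = ∑ (a₍₁₎ ▷ x)(a₍₂₎ ▷ y)`, that is, `a ▷ (x y) = m(Δ(a) ▷ (x ⊗ y))`. -/
  act_mul : ∀ (a : A) (x y : R), act a (x * y) = LinearMap.mul' ℂ R
    (extendedAction (TensorProduct.map₂ act act) (unital.tensor unital)
      (MultiplierAlgebra.left (H.Δ a)) (x ⊗ₜ y))

namespace ModuleAlgebra

variable {H : WeakMultiplierHopfAlgebra A} {R : Type*} [NonUnitalRing R]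
  [Module ℂ R] [IsScalarTower ℂ R R] [SMulCommClass ℂ R R]

/-- The product `(r ⊗ a)(s ⊗ b) = ∑ r(a₍₁₎ ▷ s) ⊗ a₍₂₎ b` on `R ⊗ A`; this algebra is `R # A`.
The formula on pure tensors is `sharpMul_tmul`. -/
noncomputable def sharpMul (M : H.ModuleAlgebra R) :
    R ⊗[ℂ] A →ₗ[ℂ] R ⊗[ℂ] A →ₗ[ℂ] R ⊗[ℂ] A :=
  TensorProduct.curry
    ((LinearMap.mul' ℂ R ∘ₗ
        (TensorProduct.lift M.act.flip).lTensor R ∘ₗ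
        (TensorProduct.assoc ℂ R R A).toLinearMap).rTensor A ∘ₗ
      (TensorProduct.assoc ℂ (R ⊗[ℂ] R) A A).symm.toLinearMap ∘ₗ
      H.T₁.lTensor (R ⊗[ℂ] R) ∘ₗ
      (TensorProduct.tensorTensorTensorComm ℂ R A R A).toLinearMap)

/-- With `Δ(a)(1 ⊗ b) = ∑ p ⊗ q`, the product `(r ⊗ a)(s ⊗ b)` is `∑ r(p ▷ s) ⊗ q`. -/
theorem sharpMul_tmul (M : H.ModuleAlgebra R) (r s : R) (a b : A) :
    M.sharpMul (r ⊗ₜ a) (s ⊗ₜ b) =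
      (LinearMap.mulLeft ℂ r ∘ₗ M.act.flip s).rTensor A (H.T₁ (a ⊗ₜ b)) := by
  simp only [sharpMul, TensorProduct.curry_apply, LinearMap.comp_apply, LinearEquiv.coe_coe,
    TensorProduct.tensorTensorTensorComm_tmul, LinearMap.lTensor_tmul]
  induction H.T₁ (a ⊗ₜ b) with
  | zero => simp
  | add x y hx hy => simp only [TensorProduct.tmul_add, map_add, hx, hy]
  | tmul p q => simp

/-- `E ▷ t` for `t` in `R ⊗ A`, so that `E ▷ (r ⊗ a) = E₍₁₎ ▷ r ⊗ E₍₂₎ a`: the action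
`(b ⊗ c)(r ⊗ a) = b ▷ r ⊗ c a` of `A ⊗ A` on `R ⊗ A` is extended to `M(A ⊗ A)`. -/
noncomputable def actE (M : H.ModuleAlgebra R) (t : R ⊗[ℂ] A) : R ⊗[ℂ] A :=
  extendedAction (TensorProduct.map₂ M.act (LinearMap.mul ℂ A))
    (M.unital.tensor (act' := LinearMap.mul ℂ A) H.idempotent) (MultiplierAlgebra.left H.E) t

/-- The underlying space of the smash product `R #_E A = E ▷ (R # A)`; its product is the one of
`R # A`. -/
noncomputable def smash (M : H.ModuleAlgebra R) : Submodule ℂ (R ⊗[ℂ] A) :=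
  Submodule.span ℂ (Set.range M.actE)

/-- The right action of `ε_t(A)` on `R`: `r · ε_t(c) = S⁻¹(ε_t(c)) ▷ r = ε'_s(c) ▷ r`. -/
noncomputable def targetAct (M : H.ModuleAlgebra R) (r : R) (c : A) : R :=
  extendedAction M.act M.unital (H.sourceMap' c) r

/-- The subspace of `R ⊗ A` spanned by all `r · x ⊗ a - r ⊗ x a`, with `x` in `ε_t(A)`. -/
noncomputable def balancing (M : H.ModuleAlgebra R) : Submodule ℂ (R ⊗[ℂ] A) :=
  Submodule.span ℂ
    {t | ∃ (r : R) (c a : A), t = M.targetAct r c ⊗ₜ a - r ⊗ₜ H.targetMap c a}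

/-- The space `R ⊗_t A`, the tensor product of `R` and `A` over the algebra `ε_t(A)`. -/
abbrev TensorOverTarget (M : H.ModuleAlgebra R) : Type _ := (R ⊗[ℂ] A) ⧸ M.balancing

end ModuleAlgebra

end WeakMultiplierHopfAlgebra

/-! Everything rests on the operator `P = (t ↦ E ▷ t)` on `R ⊗ A`. It is linear with range `R #_E
A`, and its kernel is exactly the balancing subspace (`ker_actEHom`), so it induces a linear
isomorphism from the balanced tensor product onto the smash product. The product of `R # A` does not
change when `P` is applied to either factor (`sharpMul_actE_left`, `sharpMul_actE_right`), and its
values are fixed by `P` (`actE_sharpMul`). Hence it descends to the quotient, and the isomorphism is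
multiplicative. Associativity is the pentagon equation for `T₁` combined with the module algebra
axiom.

Kernel of `P`: the identity `E(ε'_s(c) ⊗ 1) = E(1 ⊗ ε_t(c))` shows that `P` kills the balancing
relations. Conversely `E ▷ (r ⊗ wy) = ∑ r·ε_t(w₍₁₎) ⊗ w₍₂₎y` while `wy = ∑ ε_t(w₍₁₎)w₍₂₎y`, so `t -
P t` is always a sum of balancing relations.

None of this makes sense until the extended actions are known to be well defined and linear. That
needs `R` to have no nonzero element annihilated by `A`, which follows from unitality once `A` has
left local units (`exists_mul_eq_self`). The local units come from the antipode: a functional `ω`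
vanishing on `Aa` also vanishes on every `b S(v) a`, because `b S(v)` lies in `A`. So `ω`
annihilates the second legs of `E(c ⊗ a) = ∑ c₍₁₎ ⊗ c₍₂₎S(c₍₃₎)a`, and from this `ω(a) = 0`.

Non-degeneracy: if `ut = 0` for all `u`, then `Δ(a) ▷ t = 0` for all `a`, and `(A ⊗ A)E` is spanned
by the `(d ⊗ 1)Δ(a)`, so `P t = 0`. If `tu = 0` for all `u`, with `t = ∑ r ⊗ a`, the expression `∑
r(a₍₁₎S(a₍₂₎)b ▷ s) ⊗ a₍₃₎y` vanishes, and it equals `P t` multiplied on its two legs by `b ▷ s` and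
`y`.

Regularity enters through the coopposite structure `H'`. It makes `Δ(a)(x ⊗ 1)` an element of `A ⊗
A`, and each statement about one leg of `E` gets a mirror image. -/

set_option linter.unusedSectionVars false
open LinearMap (mulLeft mulRight)

/-! ### Testing elements of tensor products by separating families of maps. -/

section JointInjectivity

variable {ι M N V : Type*} [AddCommGroup M] [Module ℂ M] [AddCommGroup N] [Module ℂ N]
  [AddCommGroup V] [Module ℂ V]

/-- If the maps `f i` separate the points of `M`, the maps `f i ⊗ V` separate those of `M ⊗ V`. -/
theorem TensorProduct.eq_zero_of_rTensor_eq_zero (f : ι → M →ₗ[ℂ] N)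
    (hf : ∀ x, (∀ i, f i x = 0) → x = 0) (z : M ⊗[ℂ] V)
    (hz : ∀ i, (f i).rTensor V z = 0) : z = 0 := by
  classical
  let b := Module.Basis.ofVectorSpace ℂ V
  have key : ∀ i k (w : M ⊗[ℂ] V), TensorProduct.equivFinsuppOfBasisRight b ((f i).rTensor V w) k =
      f i (TensorProduct.equivFinsuppOfBasisRight b w k) := by
    intro i k w
    induction w with
    | zero => simp
    | add x y hx hy => simp only [map_add, Finsupp.add_apply, hx, hy]
    | tmul m v => simp
  apply (TensorProduct.equivFinsuppOfBasisRight b).injective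
  ext k
  rw [map_zero, Finsupp.zero_apply]
  exact hf _ fun i => by rw [← key, hz, map_zero, Finsupp.zero_apply]

theorem TensorProduct.eq_zero_of_lTensor_eq_zero (f : ι → M →ₗ[ℂ] N)
    (hf : ∀ x, (∀ i, f i x = 0) → x = 0) (z : V ⊗[ℂ] M)
    (hz : ∀ i, (f i).lTensor V z = 0) : z = 0 := by
  apply (TensorProduct.comm ℂ V M).injective
  rw [map_zero]
  refine TensorProduct.eq_zero_of_rTensor_eq_zero f hf _ fun i => ?_
  have := congrArg (TensorProduct.comm ℂ V N) (hz i)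
  rw [map_zero] at this
  rw [← this]
  exact LinearMap.congr_fun (TensorProduct.ext' (g := (f i).rTensor V ∘ₗ
    (TensorProduct.comm ℂ V M).toLinearMap)
    (h := (TensorProduct.comm ℂ V N).toLinearMap ∘ₗ (f i).lTensor V) fun x y => by simp) z

theorem TensorProduct.eq_of_rTensor_eq (f : ι → M →ₗ[ℂ] N)
    (hf : ∀ x, (∀ i, f i x = 0) → x = 0) {z w : M ⊗[ℂ] V}
    (hz : ∀ i, (f i).rTensor V z = (f i).rTensor V w) : z = w :=
  sub_eq_zero.1 <| TensorProduct.eq_zero_of_rTensor_eq_zero f hf _ fun i => by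
    rw [map_sub, hz, sub_self]

theorem TensorProduct.eq_of_lTensor_eq (f : ι → M →ₗ[ℂ] N)
    (hf : ∀ x, (∀ i, f i x = 0) → x = 0) {z w : V ⊗[ℂ] M}
    (hz : ∀ i, (f i).lTensor V z = (f i).lTensor V w) : z = w :=
  sub_eq_zero.1 <| TensorProduct.eq_zero_of_lTensor_eq_zero f hf _ fun i => by
    rw [map_sub, hz, sub_self]

/-- An element of `Hom(M, N) ⊗ V` is zero if it vanishes pointwise. -/
theorem TensorProduct.rTensor_eq_zero_of_flip {P : Type*} [AddCommGroup P] [Module ℂ P]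
    (f : P →ₗ[ℂ] M →ₗ[ℂ] N) (z : P ⊗[ℂ] V) (hz : ∀ m : M, (f.flip m).rTensor V z = 0) :
    f.rTensor V z = 0 := by
  refine TensorProduct.eq_zero_of_rTensor_eq_zero
    (fun m : M => (LinearMap.id : (M →ₗ[ℂ] N) →ₗ[ℂ] (M →ₗ[ℂ] N)).flip m)
    (fun _ hx => LinearMap.ext hx) _ fun m => ?_
  rw [← LinearMap.rTensor_comp_apply, ← hz m]
  rfl

theorem TensorProduct.lTensor_eq_zero_of_flip {P : Type*} [AddCommGroup P] [Module ℂ P]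
    (f : P →ₗ[ℂ] M →ₗ[ℂ] N) (z : V ⊗[ℂ] P) (hz : ∀ m : M, (f.flip m).lTensor V z = 0) :
    f.lTensor V z = 0 := by
  refine TensorProduct.eq_zero_of_lTensor_eq_zero
    (fun m : M => (LinearMap.id : (M →ₗ[ℂ] N) →ₗ[ℂ] (M →ₗ[ℂ] N)).flip m)
    (fun _ hx => LinearMap.ext hx) _ fun m => ?_
  rw [← LinearMap.lTensor_comp_apply, ← hz m]
  rfl

end JointInjectivity

/-! ### Non-degeneracy passes to tensor products. -/

section NonDegenerate

variable {A : Type*} [NonUnitalRing A] [Module ℂ A] [IsScalarTower ℂ A A] [SMulCommClass ℂ A A]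
variable {B : Type*} [NonUnitalRing B] [Module ℂ B] [IsScalarTower ℂ B B] [SMulCommClass ℂ B B]
variable {V : Type*} [AddCommGroup V] [Module ℂ V]

theorem TensorProduct.mul_tmul_eq_map (z : A ⊗[ℂ] B) (x : A) (y : B) :
    z * (x ⊗ₜ y) = TensorProduct.map (mulRight ℂ x) (mulRight ℂ y) z := by
  induction z with
  | zero => simp
  | add x y hx hy => simp only [add_mul, map_add, hx, hy]
  | tmul a b => simp [Algebra.TensorProduct.tmul_mul_tmul]

theorem TensorProduct.tmul_mul_eq_map (z : A ⊗[ℂ] B) (x : A) (y : B) :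
    (x ⊗ₜ y) * z = TensorProduct.map (mulLeft ℂ x) (mulLeft ℂ y) z := by
  induction z with
  | zero => simp
  | add x y hx hy => simp only [mul_add, map_add, hx, hy]
  | tmul a b => simp [Algebra.TensorProduct.tmul_mul_tmul]

namespace NonDegenerateProduct

theorem eq_of_mul_right (hA : NonDegenerateProduct A) {a b : A} (h : ∀ c, a * c = b * c) : a = b :=
  sub_eq_zero.1 <| hA.1 _ fun c => by rw [sub_mul, h, sub_self]

theorem eq_of_mul_left (hA : NonDegenerateProduct A) {a b : A} (h : ∀ c, c * a = c * b) : a = b :=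
  sub_eq_zero.1 <| hA.2 _ fun c => by rw [mul_sub, h, sub_self]

theorem eq_of_rTensor_mulLeft (hA : NonDegenerateProduct A) {z w : A ⊗[ℂ] V}
    (h : ∀ c, (mulLeft ℂ c).rTensor V z = (mulLeft ℂ c).rTensor V w) : z = w :=
  TensorProduct.eq_of_rTensor_eq (fun c : A => mulLeft ℂ c) hA.2 h

theorem eq_of_rTensor_mulRight (hA : NonDegenerateProduct A) {z w : A ⊗[ℂ] V}
    (h : ∀ c, (mulRight ℂ c).rTensor V z = (mulRight ℂ c).rTensor V w) : z = w :=
  TensorProduct.eq_of_rTensor_eq (fun c : A => mulRight ℂ c) hA.1 h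

theorem eq_of_lTensor_mulLeft (hA : NonDegenerateProduct A) {z w : V ⊗[ℂ] A}
    (h : ∀ c, (mulLeft ℂ c).lTensor V z = (mulLeft ℂ c).lTensor V w) : z = w :=
  TensorProduct.eq_of_lTensor_eq (fun c : A => mulLeft ℂ c) hA.2 h

theorem eq_of_lTensor_mulRight (hA : NonDegenerateProduct A) {z w : V ⊗[ℂ] A}
    (h : ∀ c, (mulRight ℂ c).lTensor V z = (mulRight ℂ c).lTensor V w) : z = w :=
  TensorProduct.eq_of_lTensor_eq (fun c : A => mulRight ℂ c) hA.1 h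

theorem tensor (hA : NonDegenerateProduct A) (hB : NonDegenerateProduct B) :
    NonDegenerateProduct (A ⊗[ℂ] B) := by
  constructor
  · intro z hz
    refine hA.eq_of_rTensor_mulRight fun x => hB.eq_of_lTensor_mulRight fun y => ?_
    rw [map_zero, map_zero, ← hz (x ⊗ₜ y), TensorProduct.mul_tmul_eq_map,
      ← LinearMap.lTensor_comp_rTensor, LinearMap.comp_apply]
  · intro z hz
    refine hA.eq_of_rTensor_mulLeft fun x => hB.eq_of_lTensor_mulLeft fun y => ?_
    rw [map_zero, map_zero, ← hz (x ⊗ₜ y), TensorProduct.tmul_mul_eq_map,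
      ← LinearMap.lTensor_comp_rTensor, LinearMap.comp_apply]

end NonDegenerateProduct

end NonDegenerate

/-! ### Left and right parts of multipliers. -/

namespace MultiplierAlgebra

variable {A : Type*} [NonUnitalRing A] [Module ℂ A] [IsScalarTower ℂ A A] [SMulCommClass ℂ A A]
variable {B : Type*} [NonUnitalRing B] [Module ℂ B] [IsScalarTower ℂ B B] [SMulCommClass ℂ B B]

theorem left_mul_apply (m : MultiplierAlgebra A) (a b : A) : left m (a * b) = left m a * b :=
  m.2.1 a b

theorem right_mul_apply (m : MultiplierAlgebra A) (a b : A) : right m (a * b) = a * right m b :=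
  m.2.2.1 a b

theorem right_mul_eq (m : MultiplierAlgebra A) (a b : A) : right m a * b = a * left m b :=
  m.2.2.2 a b

theorem left_mul (m n : MultiplierAlgebra A) (a : A) : left (m * n) a = left m (left n a) := rfl

theorem right_mul (m n : MultiplierAlgebra A) (a : A) : right (m * n) a = right n (right m a) := rfl

theorem left_flip (m : MultiplierAlgebra (A ⊗[ℂ] A)) (z : A ⊗[ℂ] A) :
    left (flip m) z = TensorProduct.comm ℂ A A (left m ((TensorProduct.comm ℂ A A).symm z)) := rfl

theorem right_flip (m : MultiplierAlgebra (A ⊗[ℂ] A)) (z : A ⊗[ℂ] A) :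
    right (flip m) z = TensorProduct.comm ℂ A A (right m ((TensorProduct.comm ℂ A A).symm z)) := rfl

theorem ext_left_right {m n : MultiplierAlgebra A} (hl : left m = left n)
    (hr : right m = right n) : m = n :=
  Subtype.ext (Prod.ext hl (MulOpposite.unop_injective hr))

/-- This is associativity `(mz)n = m(zn)`, checked against right multiplication. It is needed for
the pair `1 ⊗ E`, `E ⊗ 1` in `commutesWithE_right_E`. -/
theorem right_left_comm (hA : NonDegenerateProduct A) (m n : MultiplierAlgebra A) (z : A) :
    right n (left m z) = left m (right n z) :=
  hA.eq_of_mul_right fun w => by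
    rw [right_mul_eq, ← left_mul_apply, ← left_mul_apply, right_mul_eq]

theorem flip_flip (m : MultiplierAlgebra (A ⊗[ℂ] A)) : flip (flip m) = m := by
  apply ext_left_right <;>
  · ext z
    simp [left_flip, right_flip]

end MultiplierAlgebra

/-! ### Slice maps and bookkeeping of tensor legs. -/

section

variable {M N P Q : Type*} [AddCommGroup M] [Module ℂ M] [AddCommGroup N] [Module ℂ N]
  [AddCommGroup P] [Module ℂ P] [AddCommGroup Q] [Module ℂ Q]

theorem TensorProduct.rTensor_lTensor_comm (f : M →ₗ[ℂ] N) (g : P →ₗ[ℂ] Q) (z : M ⊗[ℂ] P) :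
    f.rTensor Q (g.lTensor M z) = g.lTensor N (f.rTensor P z) :=
  LinearMap.congr_fun (TensorProduct.ext' (g := f.rTensor Q ∘ₗ g.lTensor M)
    (h := g.lTensor N ∘ₗ f.rTensor P) fun x y => by simp) z

theorem TensorProduct.comm_rTensor (f : M →ₗ[ℂ] N) (z : M ⊗[ℂ] P) :
    TensorProduct.comm ℂ N P (f.rTensor P z) = f.lTensor P (TensorProduct.comm ℂ M P z) :=
  LinearMap.congr_fun (TensorProduct.ext' (g := (TensorProduct.comm ℂ N P).toLinearMap ∘ₗ
    f.rTensor P) (h := f.lTensor P ∘ₗ (TensorProduct.comm ℂ M P).toLinearMap)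
    fun x y => by simp) z

theorem TensorProduct.comm_lTensor (f : M →ₗ[ℂ] N) (z : P ⊗[ℂ] M) :
    TensorProduct.comm ℂ P N (f.lTensor P z) = f.rTensor P (TensorProduct.comm ℂ P M z) :=
  LinearMap.congr_fun (TensorProduct.ext' (g := (TensorProduct.comm ℂ P N).toLinearMap ∘ₗ
    f.lTensor P) (h := f.rTensor P ∘ₗ (TensorProduct.comm ℂ P M).toLinearMap)
    fun x y => by simp) z

theorem TensorProduct.map_eq_rTensor_lTensor (f : M →ₗ[ℂ] N) (g : P →ₗ[ℂ] Q) (z : M ⊗[ℂ] P) :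
    TensorProduct.map f g z = f.rTensor Q (g.lTensor M z) :=
  LinearMap.congr_fun (TensorProduct.ext' (g := TensorProduct.map f g)
    (h := f.rTensor Q ∘ₗ g.lTensor M) fun x y => by simp) z

theorem TensorProduct.map_eq_lTensor_rTensor (f : M →ₗ[ℂ] N) (g : P →ₗ[ℂ] Q) (z : M ⊗[ℂ] P) :
    TensorProduct.map f g z = g.lTensor N (f.rTensor P z) :=
  LinearMap.congr_fun (TensorProduct.ext' (g := TensorProduct.map f g)
    (h := g.lTensor N ∘ₗ f.rTensor P) fun x y => by simp) z

/-- `(φ ⊗ ι)` on `M ⊗ P`, for a functional `φ`. -/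
noncomputable def sliceLeft (φ : M →ₗ[ℂ] ℂ) : M ⊗[ℂ] P →ₗ[ℂ] P :=
  (TensorProduct.lid ℂ P).toLinearMap ∘ₗ φ.rTensor P

/-- `(ι ⊗ φ)` on `P ⊗ M`, for a functional `φ`. -/
noncomputable def sliceRight (φ : M →ₗ[ℂ] ℂ) : P ⊗[ℂ] M →ₗ[ℂ] P :=
  (TensorProduct.rid ℂ P).toLinearMap ∘ₗ φ.lTensor P

@[simp]
theorem sliceLeft_tmul (φ : M →ₗ[ℂ] ℂ) (m : M) (p : P) : sliceLeft φ (m ⊗ₜ[ℂ] p) = φ m • p := by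
  simp [sliceLeft]

@[simp]
theorem sliceRight_tmul (φ : M →ₗ[ℂ] ℂ) (m : M) (p : P) : sliceRight φ (p ⊗ₜ[ℂ] m) = φ m • p := by
  simp [sliceRight]

theorem sliceLeft_lTensor (φ : M →ₗ[ℂ] ℂ) (f : P →ₗ[ℂ] Q) (z : M ⊗[ℂ] P) :
    sliceLeft φ (f.lTensor M z) = f (sliceLeft φ z) :=
  LinearMap.congr_fun (TensorProduct.ext' (g := sliceLeft φ ∘ₗ f.lTensor M)
    (h := f ∘ₗ sliceLeft φ) fun x y => by simp) z

theorem sliceRight_rTensor (φ : M →ₗ[ℂ] ℂ) (f : P →ₗ[ℂ] Q) (z : P ⊗[ℂ] M) :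
    sliceRight φ (f.rTensor M z) = f (sliceRight φ z) :=
  LinearMap.congr_fun (TensorProduct.ext' (g := sliceRight φ ∘ₗ f.rTensor M)
    (h := f ∘ₗ sliceRight φ) fun x y => by simp) z

theorem sliceLeft_rTensor (φ : N →ₗ[ℂ] ℂ) (f : M →ₗ[ℂ] N) (z : M ⊗[ℂ] P) :
    sliceLeft φ (f.rTensor P z) = sliceLeft (φ ∘ₗ f) z :=
  LinearMap.congr_fun (TensorProduct.ext' (g := sliceLeft φ ∘ₗ f.rTensor P)
    (h := sliceLeft (φ ∘ₗ f)) fun x y => by simp) z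

theorem sliceRight_lTensor (φ : N →ₗ[ℂ] ℂ) (f : M →ₗ[ℂ] N) (z : P ⊗[ℂ] M) :
    sliceRight φ (f.lTensor P z) = sliceRight (φ ∘ₗ f) z :=
  LinearMap.congr_fun (TensorProduct.ext' (g := sliceRight φ ∘ₗ f.lTensor P)
    (h := sliceRight (φ ∘ₗ f)) fun x y => by simp) z

theorem sliceLeft_comm (φ : M →ₗ[ℂ] ℂ) (z : P ⊗[ℂ] M) :
    sliceLeft φ (TensorProduct.comm ℂ P M z) = sliceRight φ z :=
  LinearMap.congr_fun (TensorProduct.ext' (g := sliceLeft φ ∘ₗ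
    (TensorProduct.comm ℂ P M).toLinearMap) (h := sliceRight φ) fun x y => by simp) z

theorem sliceRight_comm (φ : M →ₗ[ℂ] ℂ) (z : M ⊗[ℂ] P) :
    sliceRight φ (TensorProduct.comm ℂ M P z) = sliceLeft φ z :=
  LinearMap.congr_fun (TensorProduct.ext' (g := sliceRight φ ∘ₗ
    (TensorProduct.comm ℂ M P).toLinearMap) (h := sliceLeft φ) fun x y => by simp) z

theorem apply_sliceLeft (φ : M →ₗ[ℂ] ℂ) (ψ : P →ₗ[ℂ] ℂ) (z : M ⊗[ℂ] P) :
    ψ (sliceLeft φ z) = φ (sliceRight ψ z) :=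
  LinearMap.congr_fun (TensorProduct.ext' (g := ψ ∘ₗ sliceLeft φ)
    (h := φ ∘ₗ sliceRight ψ) fun x y => by simp [mul_comm]) z

/-- Two linear maps that agree on pure tensors agree. -/
theorem TensorProduct.induction_eq {f g : M ⊗[ℂ] N →ₗ[ℂ] P} (h : ∀ x y, f (x ⊗ₜ y) = g (x ⊗ₜ y))
    (z : M ⊗[ℂ] N) : f z = g z :=
  LinearMap.congr_fun (TensorProduct.ext' h) z

end

/-! ### The canonical maps, and `E` as a unit for `Δ(A)`. -/

namespace WeakMultiplierHopfAlgebra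

open MultiplierAlgebra

variable {A : Type*} [NonUnitalRing A] [Module ℂ A] [IsScalarTower ℂ A A] [SMulCommClass ℂ A A]
variable {V : Type*} [AddCommGroup V] [Module ℂ V]

section Single

variable (H : WeakMultiplierHopfAlgebra A)

/-- Two linear maps on `A` agree if they agree on products, as `A² = A`. -/
theorem ext_mul (H : WeakMultiplierHopfAlgebra A) {f g : A →ₗ[ℂ] V} (h : ∀ x y, f (x * y) = g (x * y)) : f = g := by
  ext a
  obtain ⟨t, rfl⟩ := H.idempotent a
  exact TensorProduct.induction_eq (f := f ∘ₗ LinearMap.mul' ℂ A) (g := g ∘ₗ LinearMap.mul' ℂ A)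
    (fun x y => by simpa using h x y) t

theorem nondegenerate₂ (H : WeakMultiplierHopfAlgebra A) : NonDegenerateProduct (A ⊗[ℂ] A) := H.nondegenerate.tensor H.nondegenerate

theorem T₁_mul (a b : A) (z : A ⊗[ℂ] A) :
    H.T₁ (a ⊗ₜ b) * z = left (H.Δ a) ((mulLeft ℂ b).lTensor A z) := by
  have := congrArg (fun m => left m z) (H.T₁_spec a b)
  exact this

theorem mul_T₂ (a b : A) (z : A ⊗[ℂ] A) :
    z * H.T₂ (a ⊗ₜ b) = right (H.Δ b) ((mulRight ℂ a).rTensor A z) := by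
  have := congrArg (fun m => right m z) (H.T₂_spec a b)
  exact this

theorem lTensor_mulLeft_mul (b : A) (z w : A ⊗[ℂ] A) :
    (mulRight ℂ b).lTensor A z * w = z * (mulLeft ℂ b).lTensor A w := by
  induction z with
  | zero => simp
  | add x y hx hy => simp only [map_add, add_mul, hx, hy]
  | tmul x y =>
    induction w with
    | zero => simp
    | add x y hx hy => simp only [map_add, mul_add, hx, hy]
    | tmul u v => simp [Algebra.TensorProduct.tmul_mul_tmul, mul_assoc]

theorem rTensor_mulLeft_mul (b : A) (z w : A ⊗[ℂ] A) :
    (mulRight ℂ b).rTensor A z * w = z * (mulLeft ℂ b).rTensor A w := by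
  induction z with
  | zero => simp
  | add x y hx hy => simp only [map_add, add_mul, hx, hy]
  | tmul x y =>
    induction w with
    | zero => simp
    | add x y hx hy => simp only [map_add, mul_add, hx, hy]
    | tmul u v => simp [Algebra.TensorProduct.tmul_mul_tmul, mul_assoc]

theorem T₁_tmul_mul (a b c : A) :
    H.T₁ (a ⊗ₜ (b * c)) = (mulRight ℂ c).lTensor A (H.T₁ (a ⊗ₜ b)) := by
  refine H.nondegenerate₂.eq_of_mul_right fun w => ?_
  rw [lTensor_mulLeft_mul, T₁_mul, T₁_mul, ← LinearMap.lTensor_comp_apply]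
  congr 3
  exact LinearMap.mulLeft_mul ℂ A b c

theorem T₂_mul_tmul (a b c : A) :
    H.T₂ ((c * a) ⊗ₜ b) = (mulLeft ℂ c).rTensor A (H.T₂ (a ⊗ₜ b)) := by
  refine H.nondegenerate₂.eq_of_mul_left fun w => ?_
  rw [← rTensor_mulLeft_mul, mul_T₂, mul_T₂, ← LinearMap.rTensor_comp_apply]
  congr 3
  exact LinearMap.mulRight_mul ℂ A c a

theorem left_lTensor_mulRight (hA : NonDegenerateProduct A) (m : MultiplierAlgebra (A ⊗[ℂ] A))
    (z : A ⊗[ℂ] A) (y : A) :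
    left m ((mulRight ℂ y).lTensor A z) = (mulRight ℂ y).lTensor A (left m z) :=
  (hA.tensor hA).eq_of_mul_right fun w => by
    rw [← left_mul_apply, lTensor_mulLeft_mul, left_mul_apply, lTensor_mulLeft_mul]

theorem left_rTensor_mulRight (hA : NonDegenerateProduct A) (m : MultiplierAlgebra (A ⊗[ℂ] A))
    (z : A ⊗[ℂ] A) (y : A) :
    left m ((mulRight ℂ y).rTensor A z) = (mulRight ℂ y).rTensor A (left m z) :=
  (hA.tensor hA).eq_of_mul_right fun w => by
    rw [← left_mul_apply, rTensor_mulLeft_mul, left_mul_apply, rTensor_mulLeft_mul]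

theorem right_lTensor_mulLeft (hA : NonDegenerateProduct A) (m : MultiplierAlgebra (A ⊗[ℂ] A))
    (z : A ⊗[ℂ] A) (y : A) :
    right m ((mulLeft ℂ y).lTensor A z) = (mulLeft ℂ y).lTensor A (right m z) :=
  (hA.tensor hA).eq_of_mul_left fun w => by
    rw [← right_mul_apply, ← lTensor_mulLeft_mul, right_mul_apply, ← lTensor_mulLeft_mul]

theorem right_rTensor_mulLeft (hA : NonDegenerateProduct A) (m : MultiplierAlgebra (A ⊗[ℂ] A))
    (z : A ⊗[ℂ] A) (y : A) :
    right m ((mulLeft ℂ y).rTensor A z) = (mulLeft ℂ y).rTensor A (right m z) :=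
  (hA.tensor hA).eq_of_mul_left fun w => by
    rw [← right_mul_apply, ← rTensor_mulLeft_mul, right_mul_apply, ← rTensor_mulLeft_mul]

/-- `Δ(a)(x ⊗ y) = (Δ(a)(1 ⊗ y))(x ⊗ 1)`. -/
theorem left_Δ_tmul (a x y : A) :
    left (H.Δ a) (x ⊗ₜ y) = (mulRight ℂ x).rTensor A (H.T₁ (a ⊗ₜ y)) := by
  have : left (H.Δ a) ∘ₗ TensorProduct.mk ℂ A A x =
      (mulRight ℂ x).rTensor A ∘ₗ H.T₁ ∘ₗ TensorProduct.mk ℂ A A a := by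
    refine H.ext_mul fun b y => ?_
    have := H.T₁_mul a b (x ⊗ₜ y)
    simp only [LinearMap.lTensor_tmul, LinearMap.mulLeft_apply,
      TensorProduct.mul_tmul_eq_map] at this
    simp [← this, T₁_tmul_mul, TensorProduct.map_eq_rTensor_lTensor]
  exact LinearMap.congr_fun this y

/-- `(x ⊗ y)Δ(b) = (1 ⊗ y)((x ⊗ 1)Δ(b))`. -/
theorem right_Δ_tmul (b x y : A) :
    right (H.Δ b) (x ⊗ₜ y) = (mulLeft ℂ y).lTensor A (H.T₂ (x ⊗ₜ b)) := by
  have : right (H.Δ b) ∘ₗ (TensorProduct.mk ℂ A A).flip y =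
      (mulLeft ℂ y).lTensor A ∘ₗ H.T₂ ∘ₗ (TensorProduct.mk ℂ A A).flip b := by
    refine H.ext_mul fun x a => ?_
    have := H.mul_T₂ a b (x ⊗ₜ y)
    simp only [LinearMap.rTensor_tmul, LinearMap.mulRight_apply,
      TensorProduct.tmul_mul_eq_map] at this
    simp [← this, T₂_mul_tmul, TensorProduct.map_eq_lTensor_rTensor]
  exact LinearMap.congr_fun this x

theorem T₂_mul (d a : A) (w : A ⊗[ℂ] A) :
    H.T₂ (d ⊗ₜ a) * w = (mulLeft ℂ d).rTensor A (left (H.Δ a) w) := by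
  refine H.nondegenerate₂.eq_of_mul_left fun z => ?_
  rw [← mul_assoc, mul_T₂, right_mul_eq, rTensor_mulLeft_mul]

/-- `(d ⊗ 1)(Δ(a)(1 ⊗ b)) = ((d ⊗ 1)Δ(a))(1 ⊗ b)`. -/
theorem rTensor_mulLeft_T₁ (d a b : A) :
    (mulLeft ℂ d).rTensor A (H.T₁ (a ⊗ₜ b)) = (mulRight ℂ b).lTensor A (H.T₂ (d ⊗ₜ a)) := by
  refine H.nondegenerate₂.eq_of_mul_right fun w => ?_
  rw [lTensor_mulLeft_mul, T₂_mul, ← T₁_mul]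
  have key : ∀ z : A ⊗[ℂ] A, (mulLeft ℂ d).rTensor A z * w =
      (mulLeft ℂ d).rTensor A (z * w) := fun z => by
    refine H.nondegenerate₂.eq_of_mul_left fun v => ?_
    rw [← mul_assoc, ← rTensor_mulLeft_mul, ← rTensor_mulLeft_mul, mul_assoc]
  exact key _

theorem left_Δ_mul (a b : A) (z : A ⊗[ℂ] A) :
    left (H.Δ (a * b)) z = left (H.Δ a) (left (H.Δ b) z) := by
  rw [map_mul, left_mul]

theorem T₁_mul_tmul (a b c : A) : H.T₁ ((a * b) ⊗ₜ c) = left (H.Δ a) (H.T₁ (b ⊗ₜ c)) := by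
  refine H.nondegenerate.eq_of_rTensor_mulRight fun x => ?_
  rw [← left_Δ_tmul, left_Δ_mul, left_Δ_tmul, left_rTensor_mulRight H.nondegenerate]

theorem left_E_left_E (z : A ⊗[ℂ] A) : left H.E (left H.E z) = left H.E z := by
  rw [← left_mul, H.E_idempotent]

theorem right_E_right_E (z : A ⊗[ℂ] A) : right H.E (right H.E z) = right H.E z := by
  rw [← right_mul, H.E_idempotent]

theorem left_E_T₁ (z : A ⊗[ℂ] A) : left H.E (H.T₁ z) = H.T₁ z := by
  obtain ⟨w, hw⟩ : H.T₁ z ∈ LinearMap.range (left H.E) := H.range_T₁ ▸ ⟨z, rfl⟩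
  rw [← hw, left_E_left_E]

theorem right_E_T₂ (z : A ⊗[ℂ] A) : right H.E (H.T₂ z) = H.T₂ z := by
  obtain ⟨w, hw⟩ : H.T₂ z ∈ LinearMap.range (right H.E) := H.range_T₂ ▸ ⟨z, rfl⟩
  rw [← hw, right_E_right_E]

theorem left_E_left_Δ (a : A) (z : A ⊗[ℂ] A) :
    left H.E (left (H.Δ a) z) = left (H.Δ a) z :=
  TensorProduct.induction_eq (f := left H.E ∘ₗ left (H.Δ a)) (g := left (H.Δ a)) (fun x y => by
    rw [LinearMap.comp_apply, left_Δ_tmul, left_rTensor_mulRight H.nondegenerate, left_E_T₁]) z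

theorem right_E_right_Δ (a : A) (z : A ⊗[ℂ] A) :
    right H.E (right (H.Δ a) z) = right (H.Δ a) z :=
  TensorProduct.induction_eq (f := right H.E ∘ₗ right (H.Δ a)) (g := right (H.Δ a)) (fun x y => by
    rw [LinearMap.comp_apply, right_Δ_tmul, right_lTensor_mulLeft H.nondegenerate, right_E_T₂]) z

/-- Only the right parts are directly accessible: `(A ⊗ A)Δ(a)` lies in `(A ⊗ A)E`. Multiplying by
an arbitrary `w` on the left transfers this to the left parts. -/
theorem left_Δ_left_E (a : A) (z : A ⊗[ℂ] A) :
    left (H.Δ a) (left H.E z) = left (H.Δ a) z := by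
  refine H.nondegenerate₂.eq_of_mul_left fun w => ?_
  rw [← right_mul_eq, ← right_mul_eq, right_E_right_Δ, right_mul_eq]

/-- The space `(A ⊗ A)E` is spanned by the `(d ⊗ 1)Δ(a)`, so `E z` is determined by all the `Δ(a)z`.
Identities behind `E` can thus be checked behind every `Δ(a)`, where Sweedler calculus is available.
-/
theorem left_E_eq_of_left_Δ_eq {z w : A ⊗[ℂ] A}
    (h : ∀ a, left (H.Δ a) z = left (H.Δ a) w) : left H.E z = left H.E w := by
  refine H.nondegenerate₂.eq_of_mul_left fun v => ?_
  rw [← right_mul_eq, ← right_mul_eq]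
  obtain ⟨u, hu⟩ : right H.E v ∈ LinearMap.range H.T₂ := H.range_T₂ ▸ ⟨v, rfl⟩
  rw [← hu]
  clear hu
  induction u with
  | zero => simp
  | add x y hx hy => rw [map_add, add_mul, add_mul, hx, hy]
  | tmul d a => rw [T₂_mul, T₂_mul, h]

theorem sliceLeft_T₁ (a b : A) : sliceLeft H.ε (H.T₁ (a ⊗ₜ b)) = a * b := H.counit_left a b

theorem sliceRight_T₂ (a b : A) : sliceRight H.ε (H.T₂ (a ⊗ₜ b)) = a * b := H.counit_right a b

/-- The coproduct is full: a map that kills the left legs of all `Δ(a)(1 ⊗ b)` is zero. -/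
theorem eq_zero_of_rTensor_T₁ (f : A →ₗ[ℂ] V) (h : ∀ a b, f.rTensor A (H.T₁ (a ⊗ₜ b)) = 0) :
    f = 0 := by
  refine LinearMap.ker_eq_top.1 (H.full_left (LinearMap.ker f) ?_)
  rintro _ ⟨z, rfl⟩
  exact (Module.Flat.rTensor_exact A (LinearMap.exact_subtype_ker_map f) _).1
    (TensorProduct.induction_eq (f := f.rTensor A ∘ₗ H.T₁) (g := 0) h z)

theorem eq_zero_of_lTensor_T₂ (f : A →ₗ[ℂ] V) (h : ∀ a b, f.lTensor A (H.T₂ (a ⊗ₜ b)) = 0) :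
    f = 0 := by
  refine LinearMap.ker_eq_top.1 (H.full_right (LinearMap.ker f) ?_)
  rintro _ ⟨z, rfl⟩
  exact (Module.Flat.lTensor_exact A (LinearMap.exact_subtype_ker_map f) _).1
    (TensorProduct.induction_eq (f := f.lTensor A ∘ₗ H.T₂) (g := 0) h z)

end Single

end WeakMultiplierHopfAlgebra

section

variable {M N P Q : Type*} [AddCommGroup M] [Module ℂ M] [AddCommGroup N] [Module ℂ N]
  [AddCommGroup P] [Module ℂ P] [AddCommGroup Q] [Module ℂ Q]

theorem eq_of_sliceRight_eq {z w : P ⊗[ℂ] M} (h : ∀ ω : M →ₗ[ℂ] ℂ, sliceRight ω z = sliceRight ω w) :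
    z = w :=
  TensorProduct.eq_of_lTensor_eq (fun ω : Module.Dual ℂ M => ω)
    (fun x hx => (Module.forall_dual_apply_eq_zero_iff ℂ x).1 hx)
    fun ω => (TensorProduct.rid ℂ P).injective (h ω)

theorem TensorProduct.lTensor_sliceRight_assoc (φ : M →ₗ[ℂ] ℂ) (z : (P ⊗[ℂ] Q) ⊗[ℂ] M) :
    (sliceRight φ).lTensor P (TensorProduct.assoc ℂ P Q M z) = sliceRight φ z := by
  induction z with
  | zero => simp
  | add x y hx hy => simp only [map_add, hx, hy]
  | tmul w m =>
    induction w with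
    | zero => simp
    | add x y hx hy => simp only [map_add, TensorProduct.add_tmul, hx, hy]
    | tmul p q => simp

theorem TensorProduct.rTensor_assoc (f : P →ₗ[ℂ] N) (z : (P ⊗[ℂ] Q) ⊗[ℂ] M) :
    f.rTensor (Q ⊗[ℂ] M) (TensorProduct.assoc ℂ P Q M z) =
      TensorProduct.assoc ℂ N Q M ((f.rTensor Q).rTensor M z) := by
  induction z with
  | zero => simp
  | add x y hx hy => simp only [map_add, hx, hy]
  | tmul w m =>
    induction w with
    | zero => simp
    | add x y hx hy => simp only [map_add, TensorProduct.add_tmul, hx, hy]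
    | tmul p q => simp

end

/-! ### Colinear maps, and the projection along the kernel of `T₁`. -/

namespace WeakMultiplierHopfAlgebra

open MultiplierAlgebra

variable {A : Type*} [NonUnitalRing A] [Module ℂ A] [IsScalarTower ℂ A A] [SMulCommClass ℂ A A]
variable {V : Type*} [AddCommGroup V] [Module ℂ V]

/-- The map `a ↦ Δ(a)(1 ⊗ b)`. -/
noncomputable def δ₁ (H : WeakMultiplierHopfAlgebra A) (b : A) : A →ₗ[ℂ] A ⊗[ℂ] A :=
  H.T₁ ∘ₗ (TensorProduct.mk ℂ A A).flip b

/-- The map `a ↦ (c ⊗ 1)Δ(a)`. -/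
noncomputable def δ₂ (H : WeakMultiplierHopfAlgebra A) (c : A) : A →ₗ[ℂ] A ⊗[ℂ] A :=
  H.T₂ ∘ₗ TensorProduct.mk ℂ A A c

/-- The map `a ↦ Δ(a)(x ⊗ 1)`, where `H` carries the opposite coproduct `Δ^cop`. -/
noncomputable def δ₄ (H : WeakMultiplierHopfAlgebra A) (x : A) : A →ₗ[ℂ] A ⊗[ℂ] A :=
  (TensorProduct.comm ℂ A A).toLinearMap ∘ₗ H.δ₁ x

/-- The map `a ↦ Δ(a)w`, for `w` in `A ⊗ A`. -/
noncomputable def comulMul (H : WeakMultiplierHopfAlgebra A) (w : A ⊗[ℂ] A) : A →ₗ[ℂ] A ⊗[ℂ] A where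
  toFun a := left (H.Δ a) w
  map_add' a b := by rw [map_add]; rfl
  map_smul' c a := by rw [map_smul]; rfl

section Single

variable (H : WeakMultiplierHopfAlgebra A)

theorem δ₁_apply (a b : A) : H.δ₁ b a = H.T₁ (a ⊗ₜ b) := rfl

theorem δ₂_apply (a c : A) : H.δ₂ c a = H.T₂ (c ⊗ₜ a) := rfl

theorem δ₄_apply (a x : A) : H.δ₄ x a = TensorProduct.comm ℂ A A (H.δ₁ x a) := rfl

theorem comulMul_apply (a : A) (w : A ⊗[ℂ] A) : H.comulMul w a = left (H.Δ a) w := rfl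

/-- A map `X : A → V ⊗ A` is colinear if it commutes with the coproduct acting from the right. -/
def IsColinear (X : A →ₗ[ℂ] V ⊗[ℂ] A) : Prop :=
  ∀ a b : A, TensorProduct.assoc ℂ V A A (X.rTensor A (H.δ₁ b a)) = (H.δ₁ b).lTensor V (X a)

theorem isColinear_δ₂ (c : A) : H.IsColinear (H.δ₂ c) := by
  intro a b
  have h := H.coassoc a b c
  have h₁ : ∀ z : A ⊗[ℂ] A, H.T₂.rTensor A ((TensorProduct.assoc ℂ A A A).symm (c ⊗ₜ[ℂ] z)) =
      (H.δ₂ c).rTensor A z :=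
    TensorProduct.induction_eq (f := H.T₂.rTensor A ∘ₗ
      (TensorProduct.assoc ℂ A A A).symm.toLinearMap ∘ₗ TensorProduct.mk ℂ A (A ⊗[ℂ] A) c)
      fun x y => by simp [δ₂]
  have h₂ : ∀ z : A ⊗[ℂ] A, H.T₁.lTensor A (TensorProduct.assoc ℂ A A A (z ⊗ₜ[ℂ] b)) =
      (H.δ₁ b).lTensor A z :=
    TensorProduct.induction_eq (f := H.T₁.lTensor A ∘ₗ
      (TensorProduct.assoc ℂ A A A).toLinearMap ∘ₗ (TensorProduct.mk ℂ (A ⊗[ℂ] A) A).flip b)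
      fun x y => by simp [δ₁]
  rw [h₁, h₂] at h
  exact h

/-- Colinearity followed by `φ` on the last leg. By fullness such slices span `A`, and this is how
colinear maps get evaluated. -/
theorem IsColinear.slice {H : WeakMultiplierHopfAlgebra A} {X : A →ₗ[ℂ] V ⊗[ℂ] A}
    (hX : H.IsColinear X) (φ : A →ₗ[ℂ] ℂ) (a b : A) :
    X (sliceRight φ (H.δ₁ b a)) = (sliceRight φ ∘ₗ H.δ₁ b).lTensor V (X a) := by
  rw [← sliceRight_rTensor, ← TensorProduct.lTensor_sliceRight_assoc, hX,
    LinearMap.lTensor_comp_apply]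

/-- Fullness: `A` is spanned by the elements `(ι ⊗ ω)(Δ(a)(1 ⊗ c))`. -/
theorem eq_zero_of_slice (f : A →ₗ[ℂ] V)
    (h : ∀ (ω : A →ₗ[ℂ] ℂ) (a c : A), f (sliceRight ω (H.δ₁ c a)) = 0) : f = 0 :=
  H.eq_zero_of_rTensor_T₁ f fun a b => eq_of_sliceRight_eq fun ω => by
    rw [sliceRight_rTensor, map_zero]
    exact h ω a b

/-- The map `b ⊗ c ↦ (ι ⊗ ω)(Δ(a)(1 ⊗ c)) ⊗ b`. -/
noncomputable def insertSlice (ω : A →ₗ[ℂ] ℂ) (a : A) : A ⊗[ℂ] A →ₗ[ℂ] A ⊗[ℂ] A :=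
  (TensorProduct.comm ℂ A A).toLinearMap ∘ₗ
    (sliceRight ω ∘ₗ H.T₁ ∘ₗ TensorProduct.mk ℂ A A a).lTensor A

theorem insertSlice_tmul (ω : A →ₗ[ℂ] ℂ) (a b c : A) :
    H.insertSlice ω a (b ⊗ₜ c) = sliceRight ω (H.δ₁ c a) ⊗ₜ b := rfl

/-- By fullness the first entries `(ι ⊗ ω)(Δ(a)(1 ⊗ c))` span `A`, so the elements `H.insertSlice ω
a z` span `A ⊗ A`. -/
theorem ext_insertSlice {f g : A ⊗[ℂ] A →ₗ[ℂ] V}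
    (h : ∀ (ω : A →ₗ[ℂ] ℂ) (a : A) (z : A ⊗[ℂ] A),
      f (H.insertSlice ω a z) = g (H.insertSlice ω a z)) : f = g := by
  refine TensorProduct.ext' fun x b => ?_
  have := H.eq_zero_of_slice ((f - g) ∘ₗ (TensorProduct.mk ℂ A A).flip b) fun ω a c => by
    have := h ω a (b ⊗ₜ c)
    rw [insertSlice_tmul] at this
    simp [this]
  have := LinearMap.congr_fun this x
  simpa [sub_eq_zero] using this

/-- The projection `G₁` onto a complement of the kernel of `T₁`. -/
theorem exists_kerProj : ∃ G : A ⊗[ℂ] A →ₗ[ℂ] A ⊗[ℂ] A,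
    (∀ (ω : A →ₗ[ℂ] ℂ) (a : A) (z : A ⊗[ℂ] A),
      G (H.insertSlice ω a z) = H.insertSlice ω a (left H.E z)) ∧
    (∀ z, H.T₁ z = 0 → G z = 0) ∧ (∀ z, H.T₁ (G z) = H.T₁ z) ∧ (∀ z, G (G z) = G z) := by
  obtain ⟨G, hG, hker⟩ := H.ker_T₁
  have h₁ : ∀ (ω : A →ₗ[ℂ] ℂ) (a : A) (z : A ⊗[ℂ] A),
      G (H.insertSlice ω a z) = H.insertSlice ω a (left H.E z) := by
    intro ω a
    -- Slicing the last leg of `Δ₁₃(a)(1 ⊗ b ⊗ c)` by `ω` turns the defining three-leg equation of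
    -- `G₁` into a formula on `A ⊗ A`.
    have hD : ∀ w : A ⊗[ℂ] A, (sliceRight ω).lTensor A
        ((TensorProduct.leftComm ℂ A A A) (H.T₁.lTensor A
          (TensorProduct.leftComm ℂ A A A (a ⊗ₜ[ℂ] w)))) = H.insertSlice ω a w :=
      TensorProduct.induction_eq (f := (sliceRight ω).lTensor A ∘ₗ
        (TensorProduct.leftComm ℂ A A A).toLinearMap ∘ₗ H.T₁.lTensor A ∘ₗ
        (TensorProduct.leftComm ℂ A A A).toLinearMap ∘ₗ TensorProduct.mk ℂ A (A ⊗[ℂ] A) a)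
        fun b c => by
          rw [insertSlice_tmul, δ₁_apply]
          simp only [LinearMap.comp_apply, LinearEquiv.coe_coe, TensorProduct.mk_apply,
            TensorProduct.leftComm_tmul, LinearMap.lTensor_tmul]
          exact TensorProduct.induction_eq (f := (sliceRight ω).lTensor A ∘ₗ
            (TensorProduct.leftComm ℂ A A A).toLinearMap ∘ₗ TensorProduct.mk ℂ A (A ⊗[ℂ] A) b)
            (g := (TensorProduct.mk ℂ A A).flip b ∘ₗ sliceRight ω)
            (fun x y => by simp [TensorProduct.smul_tmul']) (H.T₁ (a ⊗ₜ c))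
    refine TensorProduct.induction_eq (f := G ∘ₗ H.insertSlice ω a)
      (g := H.insertSlice ω a ∘ₗ left H.E) fun b c => ?_
    have h := congrArg ((sliceRight ω).lTensor A) (hG a b c)
    simp only [LinearMap.comp_apply, LinearEquiv.coe_coe] at h
    rw [hD, TensorProduct.lTensor_sliceRight_assoc, sliceRight_rTensor,
      ← TensorProduct.lTensor_sliceRight_assoc, LinearEquiv.apply_symm_apply, hD] at h
    exact h
  -- The slices span `A ⊗ A` and `G` acts on them through `E`, so `G` inherits idempotency. Then the
  -- range of `1 - G` is also the kernel of `G`.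
  have h₂ : G ∘ₗ G = G := H.ext_insertSlice fun ω a z => by
    rw [LinearMap.comp_apply, h₁, h₁, left_E_left_E]
  have h₂' : ∀ z, G (G z) = G z := LinearMap.congr_fun h₂
  refine ⟨G, h₁, fun z hz => ?_, fun z => ?_, h₂'⟩
  · obtain ⟨w, rfl⟩ : z ∈ LinearMap.range (LinearMap.id - G) := hker ▸ hz
    simp [h₂']
  · have : z - G z ∈ LinearMap.ker H.T₁ := hker ▸ ⟨z, rfl⟩
    rw [LinearMap.mem_ker, map_sub, sub_eq_zero] at this
    exact this.symm

end Single

/-! ### Regularity: the coopposite structure and the elements `Δ(a)(x ⊗ 1)`. -/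

section Coopposite

variable {H H' : WeakMultiplierHopfAlgebra A}

theorem coopposite_symm (h : ∀ a, H'.Δ a = flip (H.Δ a)) (a : A) : H.Δ a = flip (H'.Δ a) := by
  rw [h, MultiplierAlgebra.flip_flip]

theorem left_Δ_tmul' (h : ∀ a, H'.Δ a = flip (H.Δ a)) (a x y : A) :
    left (H.Δ a) (x ⊗ₜ y) = (mulRight ℂ y).lTensor A (H'.δ₄ x a) := by
  rw [coopposite_symm h, left_flip, TensorProduct.comm_symm_tmul, left_Δ_tmul,
    TensorProduct.comm_rTensor]
  rfl

theorem rTensor_mulLeft_δ₄ (h : ∀ a, H'.Δ a = flip (H.Δ a)) (d x a : A) :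
    (mulLeft ℂ d).rTensor A (H'.δ₄ x a) = (mulRight ℂ x).rTensor A (H.δ₂ d a) := by
  refine H.nondegenerate.eq_of_lTensor_mulRight fun y => ?_
  rw [← TensorProduct.rTensor_lTensor_comm, ← left_Δ_tmul' h, ← T₂_mul,
    TensorProduct.mul_tmul_eq_map, TensorProduct.map_eq_lTensor_rTensor]
  rfl

theorem δ₄_mul (h : ∀ a, H'.Δ a = flip (H.Δ a)) (x a b : A) :
    H'.δ₄ x (a * b) = left (H.Δ a) (H'.δ₄ x b) := by
  refine H.nondegenerate.eq_of_lTensor_mulRight fun y => ?_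
  rw [← left_Δ_tmul' h, left_Δ_mul, left_Δ_tmul' h, left_lTensor_mulRight H.nondegenerate]

theorem left_E_δ₄ (h : ∀ a, H'.Δ a = flip (H.Δ a)) (x a : A) :
    left H.E (H'.δ₄ x a) = H'.δ₄ x a := by
  refine H.nondegenerate.eq_of_lTensor_mulRight fun y => ?_
  rw [← left_lTensor_mulRight H.nondegenerate, ← left_Δ_tmul' h, left_E_left_Δ]

/-- A left multiplication by `c` converts `Δ(a)(x ⊗ 1)` into `((c ⊗ 1)Δ(a))(x ⊗ 1)`, to which the
right counit property applies. -/
theorem sliceRight_δ₄ (h : ∀ a, H'.Δ a = flip (H.Δ a)) (x a : A) :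
    sliceRight H.ε (H'.δ₄ x a) = a * x := by
  refine H.nondegenerate.eq_of_mul_left fun c => ?_
  have := sliceRight_rTensor H.ε (mulLeft ℂ c) (H'.δ₄ x a)
  rw [rTensor_mulLeft_δ₄ h, sliceRight_rTensor, δ₂_apply, sliceRight_T₂] at this
  simpa [mul_assoc] using this.symm

/-- With `F` the flip of `E`, the product `F E'` equals both `E'` and `F`. The range of `T₁` for
`H'` gives the first equality, the range of `T₂` for `H` the second. -/
theorem coopposite_E (h : ∀ a, H'.Δ a = flip (H.Δ a)) : H'.E = flip H.E := by
  have hA := H.nondegenerate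
  have h₁ : ∀ z, left (flip H.E) (left H'.E z) = left H'.E z := by
    intro z
    obtain ⟨w, hw⟩ : left H'.E z ∈ LinearMap.range H'.T₁ := H'.range_T₁ ▸ ⟨z, rfl⟩
    rw [← hw]
    refine TensorProduct.induction_eq (f := left (flip H.E) ∘ₗ H'.T₁) (g := H'.T₁)
      (fun a x => ?_) w
    have := left_E_δ₄ h x a
    rw [δ₄_apply] at this
    rw [LinearMap.comp_apply, left_flip, ← δ₁_apply]
    exact (TensorProduct.comm ℂ A A).injective (by simpa using this)
  have h₂ : ∀ z, right H'.E (right (flip H.E) z) = right (flip H.E) z := by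
    intro z
    rw [right_flip]
    obtain ⟨w, hw⟩ : right H.E ((TensorProduct.comm ℂ A A).symm z) ∈ LinearMap.range H.T₂ :=
      H.range_T₂ ▸ ⟨_, rfl⟩
    rw [← hw]
    refine TensorProduct.induction_eq (f := right H'.E ∘ₗ
      (TensorProduct.comm ℂ A A).toLinearMap ∘ₗ H.T₂)
      (g := (TensorProduct.comm ℂ A A).toLinearMap ∘ₗ H.T₂) (fun d a => ?_) w
    refine hA.eq_of_rTensor_mulLeft fun y => ?_
    simp only [LinearMap.comp_apply, LinearEquiv.coe_coe]
    rw [← right_rTensor_mulLeft hA, ← TensorProduct.comm_lTensor, ← right_Δ_tmul]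
    have : TensorProduct.comm ℂ A A (right (H.Δ a) (d ⊗ₜ y)) = right (H'.Δ a) (y ⊗ₜ d) := by
      rw [h, right_flip]; simp
    rw [this, right_E_right_Δ]
  have hl : left H'.E = left (flip H.E) := by
    refine LinearMap.ext fun z => H.nondegenerate₂.eq_of_mul_left fun w => ?_
    rw [← right_mul_eq (flip H.E), ← h₂, right_mul_eq, right_mul_eq, h₁]
  refine ext_left_right hl (LinearMap.ext fun z => H.nondegenerate₂.eq_of_mul_right fun w => ?_)
  rw [right_mul_eq, right_mul_eq, hl]

/-- Both counits send `Δ^cop(a)(1 ⊗ b)` to `ab` when applied to its first leg, and by fullness the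
first legs span `A`. -/
theorem coopposite_ε (h : ∀ a, H'.Δ a = flip (H.Δ a)) : H'.ε = H.ε := by
  refine sub_eq_zero.1 (H'.eq_zero_of_rTensor_T₁ _ fun a b => ?_)
  apply (TensorProduct.lid ℂ A).injective
  have h₁ := H'.sliceLeft_T₁ a b
  have h₂ := sliceRight_δ₄ h b a
  rw [δ₄_apply, sliceRight_comm, δ₁_apply, ← h₁] at h₂
  rw [LinearMap.rTensor_sub, LinearMap.sub_apply, map_sub, map_zero, sub_eq_zero]
  exact h₂.symm

/-- Left multiplication by `d` on the first leg reduces the claim to coassociativity in the form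
`isColinear_δ₂`. -/
theorem isColinear_δ₄ (h : ∀ a, H'.Δ a = flip (H.Δ a)) (x : A) : H.IsColinear (H'.δ₄ x) := by
  intro a b
  refine H.nondegenerate.eq_of_rTensor_mulLeft fun d => ?_
  have h₁ : (mulLeft ℂ d).rTensor A ∘ₗ H'.δ₄ x = (mulRight ℂ x).rTensor A ∘ₗ H.δ₂ d :=
    LinearMap.ext (rTensor_mulLeft_δ₄ h d x)
  rw [TensorProduct.rTensor_assoc, ← LinearMap.rTensor_comp_apply, h₁,
    LinearMap.rTensor_comp_apply, ← TensorProduct.rTensor_assoc, isColinear_δ₂,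
    TensorProduct.rTensor_lTensor_comm, TensorProduct.rTensor_lTensor_comm,
    rTensor_mulLeft_δ₄ h]

theorem sliceRight_left_Δ_δ₄ (h : ∀ a, H'.Δ a = flip (H.Δ a)) (p q x : A) :
    sliceRight H.ε (left (H.Δ p) (H'.δ₄ x q)) = p * (q * x) := by
  rw [← δ₄_mul h, sliceRight_δ₄ h, mul_assoc]

/-- In Sweedler notation the left side is `∑ p₍₁₎ ⊗ p₍₂₎q₍₁₎x ε(p₍₃₎q₍₂₎)`, and multiplicativity of
`Δ` with the counit property collapses it. This exhibits a second element with the same image under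
`T₁` as `p ⊗ qx`, from which `kerProj` is computed. -/
theorem T₁_insertSlice (h : ∀ a, H'.Δ a = flip (H.Δ a)) (p q x : A) :
    H.T₁ (H.insertSlice H.ε p (H'.δ₄ x q)) = H.T₁ (p ⊗ₜ (q * x)) := by
  refine H.nondegenerate.eq_of_rTensor_mulLeft fun d => ?_
  have key : ∀ w : A ⊗[ℂ] A, (mulLeft ℂ d).rTensor A (H.T₁ (H.insertSlice H.ε p w)) =
      (sliceRight H.ε ∘ₗ H.comulMul w).lTensor A (H.δ₂ d p) := by
    intro w
    induction w with
    | zero =>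
      have : H.comulMul 0 = 0 := LinearMap.ext fun a => map_zero (left (H.Δ a))
      simp [this]
    | add w₁ w₂ h₁ h₂ =>
      have : H.comulMul (w₁ + w₂) = H.comulMul w₁ + H.comulMul w₂ :=
        LinearMap.ext fun a => map_add (left (H.Δ a)) _ _
      rw [this, LinearMap.comp_add, LinearMap.lTensor_add, LinearMap.add_apply, map_add, map_add,
        map_add, h₁, h₂]
    | tmul u v =>
      rw [insertSlice_tmul, rTensor_mulLeft_T₁, ← δ₂_apply, (H.isColinear_δ₂ d).slice,
        ← LinearMap.lTensor_comp_apply]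
      congr 2
      ext a
      simp only [LinearMap.comp_apply, comulMul_apply]
      rw [left_Δ_tmul, sliceRight_rTensor]
      rfl
  rw [key, rTensor_mulLeft_T₁, ← δ₂_apply]
  congr 2
  ext a
  rw [LinearMap.comp_apply, comulMul_apply, sliceRight_left_Δ_δ₄ h, LinearMap.mulRight_apply]

end Coopposite

end WeakMultiplierHopfAlgebra

section

variable {M N P Q V W : Type*} [AddCommGroup M] [Module ℂ M] [AddCommGroup N] [Module ℂ N]
  [AddCommGroup P] [Module ℂ P] [AddCommGroup Q] [Module ℂ Q] [AddCommGroup V] [Module ℂ V]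
  [AddCommGroup W] [Module ℂ W]

theorem TensorProduct.map_rTensor_assoc (f : P →ₗ[ℂ] N) (g : Q →ₗ[ℂ] V) (z : (P ⊗[ℂ] Q) ⊗[ℂ] M) :
    TensorProduct.map f (g.rTensor M) (TensorProduct.assoc ℂ P Q M z) =
      TensorProduct.assoc ℂ N V M ((TensorProduct.map f g).rTensor M z) := by
  induction z with
  | zero => simp
  | add x y hx hy => simp only [map_add, hx, hy]
  | tmul w m =>
    induction w with
    | zero => simp
    | add x y hx hy => simp only [map_add, TensorProduct.add_tmul, hx, hy]
    | tmul p q => simp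

theorem TensorProduct.lTensor_rTensor_assoc (g : Q →ₗ[ℂ] V) (z : (P ⊗[ℂ] Q) ⊗[ℂ] M) :
    (g.rTensor M).lTensor P (TensorProduct.assoc ℂ P Q M z) =
      TensorProduct.assoc ℂ P V M ((g.lTensor P).rTensor M z) := by
  induction z with
  | zero => simp
  | add x y hx hy => simp only [map_add, hx, hy]
  | tmul w m =>
    induction w with
    | zero => simp
    | add x y hx hy => simp only [map_add, TensorProduct.add_tmul, hx, hy]
    | tmul p q => simp

theorem TensorProduct.lTensor_lTensor_assoc (g : M →ₗ[ℂ] V) (z : (P ⊗[ℂ] Q) ⊗[ℂ] M) :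
    (g.lTensor Q).lTensor P (TensorProduct.assoc ℂ P Q M z) =
      TensorProduct.assoc ℂ P Q V (g.lTensor (P ⊗[ℂ] Q) z) := by
  induction z with
  | zero => simp
  | add x y hx hy => simp only [map_add, hx, hy]
  | tmul w m =>
    induction w with
    | zero => simp
    | add x y hx hy => simp only [map_add, TensorProduct.add_tmul, hx, hy]
    | tmul p q => simp

end

/-! ### The coproduct on the legs of `E`. -/

namespace WeakMultiplierHopfAlgebra

open MultiplierAlgebra

variable {A : Type*} [NonUnitalRing A] [Module ℂ A] [IsScalarTower ℂ A A] [SMulCommClass ℂ A A]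
variable {V : Type*} [AddCommGroup V] [Module ℂ V]

section Single

variable (H : WeakMultiplierHopfAlgebra A)

theorem left_inLegs₁₂ (m : MultiplierAlgebra (A ⊗[ℂ] A)) (x : A) (z : A ⊗[ℂ] A) :
    left (inLegs₁₂ m) (x ⊗ₜ z) = TensorProduct.assoc ℂ A A A
      ((left m ∘ₗ TensorProduct.mk ℂ A A x).rTensor A z) := by
  induction z with
  | zero => simp
  | add y z hy hz => rw [TensorProduct.tmul_add, map_add, hy, hz, map_add, map_add]
  | tmul y z => rfl

theorem right_inLegs₁₂ (m : MultiplierAlgebra (A ⊗[ℂ] A)) (x : A) (z : A ⊗[ℂ] A) :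
    right (inLegs₁₂ m) (x ⊗ₜ z) = TensorProduct.assoc ℂ A A A
      ((right m ∘ₗ TensorProduct.mk ℂ A A x).rTensor A z) := by
  induction z with
  | zero => simp
  | add y z hy hz => rw [TensorProduct.tmul_add, map_add, hy, hz, map_add, map_add]
  | tmul y z => rfl

theorem left_inLegs₂₃ (m : MultiplierAlgebra (A ⊗[ℂ] A)) (z : A ⊗[ℂ] (A ⊗[ℂ] A)) :
    left (inLegs₂₃ m) z = (left m).lTensor A z := rfl

theorem right_inLegs₂₃ (m : MultiplierAlgebra (A ⊗[ℂ] A)) (z : A ⊗[ℂ] (A ⊗[ℂ] A)) :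
    right (inLegs₂₃ m) z = (right m).lTensor A z := rfl

theorem left_idTensor (p : A ⊗[ℂ] A) (u : A) (z : A ⊗[ℂ] A) :
    left (idTensor H.Δ p) (u ⊗ₜ z) = TensorProduct.map (mulRight ℂ u) (H.comulMul z) p := by
  induction p with
  | zero => rw [map_zero, map_zero]; rfl
  | add x y hx hy => rw [map_add, map_add, ← hx, ← hy]; rfl
  | tmul x w => rfl

theorem eq_of_map_mulRight_rTensor (hA : NonDegenerateProduct A) {Z W : A ⊗[ℂ] (A ⊗[ℂ] A)}
    (h : ∀ u s, TensorProduct.map (mulRight ℂ u) ((mulRight ℂ s).rTensor A) Z =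
      TensorProduct.map (mulRight ℂ u) ((mulRight ℂ s).rTensor A) W) : Z = W := by
  refine hA.eq_of_rTensor_mulRight fun u => ?_
  refine TensorProduct.eq_of_lTensor_eq (fun s : A => (mulRight ℂ s).rTensor A)
    (fun z hz => hA.eq_of_rTensor_mulRight fun s => by rw [hz, map_zero]) fun s => ?_
  rw [← TensorProduct.map_eq_lTensor_rTensor, ← TensorProduct.map_eq_lTensor_rTensor, h]

/-- `(ι ⊗ Δ)(E(x ⊗ w)) = (E ⊗ 1)(x ⊗ Δ(w))`. -/
theorem isColinear_left_E (x : A) : H.IsColinear (left H.E ∘ₗ TensorProduct.mk ℂ A A x) := by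
  intro w t
  refine eq_of_map_mulRight_rTensor H.nondegenerate fun u s => ?_
  have h := congrArg (fun m => left m (u ⊗ₜ[ℂ] (s ⊗ₜ[ℂ] t))) (H.idTensor_E.2.2 (x ⊗ₜ w)).1
  simp only [left_mul, left_idTensor, TensorProduct.map_tmul, left_inLegs₂₃,
    LinearMap.mulRight_apply, LinearMap.lTensor_tmul, comulMul_apply, left_E_left_Δ] at h
  rw [left_inLegs₁₂, left_Δ_tmul] at h
  have h₁ : TensorProduct.map (mulRight ℂ u) (mulRight ℂ s) ∘ₗ left H.E ∘ₗ
      TensorProduct.mk ℂ A A x = (left H.E ∘ₗ TensorProduct.mk ℂ A A (x * u)) ∘ₗ mulRight ℂ s := by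
    ext y
    simp only [LinearMap.comp_apply, TensorProduct.mk_apply]
    rw [← TensorProduct.mul_tmul_eq_map, ← left_mul_apply, TensorProduct.mul_tmul_eq_map]
    rfl
  have h₂ : (mulRight ℂ s).rTensor A ∘ₗ H.δ₁ t = H.comulMul (s ⊗ₜ t) :=
    LinearMap.ext fun a => (H.left_Δ_tmul a s t).symm
  rw [TensorProduct.map_rTensor_assoc, ← LinearMap.rTensor_comp_apply, h₁,
    LinearMap.rTensor_comp_apply, δ₁_apply, h, LinearMap.comp_apply, TensorProduct.mk_apply, ← h₂]
  exact TensorProduct.induction_eq (f := TensorProduct.map (mulRight ℂ u)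
    ((mulRight ℂ s).rTensor A ∘ₗ H.δ₁ t))
    (g := TensorProduct.map (mulRight ℂ u) ((mulRight ℂ s).rTensor A) ∘ₗ (H.δ₁ t).lTensor A)
    (fun x y => by simp) _

theorem right_idTensor_tmul (x w u s t : A) :
    right (idTensor H.Δ (x ⊗ₜ w)) (u ⊗ₜ[ℂ] (s ⊗ₜ[ℂ] t)) =
      (u * x) ⊗ₜ right (H.Δ w) (s ⊗ₜ t) := rfl

theorem right_idTensor (p : A ⊗[ℂ] A) (u s t : A) :
    right (idTensor H.Δ p) (u ⊗ₜ[ℂ] (s ⊗ₜ[ℂ] t)) =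
      TensorProduct.map (mulLeft ℂ u) ((mulLeft ℂ t).lTensor A ∘ₗ H.δ₂ s) p := by
  induction p with
  | zero => rw [map_zero, map_zero]; rfl
  | add x y hx hy => rw [map_add, map_add, ← hx, ← hy]; rfl
  | tmul x w => rw [right_idTensor_tmul, right_Δ_tmul]; rfl

/-- `(ι ⊗ Δ)((x ⊗ w)E) = (x ⊗ Δ(w))(E ⊗ 1)`. -/
theorem isColinear_right_E (x : A) : H.IsColinear (right H.E ∘ₗ TensorProduct.mk ℂ A A x) := by
  intro w t
  have hA := H.nondegenerate
  -- Right parts of multipliers see only left multiplications, so the axiom gives the claim with `(s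
  -- ⊗ 1)Δ(w)` in place of `Δ(w)(1 ⊗ t)`. An extra factor `s` on the middle leg later exchanges the
  -- two.
  have key : ∀ s : A, TensorProduct.assoc ℂ A A A
      ((right H.E ∘ₗ TensorProduct.mk ℂ A A x).rTensor A (H.δ₂ s w)) =
      (H.δ₂ s).lTensor A (right H.E (x ⊗ₜ w)) := by
    intro s
    refine hA.eq_of_rTensor_mulLeft fun u => ?_
    refine TensorProduct.eq_of_lTensor_eq (fun t : A => (mulLeft ℂ t).lTensor A)
      (fun z hz => hA.eq_of_lTensor_mulLeft fun s => by rw [hz, map_zero]) fun t => ?_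
    have h := congrArg (fun m => right m (u ⊗ₜ[ℂ] (s ⊗ₜ[ℂ] t))) (H.idTensor_E.2.2 (x ⊗ₜ w)).2
    simp only [right_mul, H.E_comm, right_idTensor_tmul, right_inLegs₂₃, LinearMap.lTensor_tmul,
      right_E_right_Δ] at h
    rw [right_inLegs₁₂, right_Δ_tmul, right_idTensor] at h
    have h₁ : (mulLeft ℂ u).rTensor A ∘ₗ right H.E ∘ₗ TensorProduct.mk ℂ A A x =
        right H.E ∘ₗ TensorProduct.mk ℂ A A (u * x) := by
      ext y
      simp only [LinearMap.comp_apply, TensorProduct.mk_apply]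
      rw [← right_rTensor_mulLeft hA]
      rfl
    rw [TensorProduct.rTensor_assoc, ← LinearMap.rTensor_comp_apply, h₁,
      TensorProduct.lTensor_lTensor_assoc, ← TensorProduct.rTensor_lTensor_comm, δ₂_apply, h]
    exact TensorProduct.induction_eq (f := TensorProduct.map (mulLeft ℂ u)
      ((mulLeft ℂ t).lTensor A ∘ₗ H.δ₂ s))
      (g := ((mulLeft ℂ t).lTensor A).lTensor A ∘ₗ (mulLeft ℂ u).rTensor (A ⊗[ℂ] A) ∘ₗ
        (H.δ₂ s).lTensor A) (fun x y => by simp) _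
  refine TensorProduct.eq_of_lTensor_eq (fun s : A => (mulLeft ℂ s).rTensor A)
    (fun z hz => hA.eq_of_rTensor_mulLeft fun s => by rw [hz, map_zero]) fun s => ?_
  have h₁ : (mulLeft ℂ s).lTensor A ∘ₗ right H.E ∘ₗ TensorProduct.mk ℂ A A x =
      (right H.E ∘ₗ TensorProduct.mk ℂ A A x) ∘ₗ mulLeft ℂ s := by
    ext y
    simp only [LinearMap.comp_apply, TensorProduct.mk_apply]
    rw [← right_lTensor_mulLeft hA]
    rfl
  have h₂ : (mulLeft ℂ s).rTensor A ∘ₗ H.δ₁ t = (mulRight ℂ t).lTensor A ∘ₗ H.δ₂ s :=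
    LinearMap.ext fun a => H.rTensor_mulLeft_T₁ s a t
  rw [TensorProduct.lTensor_rTensor_assoc, ← LinearMap.rTensor_comp_apply, h₁,
    LinearMap.rTensor_comp_apply, δ₁_apply, rTensor_mulLeft_T₁,
    TensorProduct.rTensor_lTensor_comm, ← TensorProduct.lTensor_lTensor_assoc, ← δ₂_apply, key,
    ← LinearMap.lTensor_comp_apply, ← LinearMap.lTensor_comp_apply, h₂]
  rfl

/-- A map `X : A → V ⊗ A` that intertwines the left multiplications by `E`. -/
def CommutesWithE (X : A →ₗ[ℂ] V ⊗[ℂ] A) : Prop :=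
  ∀ z : A ⊗[ℂ] A, TensorProduct.assoc ℂ V A A (X.rTensor A (left H.E z)) =
    (left H.E).lTensor V (TensorProduct.assoc ℂ V A A (X.rTensor A z))

theorem commutesWithE_right_E (x : A) :
    H.CommutesWithE (right H.E ∘ₗ TensorProduct.mk ℂ A A x) := by
  intro z
  rw [← right_inLegs₁₂, ← right_inLegs₁₂, ← left_inLegs₂₃,
    ← right_left_comm (H.nondegenerate.tensor H.nondegenerate₂)]
  rfl

end Single

section Coopposite

variable {H H' : WeakMultiplierHopfAlgebra A}

theorem coopposite_left_E (h : ∀ a, H'.Δ a = flip (H.Δ a)) (x y : A) :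
    left H'.E (x ⊗ₜ y) = TensorProduct.comm ℂ A A (left H.E (y ⊗ₜ x)) := by
  rw [coopposite_E h, left_flip, TensorProduct.comm_symm_tmul]

/-- This is `(Δ ⊗ ι)(E) = (1 ⊗ E)(E ⊗ 1)`: the formula for `ι ⊗ Δ` in the coopposite structure, read
with the three legs in reverse order. -/
theorem commutesWithE_δ₄ (h : ∀ a, H'.Δ a = flip (H.Δ a)) (y : A) :
    H.CommutesWithE (H'.δ₄ y) := by
  let rev : A ⊗[ℂ] (A ⊗[ℂ] A) →ₗ[ℂ] (A ⊗[ℂ] A) ⊗[ℂ] A :=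
    (TensorProduct.comm ℂ A A).toLinearMap.rTensor A ∘ₗ
      (TensorProduct.comm ℂ A (A ⊗[ℂ] A)).toLinearMap
  refine TensorProduct.induction_eq (f := (TensorProduct.assoc ℂ A A A).toLinearMap ∘ₗ
    (H'.δ₄ y).rTensor A ∘ₗ left H.E) (g := (left H.E).lTensor A ∘ₗ
      (TensorProduct.assoc ℂ A A A).toLinearMap ∘ₗ (H'.δ₄ y).rTensor A) fun w x => ?_
  have h₁ := congrArg (fun t => TensorProduct.assoc ℂ A A A (rev t)) (H'.isColinear_left_E x w y)
  have hl : ∀ d : A ⊗[ℂ] A, TensorProduct.assoc ℂ A A A (rev (TensorProduct.assoc ℂ A A A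
      ((left H'.E ∘ₗ TensorProduct.mk ℂ A A x).rTensor A d))) =
      (left H.E).lTensor A (TensorProduct.assoc ℂ A A A
        (TensorProduct.comm ℂ A A d ⊗ₜ[ℂ] x)) :=
    TensorProduct.induction_eq (f := (TensorProduct.assoc ℂ A A A).toLinearMap ∘ₗ rev ∘ₗ
      (TensorProduct.assoc ℂ A A A).toLinearMap ∘ₗ
      (left H'.E ∘ₗ TensorProduct.mk ℂ A A x).rTensor A)
      (g := (left H.E).lTensor A ∘ₗ (TensorProduct.assoc ℂ A A A).toLinearMap ∘ₗ
        (TensorProduct.mk ℂ (A ⊗[ℂ] A) A).flip x ∘ₗ (TensorProduct.comm ℂ A A).toLinearMap)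
      fun p q => by
        simp only [LinearMap.comp_apply, LinearEquiv.coe_coe, LinearMap.rTensor_tmul,
          TensorProduct.mk_apply, LinearMap.flip_apply, TensorProduct.comm_tmul,
          TensorProduct.assoc_tmul, LinearMap.lTensor_tmul, coopposite_left_E h]
        exact TensorProduct.induction_eq (f := (TensorProduct.assoc ℂ A A A).toLinearMap ∘ₗ
          rev ∘ₗ (TensorProduct.assoc ℂ A A A).toLinearMap ∘ₗ
          (TensorProduct.mk ℂ (A ⊗[ℂ] A) A).flip q ∘ₗ (TensorProduct.comm ℂ A A).toLinearMap)
          (g := TensorProduct.mk ℂ A (A ⊗[ℂ] A) q) (fun u v => by simp [rev]) _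
  have hr : ∀ d : A ⊗[ℂ] A, rev ((H'.δ₁ y).lTensor A (TensorProduct.comm ℂ A A d)) =
      (H'.δ₄ y).rTensor A d :=
    TensorProduct.induction_eq (f := rev ∘ₗ (H'.δ₁ y).lTensor A ∘ₗ
      (TensorProduct.comm ℂ A A).toLinearMap) fun u v => by simp [rev, δ₄]
  simp only [LinearMap.comp_apply, TensorProduct.mk_apply, coopposite_left_E h] at h₁
  rw [hl, hr] at h₁
  exact h₁.symm

theorem commutesWithE_δ₂ (h : ∀ a, H'.Δ a = flip (H.Δ a)) (c : A) :
    H.CommutesWithE (H.δ₂ c) := by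
  intro z
  refine H.nondegenerate.eq_of_rTensor_mulRight fun y => ?_
  have h₁ : (mulRight ℂ y).rTensor A ∘ₗ H.δ₂ c = (mulLeft ℂ c).rTensor A ∘ₗ H'.δ₄ y :=
    LinearMap.ext fun a => (rTensor_mulLeft_δ₄ h c y a).symm
  rw [TensorProduct.rTensor_assoc, ← LinearMap.rTensor_comp_apply, h₁,
    LinearMap.rTensor_comp_apply, ← TensorProduct.rTensor_assoc, commutesWithE_δ₄ h,
    TensorProduct.rTensor_lTensor_comm, TensorProduct.rTensor_lTensor_comm,
    TensorProduct.rTensor_assoc, TensorProduct.rTensor_assoc, ← LinearMap.rTensor_comp_apply,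
    ← LinearMap.rTensor_comp_apply, h₁]

end Coopposite

end WeakMultiplierHopfAlgebra

/-! ### Source and target maps. -/

namespace WeakMultiplierHopfAlgebra

open MultiplierAlgebra

variable {A : Type*} [NonUnitalRing A] [Module ℂ A] [IsScalarTower ℂ A A] [SMulCommClass ℂ A A]
variable {V : Type*} [AddCommGroup V] [Module ℂ V]

section Single

variable (H : WeakMultiplierHopfAlgebra A)

/-- The projection `G₁` along the kernel of `T₁`. -/
noncomputable def kerProj : A ⊗[ℂ] A →ₗ[ℂ] A ⊗[ℂ] A := H.exists_kerProj.choose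

theorem kerProj_insertSlice (ω : A →ₗ[ℂ] ℂ) (a : A) (z : A ⊗[ℂ] A) :
    H.kerProj (H.insertSlice ω a z) = H.insertSlice ω a (left H.E z) :=
  H.exists_kerProj.choose_spec.1 ω a z

theorem kerProj_eq_zero {z : A ⊗[ℂ] A} (hz : H.T₁ z = 0) : H.kerProj z = 0 :=
  H.exists_kerProj.choose_spec.2.1 z hz

theorem T₁_kerProj (z : A ⊗[ℂ] A) : H.T₁ (H.kerProj z) = H.T₁ z :=
  H.exists_kerProj.choose_spec.2.2.1 z

theorem kerProj_kerProj (z : A ⊗[ℂ] A) : H.kerProj (H.kerProj z) = H.kerProj z :=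
  H.exists_kerProj.choose_spec.2.2.2 z

/-- On `H.insertSlice ω a z`, right multiplication of the second entry is right multiplication of
the first leg of `z`, which commutes with left multiplication by `E`. -/
theorem kerProj_lTensor_mulRight (x : A) (z : A ⊗[ℂ] A) :
    H.kerProj ((mulRight ℂ x).lTensor A z) = (mulRight ℂ x).lTensor A (H.kerProj z) := by
  have hi : ∀ (ω : A →ₗ[ℂ] ℂ) (a : A) (z : A ⊗[ℂ] A), (mulRight ℂ x).lTensor A
      (H.insertSlice ω a z) = H.insertSlice ω a ((mulRight ℂ x).rTensor A z) := fun ω a =>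
    TensorProduct.induction_eq (f := (mulRight ℂ x).lTensor A ∘ₗ H.insertSlice ω a)
      (g := H.insertSlice ω a ∘ₗ (mulRight ℂ x).rTensor A) fun b c => by simp [insertSlice_tmul]
  refine LinearMap.congr_fun (H.ext_insertSlice (f := H.kerProj ∘ₗ (mulRight ℂ x).lTensor A)
    (g := (mulRight ℂ x).lTensor A ∘ₗ H.kerProj) fun ω a z => ?_) z
  rw [LinearMap.comp_apply, LinearMap.comp_apply, hi, kerProj_insertSlice, kerProj_insertSlice, hi,
    left_rTensor_mulRight H.nondegenerate]

/-- The source map `p ↦ (q ↦ ε_s(p)q)`. -/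
noncomputable def sourceMul : A →ₗ[ℂ] A →ₗ[ℂ] A :=
  TensorProduct.curry (sliceLeft H.ε ∘ₗ H.kerProj)

theorem sourceMul_apply (p q : A) : H.sourceMul p q = sliceLeft H.ε (H.kerProj (p ⊗ₜ q)) := rfl

theorem sourceMul_mul (p q x : A) : H.sourceMul p (q * x) = H.sourceMul p q * x := by
  have := H.kerProj_lTensor_mulRight x (p ⊗ₜ q)
  rw [LinearMap.lTensor_tmul, LinearMap.mulRight_apply] at this
  rw [sourceMul_apply, this, sliceLeft_lTensor]
  rfl

/-- `∑ ε_s(a₍₁₎)b ⊗ a₍₂₎c = (1 ⊗ a)E(b ⊗ c)`. -/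
theorem rTensor_sourceMul_δ₁ (a b c : A) :
    (H.sourceMul.flip b).rTensor A (H.δ₁ c a) = (mulLeft ℂ a).lTensor A (left H.E (b ⊗ₜ c)) := by
  refine eq_of_sliceRight_eq fun ω => ?_
  have h₁ : H.sourceMul.flip b (sliceRight ω (H.δ₁ c a)) =
      sliceLeft H.ε (H.insertSlice ω a (left H.E (b ⊗ₜ c))) := by
    rw [← kerProj_insertSlice, insertSlice_tmul]
    rfl
  rw [sliceRight_rTensor, h₁, sliceRight_lTensor]
  refine TensorProduct.induction_eq (f := sliceLeft H.ε ∘ₗ H.insertSlice ω a)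
    (g := sliceRight (ω ∘ₗ mulLeft ℂ a)) (fun b c => ?_) _
  rw [LinearMap.comp_apply, insertSlice_tmul, sliceLeft_tmul, sliceRight_tmul, ← apply_sliceLeft,
    δ₁_apply, sliceLeft_T₁]
  rfl

theorem targetMap_apply (a b : A) : H.targetMap a b = sliceLeft H.ε (left H.E (a ⊗ₜ b)) := rfl

theorem sourceMap'_apply (a b : A) : H.sourceMap' a b = sliceRight H.ε (left H.E (b ⊗ₜ a)) := rfl

theorem targetMap_mul (a b x : A) : H.targetMap a (b * x) = H.targetMap a b * x := by
  have := left_lTensor_mulRight H.nondegenerate H.E (a ⊗ₜ b) x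
  rw [LinearMap.lTensor_tmul, LinearMap.mulRight_apply] at this
  rw [targetMap_apply, this, sliceLeft_lTensor]
  rfl

/-- The target map as a linear map. -/
noncomputable def targetMul : A →ₗ[ℂ] A →ₗ[ℂ] A := TensorProduct.curry (sliceLeft H.ε ∘ₗ left H.E)

/-- The map `ε'_s` as a linear map. -/
noncomputable def sourceMul' : A →ₗ[ℂ] A →ₗ[ℂ] A :=
  (TensorProduct.curry (sliceRight H.ε ∘ₗ left H.E)).flip

theorem targetMul_apply (a b : A) : H.targetMul a b = H.targetMap a b := rfl

theorem sourceMul'_apply (a b : A) : H.sourceMul' a b = H.sourceMap' a b := rfl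

/-- `E(x ⊗ wy) = ∑ ε'_s(w₍₁₎)x ⊗ w₍₂₎y`. -/
theorem left_E_tmul_mul (x w y : A) :
    left H.E (x ⊗ₜ (w * y)) = (H.sourceMul'.flip x).rTensor A (H.δ₁ y w) := by
  -- Apply `ε` to the middle leg of `(ι ⊗ Δ)(E(x ⊗ w)) = (E ⊗ 1)(x ⊗ Δ(w))`, multiplied by `y` on
  -- the last leg. One side collapses by the counit property, the other produces `ε'_s`.
  have h := congrArg ((sliceLeft H.ε).lTensor A) (H.isColinear_left_E x w y)
  have h₁ : sliceLeft H.ε ∘ₗ H.δ₁ y = mulRight ℂ y := LinearMap.ext fun a => H.sliceLeft_T₁ a y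
  rw [← LinearMap.lTensor_comp_apply, h₁, LinearMap.comp_apply, TensorProduct.mk_apply,
    ← left_lTensor_mulRight H.nondegenerate, LinearMap.lTensor_tmul,
    LinearMap.mulRight_apply] at h
  rw [← h]
  refine TensorProduct.induction_eq (f := (sliceLeft H.ε).lTensor A ∘ₗ
    (TensorProduct.assoc ℂ A A A).toLinearMap ∘ₗ
    (left H.E ∘ₗ TensorProduct.mk ℂ A A x).rTensor A) (g := (H.sourceMul'.flip x).rTensor A)
    (fun p q => ?_) _
  simp only [LinearMap.comp_apply, LinearMap.rTensor_tmul, LinearEquiv.coe_coe,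
    TensorProduct.mk_apply, LinearMap.flip_apply, sourceMul'_apply, sourceMap'_apply]
  exact TensorProduct.induction_eq (f := (sliceLeft H.ε).lTensor A ∘ₗ
    (TensorProduct.assoc ℂ A A A).toLinearMap ∘ₗ (TensorProduct.mk ℂ (A ⊗[ℂ] A) A).flip q)
    (g := (TensorProduct.mk ℂ A A).flip q ∘ₗ sliceRight H.ε)
    (fun u v => by simp) _

/-- `∑ ε_t(w₍₁₎)w₍₂₎y = wy`. -/
theorem lift_targetMul_δ₁ (w y : A) : TensorProduct.lift H.targetMul (H.δ₁ y w) = w * y := by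
  have : TensorProduct.lift H.targetMul = sliceLeft H.ε ∘ₗ left H.E :=
    TensorProduct.ext' fun x y => by simp [targetMul]
  rw [this, LinearMap.comp_apply, δ₁_apply, left_E_T₁, sliceLeft_T₁]

end Single

section Coopposite

variable {H H' : WeakMultiplierHopfAlgebra A}

/-- `G₁(p ⊗ qx) = ∑ p₍₁₎ ⊗ q₍₁₎x ε(p₍₂₎q₍₂₎)`. -/
theorem kerProj_tmul_mul (h : ∀ a, H'.Δ a = flip (H.Δ a)) (p q x : A) :
    H.kerProj (p ⊗ₜ (q * x)) = H.insertSlice H.ε p (H'.δ₄ x q) := by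
  -- Since `E` fixes `Δ(q)(x ⊗ 1)`, the right side is a fixed point of `kerProj`. It differs from `p
  -- ⊗ qx` by an element of the kernel of `T₁`.
  have h₁ := H.kerProj_insertSlice H.ε p (H'.δ₄ x q)
  rw [left_E_δ₄ h] at h₁
  rw [← h₁, ← sub_eq_zero, ← map_sub]
  apply kerProj_eq_zero
  rw [map_sub, T₁_insertSlice h, sub_self]

/-- `c ε_s(p)q = ∑ c q₍₁₎ ε(p q₍₂₎)`. -/
theorem mul_sourceMul (h : ∀ a, H'.Δ a = flip (H.Δ a)) (c p q : A) :
    c * H.sourceMul p q = sliceRight (H.ε ∘ₗ mulLeft ℂ p) (H.δ₂ c q) := by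
  refine H.nondegenerate.eq_of_mul_right fun x => ?_
  have h₁ : ∀ w, sliceLeft H.ε (H.insertSlice H.ε p w) = sliceRight (H.ε ∘ₗ mulLeft ℂ p) w :=
    TensorProduct.induction_eq (f := sliceLeft H.ε ∘ₗ H.insertSlice H.ε p) fun u v => by
      rw [LinearMap.comp_apply, insertSlice_tmul, sliceLeft_tmul, sliceRight_tmul,
        ← apply_sliceLeft, δ₁_apply, sliceLeft_T₁]
      rfl
  rw [mul_assoc, ← sourceMul_mul, sourceMul_apply, kerProj_tmul_mul h, h₁]
  have h₂ := sliceRight_rTensor (H.ε ∘ₗ mulLeft ℂ p) (mulLeft ℂ c) (H'.δ₄ x q)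
  rw [rTensor_mulLeft_δ₄ h, sliceRight_rTensor] at h₂
  exact h₂.symm

/-- `(c ⊗ 1)Δ(ε_s(p)b) = (c ⊗ ε_s(p))Δ(b)`. -/
theorem δ₂_sourceMul (h : ∀ a, H'.Δ a = flip (H.Δ a)) (c p b : A) :
    H.δ₂ c (H.sourceMul p b) = (H.sourceMul p).lTensor A (H.δ₂ c b) := by
  let F : A →ₗ[ℂ] A ⊗[ℂ] A := H.δ₂ c ∘ₗ H.sourceMul.flip b
  let F' : A →ₗ[ℂ] A ⊗[ℂ] A := (LinearMap.lTensorHom A ∘ₗ H.sourceMul).flip (H.δ₂ c b)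
  -- By fullness `p` may be replaced by the first leg of `Δ(a)(1 ⊗ e)`. Then `∑ ε_s(a₍₁₎)b ⊗ a₍₂₎e =
  -- (1 ⊗ a)E(b ⊗ e)` turns the claim into the commutation of `δ₂` with `E`.
  suffices hF : F - F' = 0 from LinearMap.congr_fun (sub_eq_zero.1 hF) p
  refine H.eq_zero_of_rTensor_T₁ _ fun a e => ?_
  rw [LinearMap.rTensor_sub, LinearMap.sub_apply, sub_eq_zero]
  apply (TensorProduct.assoc ℂ A A A).injective
  have h₁ : ∀ d : A ⊗[ℂ] A, TensorProduct.assoc ℂ A A A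
      (((LinearMap.lTensorHom A ∘ₗ H.sourceMul).flip d).rTensor A (H.δ₁ e a)) =
      ((mulLeft ℂ a).lTensor A ∘ₗ left H.E).lTensor A
        (TensorProduct.assoc ℂ A A A (d ⊗ₜ[ℂ] e)) := by
    intro d
    induction d with
    | zero => simp
    | add x y hx hy =>
      rw [map_add, LinearMap.rTensor_add, LinearMap.add_apply, map_add, hx, hy,
        TensorProduct.add_tmul, map_add, map_add]
    | tmul g k =>
      rw [TensorProduct.assoc_tmul, LinearMap.lTensor_tmul, LinearMap.comp_apply,
        ← rTensor_sourceMul_δ₁]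
      exact TensorProduct.induction_eq (f := (TensorProduct.assoc ℂ A A A).toLinearMap ∘ₗ
        ((LinearMap.lTensorHom A ∘ₗ H.sourceMul).flip (g ⊗ₜ k)).rTensor A)
        (g := TensorProduct.mk ℂ A (A ⊗[ℂ] A) g ∘ₗ (H.sourceMul.flip k).rTensor A)
        (fun u v => by simp) _
  have h₂ := h₁ (H.δ₂ c b)
  rw [δ₁_apply] at h₂
  rw [h₂, LinearMap.lTensor_comp_apply, LinearMap.rTensor_comp_apply, ← δ₁_apply,
    rTensor_sourceMul_δ₁, TensorProduct.rTensor_lTensor_comm,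
    ← TensorProduct.lTensor_lTensor_assoc, commutesWithE_δ₂ h]
  rfl

/-- Applying `ι ⊗ ε` to `(c ⊗ ε_s(p))Δ(b) = (c ⊗ 1)Δ(ε_s(p)b)` gives `c ε_s(p) b`, which is also `∑
c b₍₁₎ ε(p b₍₂₎)`. Fullness of the right leg then compares the two functionals. -/
theorem ε_sourceMul (h : ∀ a, H'.Δ a = flip (H.Δ a)) (p q : A) :
    H.ε (H.sourceMul p q) = H.ε (p * q) := by
  have : H.ε ∘ₗ H.sourceMul p - H.ε ∘ₗ mulLeft ℂ p = 0 := by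
    refine H.eq_zero_of_lTensor_T₂ _ fun c b => (TensorProduct.rid ℂ A).injective ?_
    have h₁ := mul_sourceMul h c p b
    rw [← H.sliceRight_T₂, ← δ₂_apply, δ₂_sourceMul h, sliceRight_lTensor] at h₁
    rw [LinearMap.lTensor_sub, LinearMap.sub_apply, map_sub, map_zero, sub_eq_zero]
    exact h₁
  exact LinearMap.congr_fun (sub_eq_zero.1 this) q

/-- `a ε_t(b) c = ∑ ε(a₍₁₎b) a₍₂₎c`. -/
theorem mul_targetMap (h : ∀ a, H'.Δ a = flip (H.Δ a)) (a b c : A) :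
    a * H.targetMap b c = sliceLeft (H.ε ∘ₗ mulRight ℂ b) (H.δ₁ c a) := by
  have h₁ : H.ε ∘ₗ H.sourceMul.flip b = H.ε ∘ₗ mulRight ℂ b :=
    LinearMap.ext fun p => ε_sourceMul h p b
  rw [← h₁, ← sliceLeft_rTensor, rTensor_sourceMul_δ₁, sliceLeft_lTensor]
  rfl

/-- `a ε'_s(b) c = ∑ a₍₁₎c ε(a₍₂₎b)`. -/
theorem mul_sourceMap' (h : ∀ a, H'.Δ a = flip (H.Δ a)) (a b c : A) :
    a * H.sourceMap' b c = sliceRight (H.ε ∘ₗ mulRight ℂ b) (H'.δ₄ c a) := by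
  have h₁ := mul_targetMap (coopposite_symm h) a b c
  rw [targetMap_apply, coopposite_left_E h, coopposite_ε h, sliceLeft_comm] at h₁
  rw [sourceMap'_apply, h₁, δ₄_apply, sliceRight_comm]

/-- `Δ(a)(1 ⊗ y)(x ⊗ 1) = Δ(a)(x ⊗ 1)(1 ⊗ y)`. -/
theorem rTensor_mulRight_δ₁ (h : ∀ a, H'.Δ a = flip (H.Δ a)) (a x y : A) :
    (mulRight ℂ x).rTensor A (H.δ₁ y a) = (mulRight ℂ y).lTensor A (H'.δ₄ x a) := by
  rw [← left_Δ_tmul' h, left_Δ_tmul]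
  rfl

/-- The product `a ε'_s(b)` is the element `(ι ⊗ ε)(Δ(a)(1 ⊗ b))` of `A`. Thus `ε'_s(b)` is a
two-sided multiplier, which makes its extended action computable. -/
theorem mul_sourceMap'_eq_mul (h : ∀ a, H'.Δ a = flip (H.Δ a)) (a b c : A) :
    a * H.sourceMap' b c = sliceRight H.ε (H.δ₁ b a) * c := by
  rw [mul_sourceMap' h, ← sliceRight_lTensor, ← rTensor_mulRight_δ₁ h, sliceRight_rTensor]
  rfl

theorem mul_targetMap_eq_mul (h : ∀ a, H'.Δ a = flip (H.Δ a)) (a b c : A) :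
    a * H.targetMap b c = sliceLeft H.ε (H'.δ₄ b a) * c := by
  rw [mul_targetMap h, ← sliceLeft_rTensor, rTensor_mulRight_δ₁ h, sliceLeft_lTensor]
  rfl

/-- `E(ε'_s(c) ⊗ 1) = E(1 ⊗ ε_t(c))`. -/
theorem left_E_sourceMap'_tmul (h : ∀ a, H'.Δ a = flip (H.Δ a)) (c x y : A) :
    left H.E (H.sourceMap' c x ⊗ₜ y) = left H.E (x ⊗ₜ H.targetMap c y) := by
  refine H.left_E_eq_of_left_Δ_eq fun a => ?_
  let φ := H.ε ∘ₗ mulRight ℂ c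
  have h₁ : left (H.Δ a) (H.sourceMap' c x ⊗ₜ y) =
      (sliceRight φ ∘ₗ H'.δ₄ x).rTensor A (H.δ₁ y a) := by
    rw [left_Δ_tmul]
    congr 2
    ext p
    exact mul_sourceMap' h p c x
  have h₂ : left (H.Δ a) (x ⊗ₜ H.targetMap c y) =
      (sliceLeft φ ∘ₗ H.δ₁ y).lTensor A (H'.δ₄ x a) := by
    rw [left_Δ_tmul' h]
    have h₃ : ∀ b, sliceLeft φ (H.δ₁ y b) = b * H.targetMap c y := fun b =>
      (mul_targetMap h b c y).symm
    congr 2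
    ext b
    exact (h₃ b).symm
  -- Both sides are now `∑ a₍₁₎x ε(a₍₂₎c) ⊗ a₍₃₎y`, bracketed differently.
  rw [h₁, h₂, LinearMap.lTensor_comp_apply, ← isColinear_δ₄ h]
  refine TensorProduct.induction_eq (f := (sliceRight φ ∘ₗ H'.δ₄ x).rTensor A)
    (g := (sliceLeft φ).lTensor A ∘ₗ (TensorProduct.assoc ℂ A A A).toLinearMap ∘ₗ
      (H'.δ₄ x).rTensor A) (fun p q => ?_) _
  simp only [LinearMap.comp_apply, LinearMap.rTensor_tmul, LinearEquiv.coe_coe]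
  exact TensorProduct.induction_eq (f := (TensorProduct.mk ℂ A A).flip q ∘ₗ sliceRight φ)
    (g := (sliceLeft φ).lTensor A ∘ₗ
    (TensorProduct.assoc ℂ A A A).toLinearMap ∘ₗ (TensorProduct.mk ℂ (A ⊗[ℂ] A) A).flip q)
    (fun u v => by simp) _

/-- If `ε'_s(c) = 0` then `Δ(a)(1 ⊗ ε_t(c)) = Δ(a)(ε'_s(c) ⊗ 1) = 0`, and the counit gives `a ε_t(c)
= 0`. So `ε'_s(c) ↦ ε_t(c)` is well defined. -/
theorem targetMap_eq_zero (h : ∀ a, H'.Δ a = flip (H.Δ a)) {c : A} (hc : H.sourceMap' c = 0) :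
    H.targetMap c = 0 := by
  ext y
  refine H.nondegenerate.2 _ fun a => ?_
  rw [← H.sliceLeft_T₁]
  suffices H.T₁ (a ⊗ₜ H.targetMap c y) = 0 by rw [this, map_zero]
  refine H.nondegenerate.eq_of_rTensor_mulRight fun x => ?_
  rw [← left_Δ_tmul, ← left_Δ_left_E, ← left_E_sourceMap'_tmul h, hc]
  simp

end Coopposite

end WeakMultiplierHopfAlgebra

section

variable {M N P Q V W : Type*} [AddCommGroup M] [Module ℂ M] [AddCommGroup N] [Module ℂ N]
  [AddCommGroup P] [Module ℂ P] [AddCommGroup Q] [Module ℂ Q] [AddCommGroup V] [Module ℂ V]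
  [AddCommGroup W] [Module ℂ W]

/-- A linear map has a generalized inverse. -/
theorem LinearMap.exists_generalizedInverse (f : M →ₗ[ℂ] N) :
    ∃ g : N →ₗ[ℂ] M, ∀ x, f (g (f x)) = f x := by
  obtain ⟨r, hr⟩ := f.rangeRestrict.exists_rightInverse_of_surjective f.range_rangeRestrict
  obtain ⟨g, hg⟩ := LinearMap.exists_extend r
  refine ⟨g, fun x => ?_⟩
  have h₁ : g (f x) = r (f.rangeRestrict x) := LinearMap.congr_fun hg (f.rangeRestrict x)
  have h₂ := LinearMap.congr_fun hr (f.rangeRestrict x)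
  rw [h₁]
  exact congrArg Subtype.val h₂

theorem TensorProduct.lTensor_sliceLeft_assoc (φ : Q →ₗ[ℂ] ℂ) (z : (P ⊗[ℂ] Q) ⊗[ℂ] M) :
    (sliceLeft φ).lTensor P (TensorProduct.assoc ℂ P Q M z) = (sliceRight φ).rTensor M z := by
  induction z with
  | zero => simp
  | add x y hx hy => simp only [map_add, hx, hy]
  | tmul w m =>
    induction w with
    | zero => simp
    | add x y hx hy => simp only [map_add, TensorProduct.add_tmul, hx, hy]
    | tmul p q => simp [TensorProduct.smul_tmul']

end

/-! ### The antipode, and local units. -/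

namespace WeakMultiplierHopfAlgebra

open MultiplierAlgebra

variable {A : Type*} [NonUnitalRing A] [Module ℂ A] [IsScalarTower ℂ A A] [SMulCommClass ℂ A A]
variable {V : Type*} [AddCommGroup V] [Module ℂ V]

section Single

variable (H : WeakMultiplierHopfAlgebra A)

/-- As `kerProj` kills the kernel of `T₁`, it factors through `T₁`; any generalized inverse of `T₁`
supplies the factor. -/
theorem exists_leftInverse_T₁ : ∃ L : A ⊗[ℂ] A →ₗ[ℂ] A ⊗[ℂ] A, ∀ z, L (H.T₁ z) = H.kerProj z := by
  obtain ⟨s, hs⟩ := H.T₁.exists_generalizedInverse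
  refine ⟨H.kerProj ∘ₗ s, fun z => ?_⟩
  rw [LinearMap.comp_apply, ← sub_eq_zero, ← map_sub]
  apply kerProj_eq_zero
  rw [map_sub, hs, sub_self]

/-- The generalized inverse `R₁` of `T₁`, given by `R₁(c ⊗ a) = ∑ c₍₁₎ ⊗ S(c₍₂₎)a`. -/
noncomputable def R₁ : A ⊗[ℂ] A →ₗ[ℂ] A ⊗[ℂ] A :=
  H.exists_leftInverse_T₁.choose ∘ₗ left H.E

theorem exists_R₁_eq (z : A ⊗[ℂ] A) : ∃ w, H.T₁ w = left H.E z ∧ H.R₁ z = H.kerProj w := by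
  obtain ⟨w, hw⟩ : left H.E z ∈ LinearMap.range H.T₁ := H.range_T₁ ▸ ⟨z, rfl⟩
  exact ⟨w, hw, by rw [R₁, LinearMap.comp_apply, ← hw, H.exists_leftInverse_T₁.choose_spec]⟩

theorem T₁_R₁ (z : A ⊗[ℂ] A) : H.T₁ (H.R₁ z) = left H.E z := by
  obtain ⟨w, h₁, h₂⟩ := H.exists_R₁_eq z
  rw [h₂, T₁_kerProj, h₁]

theorem kerProj_R₁ (z : A ⊗[ℂ] A) : H.kerProj (H.R₁ z) = H.R₁ z := by
  obtain ⟨w, h₁, h₂⟩ := H.exists_R₁_eq z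
  rw [h₂, kerProj_kerProj]

/-- The map `c ↦ (a ↦ S(c)a)`, for the antipode `S`. -/
noncomputable def antipodeMul : A →ₗ[ℂ] A →ₗ[ℂ] A :=
  TensorProduct.curry (sliceLeft H.ε ∘ₗ H.R₁)

theorem antipodeMul_apply (c a : A) : H.antipodeMul c a = sliceLeft H.ε (H.R₁ (c ⊗ₜ a)) := rfl

/-- The map `a ↦ insertSlice ω a w`. -/
noncomputable def insertSliceFlip (ω : A →ₗ[ℂ] ℂ) (w : A ⊗[ℂ] A) : A →ₗ[ℂ] A ⊗[ℂ] A :=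
  (TensorProduct.comm ℂ A A).toLinearMap ∘ₗ
    (LinearMap.lTensorHom A ∘ₗ TensorProduct.curry (sliceRight ω ∘ₗ H.T₁)).flip w

theorem insertSliceFlip_apply (ω : A →ₗ[ℂ] ℂ) (w : A ⊗[ℂ] A) (a : A) :
    H.insertSliceFlip ω w a = H.insertSlice ω a w := rfl

theorem mul'_R₁ (z : A ⊗[ℂ] A) :
    LinearMap.mul' ℂ A (H.R₁ z) = sliceLeft H.ε (left H.E z) := by
  rw [← T₁_R₁]
  exact TensorProduct.induction_eq (f := LinearMap.mul' ℂ A) (g := sliceLeft H.ε ∘ₗ H.T₁)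
    (fun x y => (H.sliceLeft_T₁ x y).symm) _

theorem mul'_R₁_tmul (p a : A) :
    LinearMap.mul' ℂ A (H.R₁ (p ⊗ₜ a)) = H.targetMap p a := H.mul'_R₁ _

/-- `b ε_s(p) q`, with `b ε_s(p) = (ι ⊗ ε)((b ⊗ p)E)`. -/
theorem mul_sourceMul_eq_mul (b p q : A) :
    b * H.sourceMul p q = sliceRight H.ε (right H.E (b ⊗ₜ p)) * q := by
  let X := right H.E ∘ₗ TensorProduct.mk ℂ A A b
  suffices h : mulLeft ℂ b ∘ₗ H.sourceMul.flip q - mulRight ℂ q ∘ₗ sliceRight H.ε ∘ₗ X = 0 from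
    LinearMap.congr_fun (sub_eq_zero.1 h) p
  refine H.eq_zero_of_rTensor_T₁ _ fun a c => ?_
  have h₁ : sliceLeft H.ε ∘ₗ H.δ₁ c = mulRight ℂ c := LinearMap.ext fun a => H.sliceLeft_T₁ a c
  rw [LinearMap.rTensor_sub, LinearMap.sub_apply, sub_eq_zero, ← δ₁_apply,
    LinearMap.rTensor_comp_apply, LinearMap.rTensor_comp_apply, LinearMap.rTensor_comp_apply,
    rTensor_sourceMul_δ₁, ← TensorProduct.lTensor_sliceLeft_assoc, H.isColinear_right_E b,
    ← LinearMap.lTensor_comp_apply, h₁, ← TensorProduct.map_eq_rTensor_lTensor,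
    ← TensorProduct.map_eq_rTensor_lTensor, ← TensorProduct.mul_tmul_eq_map,
    ← TensorProduct.tmul_mul_eq_map, LinearMap.comp_apply, TensorProduct.mk_apply, right_mul_eq]

end Single

section Coopposite

variable {H H' : WeakMultiplierHopfAlgebra A}

theorem IsColinear.assoc_rTensor_T₁ {X : A →ₗ[ℂ] V ⊗[ℂ] A} (hX : H.IsColinear X)
    (z : A ⊗[ℂ] A) : TensorProduct.assoc ℂ V A A (X.rTensor A (H.T₁ z)) =
      H.T₁.lTensor V (TensorProduct.assoc ℂ V A A (X.rTensor A z)) := by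
  refine TensorProduct.induction_eq (f := (TensorProduct.assoc ℂ V A A).toLinearMap ∘ₗ
    X.rTensor A ∘ₗ H.T₁) (g := H.T₁.lTensor V ∘ₗ (TensorProduct.assoc ℂ V A A).toLinearMap ∘ₗ
    X.rTensor A) (fun a b => ?_) z
  refine (hX a b).trans ?_
  simp only [LinearMap.comp_apply, LinearMap.rTensor_tmul, LinearEquiv.coe_coe]
  exact TensorProduct.induction_eq (f := (H.δ₁ b).lTensor V) (g := H.T₁.lTensor V ∘ₗ
    (TensorProduct.assoc ℂ V A A).toLinearMap ∘ₗ (TensorProduct.mk ℂ (V ⊗[ℂ] A) A).flip b)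
    (fun x y => by simp [δ₁]) _

/-- In `∑ p₍₁₎ ⊗ q₍₁₎x ε(p₍₂₎q₍₂₎)`, the value of `kerProj` on `p ⊗ qx`, the variable `p` occurs
only through right slices of `Δ(p)`, and colinear maps commute with these. -/
theorem IsColinear.assoc_rTensor_kerProj (h : ∀ a, H'.Δ a = flip (H.Δ a))
    {X : A →ₗ[ℂ] V ⊗[ℂ] A} (hX : H.IsColinear X)
    (z : A ⊗[ℂ] A) : TensorProduct.assoc ℂ V A A (X.rTensor A (H.kerProj z)) =
      H.kerProj.lTensor V (TensorProduct.assoc ℂ V A A (X.rTensor A z)) := by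
  refine TensorProduct.induction_eq (f := (TensorProduct.assoc ℂ V A A).toLinearMap ∘ₗ
    X.rTensor A ∘ₗ H.kerProj) (g := H.kerProj.lTensor V ∘ₗ
    (TensorProduct.assoc ℂ V A A).toLinearMap ∘ₗ X.rTensor A) (fun p b => ?_) z
  have key : ∀ w, TensorProduct.assoc ℂ V A A (X.rTensor A (H.insertSlice H.ε p w)) =
      (H.insertSliceFlip H.ε w).lTensor V (X p) := by
    intro w
    induction w with
    | zero =>
      have : H.insertSliceFlip H.ε 0 = 0 := LinearMap.ext fun a => map_zero (H.insertSlice H.ε a)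
      simp [this]
    | add w₁ w₂ h₁ h₂ =>
      have : H.insertSliceFlip H.ε (w₁ + w₂) = H.insertSliceFlip H.ε w₁ +
        H.insertSliceFlip H.ε w₂ := LinearMap.ext fun a => map_add (H.insertSlice H.ε a) _ _
      rw [this, LinearMap.lTensor_add, LinearMap.add_apply, map_add, map_add, map_add, h₁, h₂]
    | tmul u v =>
      rw [insertSlice_tmul, LinearMap.rTensor_tmul, hX.slice]
      exact TensorProduct.induction_eq (f := (TensorProduct.assoc ℂ V A A).toLinearMap ∘ₗ
        (TensorProduct.mk ℂ (V ⊗[ℂ] A) A).flip u ∘ₗ (sliceRight H.ε ∘ₗ H.δ₁ v).lTensor V)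
        (g := (H.insertSliceFlip H.ε (u ⊗ₜ v)).lTensor V)
        (fun x y => by simp [insertSliceFlip_apply, insertSlice_tmul]) _
  refine LinearMap.congr_fun (H.ext_mul (f := (((TensorProduct.assoc ℂ V A A).toLinearMap ∘ₗ
    X.rTensor A ∘ₗ H.kerProj) ∘ₗ TensorProduct.mk ℂ A A p)) (g := (H.kerProj.lTensor V ∘ₗ
    (TensorProduct.assoc ℂ V A A).toLinearMap ∘ₗ X.rTensor A) ∘ₗ TensorProduct.mk ℂ A A p)
    fun q x => ?_) b
  simp only [LinearMap.comp_apply, TensorProduct.mk_apply, LinearEquiv.coe_coe,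
    kerProj_tmul_mul h, key, LinearMap.rTensor_tmul]
  exact TensorProduct.induction_eq (f := (H.insertSliceFlip H.ε (H'.δ₄ x q)).lTensor V)
    (g := H.kerProj.lTensor V ∘ₗ (TensorProduct.assoc ℂ V A A).toLinearMap ∘ₗ
      (TensorProduct.mk ℂ (V ⊗[ℂ] A) A).flip (q * x))
    (fun y c => by simp [insertSliceFlip_apply, kerProj_tmul_mul h]) _

/-- The relations `T₁ R₁ = E` and `kerProj R₁ = R₁` determine `R₁`, and `X` intertwines `T₁`, `E`
and `kerProj`. -/
theorem IsColinear.assoc_rTensor_R₁ (h : ∀ a, H'.Δ a = flip (H.Δ a))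
    {X : A →ₗ[ℂ] V ⊗[ℂ] A} (hX : H.IsColinear X) (hE : H.CommutesWithE X)
    (z : A ⊗[ℂ] A) : TensorProduct.assoc ℂ V A A (X.rTensor A (H.R₁ z)) =
      H.R₁.lTensor V (TensorProduct.assoc ℂ V A A (X.rTensor A z)) := by
  have hL : H.exists_leftInverse_T₁.choose ∘ₗ H.T₁ = H.kerProj :=
    LinearMap.ext H.exists_leftInverse_T₁.choose_spec
  rw [R₁, LinearMap.lTensor_comp_apply, ← hE, ← T₁_R₁, hX.assoc_rTensor_T₁,
    ← LinearMap.lTensor_comp_apply, hL, ← hX.assoc_rTensor_kerProj h]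
  congr 2
  exact (H.kerProj_R₁ z).symm

/-- Applying `ε` to the middle leg of the intertwining relation for `R₁` leaves the antipode on the
second leg of `X c`. Taking for `X` the maps `δ₄`, `δ₂` and right multiplication by `E` yields the
antipode identities used below. -/
theorem IsColinear.slice_R₁ (h : ∀ a, H'.Δ a = flip (H.Δ a))
    {X : A →ₗ[ℂ] V ⊗[ℂ] A} (hX : H.IsColinear X) (hE : H.CommutesWithE X) (c a : A) :
    (sliceRight H.ε ∘ₗ X).rTensor A (H.R₁ (c ⊗ₜ a)) = (H.antipodeMul.flip a).lTensor V (X c) := by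
  rw [LinearMap.rTensor_comp_apply, ← TensorProduct.lTensor_sliceLeft_assoc,
    hX.assoc_rTensor_R₁ h hE, LinearMap.rTensor_tmul]
  exact TensorProduct.induction_eq (f := (sliceLeft H.ε).lTensor V ∘ₗ H.R₁.lTensor V ∘ₗ
    (TensorProduct.assoc ℂ V A A).toLinearMap ∘ₗ (TensorProduct.mk ℂ (V ⊗[ℂ] A) A).flip a)
    (g := (H.antipodeMul.flip a).lTensor V) (fun x y => by simp [antipodeMul_apply]) _

/-- `R₁(c ⊗ a)(d ⊗ 1) = ∑ c₍₁₎d ⊗ S(c₍₂₎)a`. -/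
theorem rTensor_mulRight_R₁ (h : ∀ a, H'.Δ a = flip (H.Δ a)) (c a d : A) :
    (mulRight ℂ d).rTensor A (H.R₁ (c ⊗ₜ a)) = (H.antipodeMul.flip a).lTensor A (H'.δ₄ d c) := by
  rw [← (isColinear_δ₄ h d).slice_R₁ h (commutesWithE_δ₄ h d)]
  congr 2
  ext p
  exact (sliceRight_δ₄ h d p).symm

/-- `S(v)` is a right multiplier as well: `b S(v)` is in `A`. -/
theorem exists_mul_antipodeMul (h : ∀ a, H'.Δ a = flip (H.Δ a)) (b v : A) :
    ∃ s : A, ∀ a, b * H.antipodeMul v a = s * a := by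
  -- As `kerProj` fixes `R₁(v ⊗ a) = ∑ p ⊗ q`, one has `S(v)a = ∑ ε_s(p)q`, where `b ε_s(p) = (ι ⊗
  -- ε)((b ⊗ p)E)`. Thus `b S(v)` is the product of the legs of `(b ⊗ v)E` after `S` on the second
  -- one.
  have h₁ : ∀ a, b * H.antipodeMul v a =
      LinearMap.mul' ℂ A ((H.antipodeMul.flip a).lTensor A (right H.E (b ⊗ₜ v))) := by
    intro a
    have h₂ := (H.isColinear_right_E b).slice_R₁ h (H.commutesWithE_right_E b) v a
    rw [LinearMap.comp_apply, TensorProduct.mk_apply] at h₂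
    rw [← h₂, antipodeMul_apply, ← kerProj_R₁]
    refine TensorProduct.induction_eq (f := mulLeft ℂ b ∘ₗ sliceLeft H.ε ∘ₗ H.kerProj)
      (g := LinearMap.mul' ℂ A ∘ₗ (sliceRight H.ε ∘ₗ right H.E ∘ₗ
        TensorProduct.mk ℂ A A b).rTensor A) (fun p q => ?_) (H.R₁ (v ⊗ₜ a)) |>.trans ?_
    · exact (H.mul_sourceMul_eq_mul b p q).trans (by simp)
    · rw [kerProj_R₁]; rfl
  obtain ⟨u, hu⟩ : right H.E (b ⊗ₜ v) ∈ LinearMap.range H.T₂ := H.range_T₂ ▸ ⟨_, rfl⟩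
  simp only [h₁, ← hu]
  clear h₁ hu
  induction u with
  | zero => exact ⟨0, fun a => by simp⟩
  | add x y hx hy =>
    obtain ⟨s, hs⟩ := hx
    obtain ⟨t, ht⟩ := hy
    exact ⟨s + t, fun a => by rw [map_add, map_add, map_add, hs, ht, add_mul]⟩
  | tmul x y =>
    -- For `(x ⊗ 1)Δ(y)` the expression is `∑ x y₍₁₎S(y₍₂₎)a = x ε_t(y) a`, and `x ε_t(y) = (ε ⊗
    -- ι)(Δ(x)(y ⊗ 1))` is in `A`.
    refine ⟨sliceLeft H.ε (H'.δ₄ y x), fun a => ?_⟩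
    rw [← mul_targetMap_eq_mul h, ← δ₂_apply,
      ← (H.isColinear_δ₂ x).slice_R₁ h (commutesWithE_δ₂ h x), ← mul'_R₁_tmul]
    refine TensorProduct.induction_eq (f := LinearMap.mul' ℂ A ∘ₗ
      (sliceRight H.ε ∘ₗ H.δ₂ x).rTensor A) (g := mulLeft ℂ x ∘ₗ LinearMap.mul' ℂ A)
      (fun p q => ?_) _
    have := H.sliceRight_T₂ x p
    simp [δ₂_apply, this, mul_assoc]

/-- Since `E = T₁R₁`, formally `E(c ⊗ a) = ∑ c₍₁₎ ⊗ c₍₂₎S(c₍₃₎)a`, and `ω` kills `b S(v) a` because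
`b S(v)` is in `A`. -/
theorem sliceRight_left_E_eq_zero (h : ∀ a, H'.Δ a = flip (H.Δ a)) (ω : A →ₗ[ℂ] ℂ) (a : A)
    (hω : ∀ b, ω (b * a) = 0) (c : A) : sliceRight ω (left H.E (c ⊗ₜ a)) = 0 := by
  let Φ : A →ₗ[ℂ] A →ₗ[ℂ] ℂ := (LinearMap.mul ℂ A).flip.compr₂ ω
  have h₁ : Φ.lTensor A (H.R₁ (c ⊗ₜ a)) = 0 := by
    refine TensorProduct.lTensor_eq_zero_of_flip Φ _ fun b => ?_
    refine H.nondegenerate.eq_of_rTensor_mulRight fun d => ?_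
    rw [TensorProduct.rTensor_lTensor_comm, rTensor_mulRight_R₁ h,
      ← LinearMap.lTensor_comp_apply, map_zero]
    have : Φ.flip b ∘ₗ H.antipodeMul.flip a = 0 := by
      ext v
      obtain ⟨s, hs⟩ := exists_mul_antipodeMul h b v
      exact (congrArg ω (hs a)).trans (hω s)
    rw [this]
    simp
  refine H.nondegenerate.2 _ fun d => ?_
  -- `Λ` shows that `d · (ι ⊗ ω)T₁(p ⊗ q)` depends on `q` only through the functional `Φ q = (b ↦
  -- ω(bq))`.
  let Λ : A ⊗[ℂ] (A →ₗ[ℂ] ℂ) →ₗ[ℂ] A := (TensorProduct.rid ℂ A).toLinearMap ∘ₗ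
    (TensorProduct.lift (LinearMap.id : (A →ₗ[ℂ] ℂ) →ₗ[ℂ] (A →ₗ[ℂ] ℂ)).flip).lTensor A ∘ₗ
    (TensorProduct.assoc ℂ A A (A →ₗ[ℂ] ℂ)).toLinearMap ∘ₗ (H.δ₂ d).rTensor (A →ₗ[ℂ] ℂ)
  have h₂ : ∀ z : A ⊗[ℂ] A, d * sliceRight ω (H.T₁ z) = Λ (Φ.lTensor A z) := by
    refine TensorProduct.induction_eq (f := mulLeft ℂ d ∘ₗ sliceRight ω ∘ₗ H.T₁)
      (g := Λ ∘ₗ Φ.lTensor A) fun p q => ?_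
    simp only [LinearMap.comp_apply, Λ, LinearMap.lTensor_tmul, LinearMap.rTensor_tmul,
      LinearEquiv.coe_coe]
    rw [← sliceRight_rTensor, rTensor_mulLeft_T₁, ← δ₂_apply]
    exact TensorProduct.induction_eq (f := sliceRight ω ∘ₗ (mulRight ℂ q).lTensor A)
      (g := (TensorProduct.rid ℂ A).toLinearMap ∘ₗ
        (TensorProduct.lift (LinearMap.id : (A →ₗ[ℂ] ℂ) →ₗ[ℂ] (A →ₗ[ℂ] ℂ)).flip).lTensor A ∘ₗ
        (TensorProduct.assoc ℂ A A (A →ₗ[ℂ] ℂ)).toLinearMap ∘ₗ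
        (TensorProduct.mk ℂ (A ⊗[ℂ] A) (A →ₗ[ℂ] ℂ)).flip (Φ q))
      (fun u v => by simp [Φ]) _
  rw [← T₁_R₁, h₂, h₁, map_zero]

/-- Take `a = wy`. The functionals `ω(ε_t(u) ·)` also vanish on `Aa`, so slicing `E(x ⊗ a)` gives `∑
ε'_s(w₍₁₎)x ω(ε_t(u)w₍₂₎y) = 0` for all `x` and `u`. Replacing `ε'_s(w₍₁₎)` by `w₍₁₎` modulo the
kernel of `ε'_s` and putting it in the place of `u` gives `ω(∑ ε_t(w₍₁₎)w₍₂₎y) = ω(a)`. -/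
theorem apply_eq_zero_of_mul (h : ∀ a, H'.Δ a = flip (H.Δ a)) (ω : A →ₗ[ℂ] ℂ) (a : A)
    (hω : ∀ b, ω (b * a) = 0) : ω a = 0 := by
  obtain ⟨t, ht⟩ := H.idempotent a
  let Φ : A →ₗ[ℂ] A →ₗ[ℂ] ℂ := H.targetMul.flip.compr₂ ω
  have hE : ∀ x, left H.E (x ⊗ₜ a) = (H.sourceMul'.flip x).rTensor A (H.T₁ t) := by
    intro x
    rw [← ht]
    exact TensorProduct.induction_eq (f := left H.E ∘ₗ TensorProduct.mk ℂ A A x ∘ₗ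
      LinearMap.mul' ℂ A) (g := (H.sourceMul'.flip x).rTensor A ∘ₗ H.T₁)
      (fun w y => by simpa [δ₁_apply] using H.left_E_tmul_mul x w y) t
  have hlift : TensorProduct.lift H.targetMul (H.T₁ t) = a := by
    rw [← ht]
    exact TensorProduct.induction_eq (f := TensorProduct.lift H.targetMul ∘ₗ H.T₁)
      (fun w y => by simpa [δ₁_apply] using H.lift_targetMul_δ₁ w y) t
  have h₁ : H.sourceMul'.rTensor (A →ₗ[ℂ] ℂ) (Φ.lTensor A (H.T₁ t)) = 0 := by
    refine TensorProduct.rTensor_eq_zero_of_flip _ _ fun x => ?_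
    rw [TensorProduct.rTensor_lTensor_comm, ← hE]
    refine TensorProduct.lTensor_eq_zero_of_flip Φ _ fun u => ?_
    apply (TensorProduct.rid ℂ A).injective
    rw [map_zero]
    refine sliceRight_left_E_eq_zero h (ω ∘ₗ H.targetMul u) a (fun b => ?_) x
    rw [LinearMap.comp_apply, targetMul_apply, targetMap_mul, hω]
  -- `g` recovers `p` from `ε'_s(p)` modulo the kernel of `ε'_s`, on which `ε_t` vanishes.
  obtain ⟨g, hg⟩ := H.sourceMul'.exists_generalizedInverse
  have hg' : ∀ p, H.targetMul (g (H.sourceMul' p)) = H.targetMul p := by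
    intro p
    rw [← sub_eq_zero, ← map_sub]
    refine targetMap_eq_zero h (c := g (H.sourceMul' p) - p) ?_
    change H.sourceMul' _ = 0
    rw [map_sub, hg, sub_self]
  have h₂ := congrArg (TensorProduct.lift (LinearMap.id : (A →ₗ[ℂ] ℂ) →ₗ[ℂ] (A →ₗ[ℂ] ℂ)).flip)
    (congrArg (g.rTensor (A →ₗ[ℂ] ℂ)) h₁)
  rw [map_zero, map_zero] at h₂
  rw [← hlift, ← h₂]
  exact TensorProduct.induction_eq (f := ω ∘ₗ TensorProduct.lift H.targetMul)
    (g := TensorProduct.lift (LinearMap.id : (A →ₗ[ℂ] ℂ) →ₗ[ℂ] (A →ₗ[ℂ] ℂ)).flip ∘ₗ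
      g.rTensor (A →ₗ[ℂ] ℂ) ∘ₗ H.sourceMul'.rTensor (A →ₗ[ℂ] ℂ) ∘ₗ Φ.lTensor A)
    (fun p q => by simp [Φ, hg']) _

/-- `A` has left local units. -/
theorem exists_mul_eq_self (h : ∀ a, H'.Δ a = flip (H.Δ a)) (a : A) : ∃ e : A, e * a = a := by
  by_contra hcon
  have ha : a ∉ LinearMap.range (mulRight ℂ a) := fun ⟨e, he⟩ => hcon ⟨e, he⟩
  obtain ⟨ω, hω, hle⟩ := Submodule.exists_le_ker_of_notMem ha
  exact hω (apply_eq_zero_of_mul h ω a fun b => hle ⟨b, rfl⟩)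

theorem exists_forall_mul_eq_self (h : ∀ a, H'.Δ a = flip (H.Δ a)) (s : Finset A) :
    ∃ e : A, ∀ a ∈ s, e * a = a := by
  classical
  induction s using Finset.induction_on with
  | empty => exact ⟨0, by simp⟩
  | insert b s hb ih =>
    obtain ⟨e, he⟩ := ih
    obtain ⟨f, hf⟩ := exists_mul_eq_self h (b - e * b)
    -- Formally `1 - (1 - f)(1 - e)`: the factor `1 - e` kills `s`, and `1 - f` kills `b - eb`.
    refine ⟨f + e - f * e, fun a ha => ?_⟩
    rcases Finset.mem_insert.1 ha with rfl | ha
    · rw [sub_mul, add_mul, mul_assoc, add_sub_right_comm, ← mul_sub, hf, sub_add_cancel]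
    · rw [sub_mul, add_mul, mul_assoc, he a ha]
      abel

/-- In a unital module, only zero is annihilated by `A`. -/
theorem eq_zero_of_forall_act_eq_zero (h : ∀ a, H'.Δ a = flip (H.Δ a))
    {act : A →ₗ[ℂ] V →ₗ[ℂ] V} (hact : ∀ a b v, act (a * b) v = act a (act b v))
    (hu : IsUnitalAction act) (v : V) (hv : ∀ b, act b v = 0) : v = 0 := by
  classical
  obtain ⟨t, rfl⟩ := hu v
  obtain ⟨S, rfl⟩ := TensorProduct.exists_finset t
  obtain ⟨e, he⟩ := exists_forall_mul_eq_self h (S.image Prod.fst)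
  rw [← hv e, map_sum, map_sum]
  refine Finset.sum_congr rfl fun i hi => ?_
  rw [TensorProduct.lift.tmul, ← hact, he _ (Finset.mem_image_of_mem _ hi)]

end Coopposite

end WeakMultiplierHopfAlgebra

/-! ### Extended actions of multipliers on faithful unital modules. -/

section ExtendedAction

variable {B V : Type*} [AddCommGroup B] [Module ℂ B] [AddCommGroup V] [Module ℂ V]

theorem IsUnitalAction.ext {W : Type*} [AddCommGroup W] [Module ℂ W] {act : B →ₗ[ℂ] V →ₗ[ℂ] V}
    (hu : IsUnitalAction act) {f g : V →ₗ[ℂ] W} (h : ∀ b v, f (act b v) = g (act b v)) : f = g := by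
  ext v
  obtain ⟨t, rfl⟩ := hu v
  exact TensorProduct.induction_eq (f := f ∘ₗ TensorProduct.lift act)
    (g := g ∘ₗ TensorProduct.lift act) (fun b v => by simpa using h b v) t

/-- The extended action is well-defined for a faithful action and a two-sided multiplier. -/
theorem extendedAction_lift {act : B →ₗ[ℂ] V →ₗ[ℂ] V} (hu : IsUnitalAction act)
    (hf : ∀ v, (∀ b, act b v = 0) → v = 0) {m : B →ₗ[ℂ] B} {n : B → B}
    (hm : ∀ b a v, act b (act (m a) v) = act (n b) (act a v)) (t : B ⊗[ℂ] V) :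
    extendedAction act hu m (TensorProduct.lift act t) =
      TensorProduct.lift act (m.rTensor V t) := by
  have key : ∀ b s, act b (TensorProduct.lift act (m.rTensor V s)) =
      act (n b) (TensorProduct.lift act s) := fun b =>
    TensorProduct.induction_eq (f := act b ∘ₗ TensorProduct.lift act ∘ₗ m.rTensor V)
      (g := act (n b) ∘ₗ TensorProduct.lift act) fun a v => by simpa using hm b a v
  rw [← sub_eq_zero]
  refine hf _ fun b => ?_
  have hs : TensorProduct.lift act (Function.surjInv hu (TensorProduct.lift act t)) =
      TensorProduct.lift act t := Function.surjInv_eq hu _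
  rw [map_sub, extendedAction, key, key, hs, sub_self]

/-- Here `n` is the right part `b ↦ bm` of the multiplier. With faithfulness, `b(mv) = (bm)v`
characterizes `mv`, and linearity of the extended actions is read off from it. -/
theorem act_extendedAction {act : B →ₗ[ℂ] V →ₗ[ℂ] V} (hu : IsUnitalAction act)
    (hf : ∀ v, (∀ b, act b v = 0) → v = 0) {m : B →ₗ[ℂ] B} {n : B → B}
    (hm : ∀ b a v, act b (act (m a) v) = act (n b) (act a v)) (b : B) (v : V) :
    act b (extendedAction act hu m v) = act (n b) v := by
  obtain ⟨t, rfl⟩ := hu v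
  rw [extendedAction_lift hu hf hm]
  exact TensorProduct.induction_eq (f := act b ∘ₗ TensorProduct.lift act ∘ₗ m.rTensor V)
    (g := act (n b) ∘ₗ TensorProduct.lift act) (fun a v => by simpa using hm b a v) t

end ExtendedAction

section TensorAction

variable {A : Type*} [NonUnitalRing A] [Module ℂ A] [IsScalarTower ℂ A A] [SMulCommClass ℂ A A]
variable {V : Type*} [AddCommGroup V] [Module ℂ V] {W : Type*} [AddCommGroup W] [Module ℂ W]

theorem TensorProduct.map₂_mul {act : A →ₗ[ℂ] V →ₗ[ℂ] V} {act' : A →ₗ[ℂ] W →ₗ[ℂ] W}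
    (h : ∀ a b v, act (a * b) v = act a (act b v))
    (h' : ∀ a b w, act' (a * b) w = act' a (act' b w)) (x y : A ⊗[ℂ] A) (t : V ⊗[ℂ] W) :
    TensorProduct.map₂ act act' (x * y) t =
      TensorProduct.map₂ act act' x (TensorProduct.map₂ act act' y t) := by
  induction x with
  | zero => simp
  | add x₁ x₂ h₁ h₂ => simp only [add_mul, map_add, LinearMap.add_apply, h₁, h₂]
  | tmul a b =>
    induction y with
    | zero => simp
    | add x₁ x₂ h₁ h₂ => simp only [mul_add, map_add, LinearMap.add_apply, h₁, h₂]
    | tmul c d =>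
      induction t with
      | zero => simp
      | add x₁ x₂ h₁ h₂ => simp only [map_add, h₁, h₂]
      | tmul v w => simp [Algebra.TensorProduct.tmul_mul_tmul, h, h']

theorem TensorProduct.eq_zero_of_map₂ {act : A →ₗ[ℂ] V →ₗ[ℂ] V} {act' : A →ₗ[ℂ] W →ₗ[ℂ] W}
    (hf : ∀ v, (∀ b, act b v = 0) → v = 0) (hf' : ∀ w, (∀ b, act' b w = 0) → w = 0)
    (t : V ⊗[ℂ] W) (ht : ∀ z, TensorProduct.map₂ act act' z t = 0) : t = 0 := by
  refine TensorProduct.eq_zero_of_rTensor_eq_zero (fun a : A => act a) hf t fun a => ?_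
  refine TensorProduct.eq_zero_of_lTensor_eq_zero (fun b : A => act' b) hf' _ fun b => ?_
  rw [← TensorProduct.map_eq_lTensor_rTensor]
  exact ht (a ⊗ₜ b)

open MultiplierAlgebra in
theorem TensorProduct.map₂_left {act : A →ₗ[ℂ] V →ₗ[ℂ] V} {act' : A →ₗ[ℂ] W →ₗ[ℂ] W}
    (h : ∀ a b v, act (a * b) v = act a (act b v))
    (h' : ∀ a b w, act' (a * b) w = act' a (act' b w)) (m : MultiplierAlgebra (A ⊗[ℂ] A))
    (x y : A ⊗[ℂ] A) (t : V ⊗[ℂ] W) :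
    TensorProduct.map₂ act act' x (TensorProduct.map₂ act act' (left m y) t) =
      TensorProduct.map₂ act act' (right m x) (TensorProduct.map₂ act act' y t) := by
  rw [← TensorProduct.map₂_mul h h', ← TensorProduct.map₂_mul h h', right_mul_eq]

theorem TensorProduct.map₂_tmul_eq {act : A →ₗ[ℂ] V →ₗ[ℂ] V} {act' : A →ₗ[ℂ] W →ₗ[ℂ] W}
    (z : A ⊗[ℂ] A) (v : V) (w : W) : TensorProduct.map₂ act act' z (v ⊗ₜ w) =
      TensorProduct.map (act.flip v) (act'.flip w) z := by
  induction z with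
  | zero => simp
  | add x₁ x₂ h₁ h₂ => simp only [map_add, LinearMap.add_apply, h₁, h₂]
  | tmul a b => simp

end TensorAction

/-! ### The operator `E ▷` on `R ⊗ A`: its kernel and range. -/

namespace WeakMultiplierHopfAlgebra

open MultiplierAlgebra

namespace ModuleAlgebra

variable {A : Type*} [NonUnitalRing A] [Module ℂ A] [IsScalarTower ℂ A A] [SMulCommClass ℂ A A]
variable {R : Type*} [NonUnitalRing R] [Module ℂ R] [IsScalarTower ℂ R R] [SMulCommClass ℂ R R]
variable {V : Type*} [AddCommGroup V] [Module ℂ V]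
variable {H H' : WeakMultiplierHopfAlgebra A} (M : H.ModuleAlgebra R)

theorem eq_zero_of_act (h : ∀ a, H'.Δ a = flip (H.Δ a)) (r : R) (hr : ∀ b, M.act b r = 0) :
    r = 0 :=
  eq_zero_of_forall_act_eq_zero h M.mul_act M.unital r hr

theorem eq_of_act_eq (h : ∀ a, H'.Δ a = flip (H.Δ a)) {r s : R}
    (hr : ∀ b, M.act b r = M.act b s) : r = s :=
  sub_eq_zero.1 <| M.eq_zero_of_act h _ fun b => by rw [map_sub, hr, sub_self]

theorem mul_mul_act (a b c : A) : LinearMap.mul ℂ A (a * b) c =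
    LinearMap.mul ℂ A a (LinearMap.mul ℂ A b c) := by simp [mul_assoc]

/-- The action of `A ⊗ A` on `R ⊗ A`. -/
noncomputable abbrev act₂ : A ⊗[ℂ] A →ₗ[ℂ] R ⊗[ℂ] A →ₗ[ℂ] R ⊗[ℂ] A :=
  TensorProduct.map₂ M.act (LinearMap.mul ℂ A)

theorem eq_zero_of_act₂ (h : ∀ a, H'.Δ a = flip (H.Δ a)) (t : R ⊗[ℂ] A)
    (ht : ∀ z, M.act₂ z t = 0) : t = 0 :=
  TensorProduct.eq_zero_of_map₂ (M.eq_zero_of_act h) H.nondegenerate.2 t ht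

theorem eq_of_act₂_eq (h : ∀ a, H'.Δ a = flip (H.Δ a)) {t u : R ⊗[ℂ] A}
    (ht : ∀ z, M.act₂ z t = M.act₂ z u) : t = u :=
  sub_eq_zero.1 <| M.eq_zero_of_act₂ h _ fun b => by rw [map_sub, ht, sub_self]

theorem act₂_actE (h : ∀ a, H'.Δ a = flip (H.Δ a)) (z : A ⊗[ℂ] A) (t : R ⊗[ℂ] A) :
    M.act₂ z (M.actE t) = M.act₂ (right H.E z) t :=
  act_extendedAction _ (M.eq_zero_of_act₂ h)
    (fun b a v => TensorProduct.map₂_left M.mul_act mul_mul_act H.E b a v) z t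

theorem act₂_tmul (z : A ⊗[ℂ] A) (s : R) (b : A) :
    M.act₂ z (s ⊗ₜ b) = (M.act.flip s).rTensor A ((mulRight ℂ b).lTensor A z) := by
  rw [TensorProduct.map₂_tmul_eq, ← TensorProduct.map_eq_rTensor_lTensor]
  rfl

/-- The map `t ↦ E ▷ t` as a linear map. -/
noncomputable def actEHom (h : ∀ a, H'.Δ a = flip (H.Δ a)) : R ⊗[ℂ] A →ₗ[ℂ] R ⊗[ℂ] A where
  toFun := M.actE
  map_add' t u := M.eq_of_act₂_eq h fun z => by simp only [map_add, act₂_actE M h]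
  map_smul' c t := M.eq_of_act₂_eq h fun z => by
    simp only [map_smul, act₂_actE M h, RingHom.id_apply]

theorem actEHom_apply (h : ∀ a, H'.Δ a = flip (H.Δ a)) (t : R ⊗[ℂ] A) :
    M.actEHom h t = M.actE t := rfl

theorem actE_act_tmul (h : ∀ a, H'.Δ a = flip (H.Δ a)) (x y : A) (s : R) :
    M.actE (M.act x s ⊗ₜ y) = (M.act.flip s).rTensor A (left H.E (x ⊗ₜ y)) := by
  refine LinearMap.congr_fun (H.ext_mul (f := M.actEHom h ∘ₗ TensorProduct.mk ℂ R A (M.act x s))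
    (g := (M.act.flip s).rTensor A ∘ₗ left H.E ∘ₗ TensorProduct.mk ℂ A A x) fun y b => ?_) y
  have h₁ := extendedAction_lift (M.unital.tensor (act' := LinearMap.mul ℂ A) H.idempotent)
    (M.eq_zero_of_act₂ h)
    (fun b a v => TensorProduct.map₂_left M.mul_act mul_mul_act H.E b a v)
    ((x ⊗ₜ y) ⊗ₜ (s ⊗ₜ b))
  rw [LinearMap.rTensor_tmul, TensorProduct.lift.tmul, TensorProduct.lift.tmul,
    act₂_tmul, act₂_tmul, ← left_lTensor_mulRight H.nondegenerate] at h₁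
  simpa [actEHom_apply, actE] using h₁

theorem actE_rTensor (h : ∀ a, H'.Δ a = flip (H.Δ a)) (s : R) (z : A ⊗[ℂ] A) :
    M.actE ((M.act.flip s).rTensor A z) = (M.act.flip s).rTensor A (left H.E z) :=
  TensorProduct.induction_eq (f := M.actEHom h ∘ₗ (M.act.flip s).rTensor A)
    (g := (M.act.flip s).rTensor A ∘ₗ left H.E) (fun x y => M.actE_act_tmul h x y s) z

theorem act_targetAct (h : ∀ a, H'.Δ a = flip (H.Δ a)) (b c : A) (r : R) :
    M.act b (M.targetAct r c) = M.act (sliceRight H.ε (H.δ₁ c b)) r :=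
  act_extendedAction (n := fun b => sliceRight H.ε (H.δ₁ c b)) M.unital (M.eq_zero_of_act h)
    (fun b a v => by rw [← M.mul_act, ← M.mul_act, mul_sourceMap'_eq_mul h]) b r

theorem targetAct_act (h : ∀ a, H'.Δ a = flip (H.Δ a)) (c x : A) (s : R) :
    M.targetAct (M.act x s) c = M.act (H.sourceMap' c x) s :=
  M.eq_of_act_eq h fun b => by
    rw [act_targetAct M h, ← M.mul_act, ← M.mul_act, mul_sourceMap'_eq_mul h]

/-- The right action of `ε_t(A)` on `R` as a bilinear map. -/
noncomputable def targetActHom (h : ∀ a, H'.Δ a = flip (H.Δ a)) : R →ₗ[ℂ] A →ₗ[ℂ] R :=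
  LinearMap.mk₂ ℂ M.targetAct
    (fun r s c => M.eq_of_act_eq h fun b => by simp only [map_add, act_targetAct M h])
    (fun k r c => M.eq_of_act_eq h fun b => by simp only [map_smul, act_targetAct M h])
    (fun r c d => M.eq_of_act_eq h fun b => by
      simp only [map_add, act_targetAct M h, δ₁_apply, TensorProduct.tmul_add, LinearMap.add_apply])
    (fun k r c => M.eq_of_act_eq h fun b => by
      simp only [map_smul, act_targetAct M h, δ₁_apply, TensorProduct.tmul_smul,
        LinearMap.smul_apply])

theorem targetActHom_apply (h : ∀ a, H'.Δ a = flip (H.Δ a)) (r : R) (c : A) :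
    M.targetActHom h r c = M.targetAct r c := rfl

/-- For `r = x ▷ s` this is `E(x ⊗ wy) = ∑ ε'_s(w₍₁₎)x ⊗ w₍₂₎y` applied to `s`; unitality of `R`
covers all `r`. -/
theorem actE_tmul_mul (h : ∀ a, H'.Δ a = flip (H.Δ a)) (r : R) (w y : A) :
    M.actE (r ⊗ₜ (w * y)) = (M.targetActHom h r).rTensor A (H.δ₁ y w) := by
  refine LinearMap.congr_fun (M.unital.ext (f := M.actEHom h ∘ₗ (TensorProduct.mk ℂ R A).flip (w * y))
    (g := (LinearMap.rTensorHom A ∘ₗ M.targetActHom h).flip (H.δ₁ y w)) fun x s => ?_) r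
  have h₁ : M.targetActHom h (M.act x s) = M.act.flip s ∘ₗ H.sourceMul'.flip x :=
    LinearMap.ext fun c => M.targetAct_act h c x s
  have h₂ := M.actE_act_tmul h x (w * y) s
  rw [left_E_tmul_mul, ← LinearMap.rTensor_comp_apply, ← h₁] at h₂
  exact h₂

/-- Because `wy = ∑ ε_t(w₍₁₎)w₍₂₎y`, the difference for `r ⊗ wy` is `∑ (r ⊗ ε_t(w₍₁₎)w₍₂₎y -
r·ε_t(w₍₁₎) ⊗ w₍₂₎y)`, a sum of balancing relations. -/
theorem sub_actE_mem_balancing (h : ∀ a, H'.Δ a = flip (H.Δ a)) (t : R ⊗[ℂ] A) :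
    t - M.actE t ∈ M.balancing := by
  have key : ∀ (r : R) (z : A ⊗[ℂ] A), r ⊗ₜ TensorProduct.lift H.targetMul z -
      (M.targetActHom h r).rTensor A z ∈ M.balancing := by
    intro r z
    induction z with
    | zero => simp
    | add x y hx hy =>
      rw [map_add, map_add, TensorProduct.tmul_add, add_sub_add_comm]
      exact add_mem hx hy
    | tmul c a =>
      rw [← neg_mem_iff, neg_sub]
      exact Submodule.subset_span ⟨r, c, a, rfl⟩
  suffices h₀ : M.balancing.mkQ ∘ₗ (LinearMap.id - M.actEHom h) = 0 from
    (Submodule.Quotient.mk_eq_zero _).1 (LinearMap.congr_fun h₀ t)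
  refine TensorProduct.ext' fun r a => ?_
  refine LinearMap.congr_fun (H.ext_mul (f := M.balancing.mkQ ∘ₗ (LinearMap.id - M.actEHom h) ∘ₗ
    TensorProduct.mk ℂ R A r) (g := 0) fun w y => ?_) a
  refine (Submodule.Quotient.mk_eq_zero _).2 ?_
  have := key r (H.δ₁ y w)
  rw [lift_targetMul_δ₁, ← actE_tmul_mul] at this
  exact this

/-- For `r = x ▷ s` this is `E(ε'_s(c) ⊗ 1) = E(1 ⊗ ε_t(c))`. -/
theorem actE_eq_zero_of_mem_balancing (h : ∀ a, H'.Δ a = flip (H.Δ a)) {t : R ⊗[ℂ] A}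
    (ht : t ∈ M.balancing) : M.actE t = 0 := by
  suffices hle : M.balancing ≤ LinearMap.ker (M.actEHom h) from hle ht
  refine Submodule.span_le.2 ?_
  rintro _ ⟨r, c, a, rfl⟩
  refine LinearMap.congr_fun (M.unital.ext (f := M.actEHom h ∘ₗ
    ((TensorProduct.mk ℂ R A).flip a ∘ₗ (M.targetActHom h).flip c -
      (TensorProduct.mk ℂ R A).flip (H.targetMap c a))) (g := 0) fun x s => ?_) r
  simp only [LinearMap.comp_apply, LinearMap.sub_apply, LinearMap.flip_apply, map_sub,
    TensorProduct.mk_apply, targetActHom_apply, actEHom_apply, targetAct_act M h,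
    actE_act_tmul M h, left_E_sourceMap'_tmul h, sub_self, LinearMap.zero_apply]

theorem ker_actEHom (h : ∀ a, H'.Δ a = flip (H.Δ a)) :
    LinearMap.ker (M.actEHom h) = M.balancing := by
  apply le_antisymm
  · intro t ht
    have := M.sub_actE_mem_balancing h t
    rwa [← actEHom_apply M h, LinearMap.mem_ker.1 ht, sub_zero] at this
  · exact fun t ht => M.actE_eq_zero_of_mem_balancing h ht

theorem range_actEHom (h : ∀ a, H'.Δ a = flip (H.Δ a)) :
    LinearMap.range (M.actEHom h) = M.smash := by
  have : Set.range M.actE = LinearMap.range (M.actEHom h) := rfl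
  rw [smash, this, Submodule.span_eq]

end ModuleAlgebra

end WeakMultiplierHopfAlgebra

/-! ### The pentagon equation and the product of `R # A`. -/

namespace WeakMultiplierHopfAlgebra

open MultiplierAlgebra

variable {A : Type*} [NonUnitalRing A] [Module ℂ A] [IsScalarTower ℂ A A] [SMulCommClass ℂ A A]

section Pentagon

variable (H : WeakMultiplierHopfAlgebra A)

/-- The map `p ⊗ q ↦ ∑ a₍₁₎ ⊗ a₍₂₎p ⊗ a₍₃₎q`. -/
noncomputable def comul₃Mul (a : A) : A ⊗[ℂ] A →ₗ[ℂ] (A ⊗[ℂ] A) ⊗[ℂ] A :=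
  H.T₁.rTensor A ∘ₗ (TensorProduct.assoc ℂ A A A).symm.toLinearMap ∘ₗ
    (TensorProduct.leftComm ℂ A A A).toLinearMap ∘ₗ (H.T₁ ∘ₗ TensorProduct.mk ℂ A A a).lTensor A

theorem comul₃Mul_tmul (a p q : A) :
    H.comul₃Mul a (p ⊗ₜ q) = (H.δ₁ p).rTensor A (H.δ₁ q a) :=
  TensorProduct.induction_eq (f := H.T₁.rTensor A ∘ₗ
    (TensorProduct.assoc ℂ A A A).symm.toLinearMap ∘ₗ
    (TensorProduct.leftComm ℂ A A A).toLinearMap ∘ₗ TensorProduct.mk ℂ A (A ⊗[ℂ] A) p)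
    (g := (H.δ₁ p).rTensor A) (fun x y => by simp [δ₁]) (H.δ₁ q a)

/-- The pentagon equation for `T₁`. -/
theorem assoc_comul₃Mul_δ₁ (a b c : A) :
    TensorProduct.assoc ℂ A A A (H.comul₃Mul a (H.δ₁ c b)) =
      (H.δ₁ c).lTensor A (H.δ₁ b a) := by
  refine H.nondegenerate.eq_of_rTensor_mulLeft fun d => ?_
  have key : ∀ w : A ⊗[ℂ] A, (mulLeft ℂ d).rTensor (A ⊗[ℂ] A)
      (TensorProduct.assoc ℂ A A A (H.comul₃Mul a w)) =
      (H.comulMul w).lTensor A (H.δ₂ d a) := by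
    intro w
    induction w with
    | zero =>
      have : H.comulMul 0 = 0 := LinearMap.ext fun a => map_zero (left (H.Δ a))
      simp [this]
    | add w₁ w₂ h₁ h₂ =>
      have : H.comulMul (w₁ + w₂) = H.comulMul w₁ + H.comulMul w₂ :=
        LinearMap.ext fun a => map_add (left (H.Δ a)) _ _
      rw [this, LinearMap.lTensor_add, LinearMap.add_apply, map_add, map_add, map_add, h₁, h₂]
    | tmul p q =>
      have h₁ : (mulLeft ℂ d).rTensor A ∘ₗ H.δ₁ p = (mulRight ℂ p).lTensor A ∘ₗ H.δ₂ d :=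
        LinearMap.ext fun a => H.rTensor_mulLeft_T₁ d a p
      have h₂ : H.comulMul (p ⊗ₜ q) = (mulRight ℂ p).rTensor A ∘ₗ H.δ₁ q :=
        LinearMap.ext fun a => H.left_Δ_tmul a p q
      rw [comul₃Mul_tmul, TensorProduct.rTensor_assoc, ← LinearMap.rTensor_comp_apply, h₁,
        LinearMap.rTensor_comp_apply, ← TensorProduct.lTensor_rTensor_assoc, H.isColinear_δ₂ d,
        ← LinearMap.lTensor_comp_apply, h₂]
  have h₃ : H.comulMul (H.δ₁ c b) = H.δ₁ c ∘ₗ mulRight ℂ b :=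
    LinearMap.ext fun y => (H.T₁_mul_tmul y b c).symm
  rw [key, h₃, LinearMap.lTensor_comp_apply, TensorProduct.rTensor_lTensor_comm, δ₁_apply,
    rTensor_mulLeft_T₁]
  rfl

end Pentagon

namespace ModuleAlgebra

variable {R : Type*} [NonUnitalRing R] [Module ℂ R] [IsScalarTower ℂ R R] [SMulCommClass ℂ R R]
variable {V : Type*} [AddCommGroup V] [Module ℂ V]
variable {H H' : WeakMultiplierHopfAlgebra A} (M : H.ModuleAlgebra R)

/-- The map `p ⊗ q ↦ (p ▷ x)(q ▷ y)`. -/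
noncomputable def mulAct (x y : R) : A ⊗[ℂ] A →ₗ[ℂ] R :=
  LinearMap.mul' ℂ R ∘ₗ TensorProduct.map (M.act.flip x) (M.act.flip y)

@[simp]
theorem mulAct_tmul (x y : R) (p q : A) : M.mulAct x y (p ⊗ₜ q) = M.act p x * M.act q y := rfl

theorem mulAct_rTensor (x y : R) (p : A) (z : A ⊗[ℂ] A) :
    M.mulAct x y ((mulRight ℂ p).rTensor A z) = M.mulAct (M.act p x) y z :=
  TensorProduct.induction_eq (f := M.mulAct x y ∘ₗ (mulRight ℂ p).rTensor A)
    (fun a b => by simp [M.mul_act]) z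

theorem mulAct_lTensor (x y : R) (q : A) (z : A ⊗[ℂ] A) :
    M.mulAct x y ((mulRight ℂ q).lTensor A z) = M.mulAct x (M.act q y) z :=
  TensorProduct.induction_eq (f := M.mulAct x y ∘ₗ (mulRight ℂ q).lTensor A)
    (fun a b => by simp [M.mul_act]) z

theorem act_mulAct (h : ∀ a, H'.Δ a = flip (H.Δ a)) (a : A) (x y : R) (z : A ⊗[ℂ] A) :
    M.act a (M.mulAct x y z) = M.mulAct x y (left (H.Δ a) z) := by
  refine TensorProduct.induction_eq (f := M.act a ∘ₗ M.mulAct x y)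
    (g := M.mulAct x y ∘ₗ left (H.Δ a)) (fun p q => ?_) z
  have hf := M.eq_zero_of_act h
  have h₁ := extendedAction_lift (M.unital.tensor M.unital) (TensorProduct.eq_zero_of_map₂ hf hf)
    (fun b c v => TensorProduct.map₂_left M.mul_act M.mul_act (H.Δ a) b c v)
    ((p ⊗ₜ q) ⊗ₜ (x ⊗ₜ y))
  rw [LinearMap.rTensor_tmul, TensorProduct.lift.tmul, TensorProduct.lift.tmul,
    TensorProduct.map₂_tmul_eq, TensorProduct.map₂_tmul_eq, TensorProduct.map_tmul] at h₁
  rw [LinearMap.comp_apply, mulAct_tmul, M.act_mul]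
  exact congrArg (LinearMap.mul' ℂ R) h₁

/-- `a ▷ (x(q ▷ y)) = ∑ (a₍₁₎ ▷ x)(a₍₂₎q ▷ y)`. -/
theorem act_mul_act (h : ∀ a, H'.Δ a = flip (H.Δ a)) (a q : A) (x y : R) :
    M.act a (x * M.act q y) = M.mulAct x y (H.δ₁ q a) := by
  refine LinearMap.congr_fun (M.unital.ext (f := M.act a ∘ₗ mulRight ℂ (M.act q y))
    (g := LinearMap.mul' ℂ R ∘ₗ ((LinearMap.mk₂ ℂ (fun x w => TensorProduct.map (M.act.flip x)
      (M.act.flip y) w) (by simp [TensorProduct.map_add_left]) (by simp [TensorProduct.map_smul_left])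
      (by simp) (by simp)).flip (H.δ₁ q a))) fun p x => ?_) x
  have h₁ := M.act_mulAct h a x y (p ⊗ₜ q)
  rw [left_Δ_tmul, mulAct_rTensor] at h₁
  exact h₁

/-- `a ▷ ((p ▷ x)y) = ∑ (a₍₁₎p ▷ x)(a₍₂₎ ▷ y)`. -/
theorem act_act_mul (h : ∀ a, H'.Δ a = flip (H.Δ a)) (a p : A) (x y : R) :
    M.act a (M.act p x * y) = M.mulAct x y (H'.δ₄ p a) := by
  refine LinearMap.congr_fun (M.unital.ext (f := M.act a ∘ₗ mulLeft ℂ (M.act p x))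
    (g := LinearMap.mul' ℂ R ∘ₗ ((LinearMap.mk₂ ℂ (fun y w => TensorProduct.map (M.act.flip x)
      (M.act.flip y) w) (by simp [TensorProduct.map_add_right])
      (by simp [TensorProduct.map_smul_right])
      (by simp) (by simp)).flip (H'.δ₄ p a))) fun q y => ?_) y
  have h₁ := M.act_mulAct h a x y (p ⊗ₜ q)
  rw [left_Δ_tmul' h, mulAct_lTensor] at h₁
  exact h₁

/-- The two sides agree after the action of any `a`, as `Δ(a)E = Δ(a)`, and `R` is faithful. So the
multiplication of `R` absorbs `E`. -/
theorem mulAct_left_E (h : ∀ a, H'.Δ a = flip (H.Δ a)) (x y : R) (z : A ⊗[ℂ] A) :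
    M.mulAct x y (left H.E z) = M.mulAct x y z :=
  M.eq_of_act_eq h fun a => by rw [act_mulAct M h, act_mulAct M h, left_Δ_left_E]

/-- The map `s ⊗ b ↦ Δ(a) ▷ (s ⊗ b)`. -/
noncomputable def comulAct (a : A) : R ⊗[ℂ] A →ₗ[ℂ] R ⊗[ℂ] A :=
  (TensorProduct.lift M.act.flip).rTensor A ∘ₗ
    (TensorProduct.assoc ℂ R A A).symm.toLinearMap ∘ₗ (H.T₁ ∘ₗ TensorProduct.mk ℂ A A a).lTensor R

theorem comulAct_tmul (a b : A) (s : R) :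
    M.comulAct a (s ⊗ₜ b) = (M.act.flip s).rTensor A (H.δ₁ b a) :=
  TensorProduct.induction_eq (f := (TensorProduct.lift M.act.flip).rTensor A ∘ₗ
    (TensorProduct.assoc ℂ R A A).symm.toLinearMap ∘ₗ TensorProduct.mk ℂ R (A ⊗[ℂ] A) s)
    (g := (M.act.flip s).rTensor A) (fun x y => by simp) (H.δ₁ b a)

theorem sharpMul_tmul_eq (r : R) (a : A) (t : R ⊗[ℂ] A) :
    M.sharpMul (r ⊗ₜ a) t = (mulLeft ℂ r).rTensor A (M.comulAct a t) :=
  TensorProduct.induction_eq (f := M.sharpMul (r ⊗ₜ a)) (g := (mulLeft ℂ r).rTensor A ∘ₗ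
    M.comulAct a) (fun s b => by
      rw [sharpMul_tmul, LinearMap.comp_apply, comulAct_tmul, ← LinearMap.rTensor_comp_apply,
        δ₁_apply]) t

theorem comulAct_rTensor (a : A) (s : R) (z : A ⊗[ℂ] A) :
    M.comulAct a ((M.act.flip s).rTensor A z) = (M.act.flip s).rTensor A (left (H.Δ a) z) := by
  refine TensorProduct.induction_eq (f := M.comulAct a ∘ₗ (M.act.flip s).rTensor A)
    (g := (M.act.flip s).rTensor A ∘ₗ left (H.Δ a)) (fun x y => ?_) z
  rw [LinearMap.comp_apply, LinearMap.rTensor_tmul, comulAct_tmul, LinearMap.comp_apply,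
    left_Δ_tmul, ← δ₁_apply, ← LinearMap.rTensor_comp_apply]
  congr 2
  ext p
  simp [M.mul_act]

/-- The second factor enters only through `Δ(a) ▷ u`, and `Δ(a)E = Δ(a)`. -/
theorem sharpMul_actE_right (h : ∀ a, H'.Δ a = flip (H.Δ a)) (t u : R ⊗[ℂ] A) :
    M.sharpMul t (M.actE u) = M.sharpMul t u := by
  suffices h₀ : ∀ a, M.comulAct a ∘ₗ M.actEHom h = M.comulAct a from
    TensorProduct.induction_eq (f := M.sharpMul.flip (M.actE u)) (g := M.sharpMul.flip u)
      (fun r a => by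
        rw [LinearMap.flip_apply, LinearMap.flip_apply, sharpMul_tmul_eq, sharpMul_tmul_eq]
        exact congrArg _ (LinearMap.congr_fun (h₀ a) u)) t
  intro a
  refine TensorProduct.ext' fun s b => LinearMap.congr_fun (M.unital.ext
    (f := (M.comulAct a ∘ₗ M.actEHom h) ∘ₗ (TensorProduct.mk ℂ R A).flip b)
    (g := M.comulAct a ∘ₗ (TensorProduct.mk ℂ R A).flip b) fun q s => ?_) s
  have h₁ := M.comulAct_rTensor a s (left H.E (q ⊗ₜ b))
  rw [left_Δ_left_E, ← comulAct_rTensor, ← actE_rTensor M h] at h₁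
  exact h₁

theorem sharpMul_rTensor (r s : R) (b : A) (z : A ⊗[ℂ] A) :
    M.sharpMul ((M.act.flip r).rTensor A z) (s ⊗ₜ b) = (M.mulAct r s).rTensor A
      ((TensorProduct.assoc ℂ A A A).symm ((H.δ₁ b).lTensor A z)) := by
  refine TensorProduct.induction_eq (f := M.sharpMul.flip (s ⊗ₜ b) ∘ₗ (M.act.flip r).rTensor A)
    (g := (M.mulAct r s).rTensor A ∘ₗ (TensorProduct.assoc ℂ A A A).symm.toLinearMap ∘ₗ
      (H.δ₁ b).lTensor A) (fun p a => ?_) z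
  simp only [LinearMap.comp_apply, LinearMap.flip_apply, LinearMap.rTensor_tmul,
    LinearMap.lTensor_tmul, LinearEquiv.coe_coe]
  rw [sharpMul_tmul, ← δ₁_apply]
  exact TensorProduct.induction_eq (f := (mulLeft ℂ (M.act p r) ∘ₗ M.act.flip s).rTensor A)
    (g := (M.mulAct r s).rTensor A ∘ₗ (TensorProduct.assoc ℂ A A A).symm.toLinearMap ∘ₗ
      TensorProduct.mk ℂ A (A ⊗[ℂ] A) p) (fun x y => by simp) _

/-- By `(ι ⊗ Δ)(E(p ⊗ a)) = (E ⊗ 1)(p ⊗ Δ(a))`, the factor `E` comes to act on the two elements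
multiplied in `R`, where `mulAct_left_E` removes it. -/
theorem sharpMul_actE_left (h : ∀ a, H'.Δ a = flip (H.Δ a)) (t u : R ⊗[ℂ] A) :
    M.sharpMul (M.actE t) u = M.sharpMul t u := by
  suffices h₀ : M.sharpMul ∘ₗ M.actEHom h = M.sharpMul from
    LinearMap.congr_fun (LinearMap.congr_fun h₀ t) u
  refine TensorProduct.ext' fun r a => LinearMap.congr_fun (M.unital.ext
    (f := (M.sharpMul ∘ₗ M.actEHom h) ∘ₗ (TensorProduct.mk ℂ R A).flip a)
    (g := M.sharpMul ∘ₗ (TensorProduct.mk ℂ R A).flip a) fun p r => ?_) r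
  refine TensorProduct.ext' fun s b => ?_
  have h₁ : M.mulAct r s ∘ₗ left H.E ∘ₗ TensorProduct.mk ℂ A A p =
      M.mulAct r s ∘ₗ TensorProduct.mk ℂ A A p := LinearMap.ext fun q => M.mulAct_left_E h r s _
  have h₂ := M.sharpMul_rTensor r s b (left H.E (p ⊗ₜ a))
  have h₃ := H.isColinear_left_E p a b
  rw [LinearMap.comp_apply, TensorProduct.mk_apply] at h₃
  rw [← h₃, LinearEquiv.symm_apply_apply, ← LinearMap.rTensor_comp_apply, h₁,
    ← actE_rTensor M h] at h₂
  refine h₂.trans ?_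
  have h₄ := M.sharpMul_rTensor r s b (p ⊗ₜ a)
  refine Eq.trans ?_ h₄.symm
  rw [LinearMap.lTensor_tmul]
  exact TensorProduct.induction_eq (f := (M.mulAct r s ∘ₗ TensorProduct.mk ℂ A A p).rTensor A)
    (g := (M.mulAct r s).rTensor A ∘ₗ (TensorProduct.assoc ℂ A A A).symm.toLinearMap ∘ₗ
      TensorProduct.mk ℂ A (A ⊗[ℂ] A) p) (fun x y => by simp) _

/-- `(rz)·ε_t(c) = r(z·ε_t(c))`. -/
theorem targetAct_mul (h : ∀ a, H'.Δ a = flip (H.Δ a)) (r z : R) (c : A) :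
    M.targetAct (r * z) c = r * M.targetAct z c := by
  refine LinearMap.congr_fun (M.unital.ext (f := (M.targetActHom h).flip c ∘ₗ mulRight ℂ z)
    (g := mulRight ℂ (M.targetAct z c)) fun p r => M.eq_of_act_eq h fun b => ?_) r
  have h₁ := M.act_targetAct h b c (M.act p r * z)
  rw [act_act_mul M h, (isColinear_δ₄ h p).slice] at h₁
  refine h₁.trans ?_
  rw [LinearMap.mulRight_apply, act_act_mul M h]
  exact TensorProduct.induction_eq (f := M.mulAct r z ∘ₗ (sliceRight H.ε ∘ₗ H.δ₁ c).lTensor A)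
    (g := M.mulAct r (M.targetAct z c)) (fun g k => by simp [act_targetAct M h]) _

/-- `E ▷` is expressed through the right action of `ε_t(A)` on `R`, which commutes with left
multiplications. -/
theorem actE_rTensor_mulLeft (h : ∀ a, H'.Δ a = flip (H.Δ a)) (r : R) (t : R ⊗[ℂ] A) :
    M.actE ((mulLeft ℂ r).rTensor A t) = (mulLeft ℂ r).rTensor A (M.actE t) := by
  refine TensorProduct.induction_eq (f := M.actEHom h ∘ₗ (mulLeft ℂ r).rTensor A)
    (g := (mulLeft ℂ r).rTensor A ∘ₗ M.actEHom h) (fun z a => LinearMap.congr_fun (H.ext_mul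
      (f := (M.actEHom h ∘ₗ (mulLeft ℂ r).rTensor A) ∘ₗ TensorProduct.mk ℂ R A z)
      (g := ((mulLeft ℂ r).rTensor A ∘ₗ M.actEHom h) ∘ₗ TensorProduct.mk ℂ R A z)
      fun w y => ?_) a) t
  simp only [LinearMap.comp_apply, TensorProduct.mk_apply, LinearMap.rTensor_tmul, actEHom_apply,
    LinearMap.mulLeft_apply]
  rw [actE_tmul_mul M h, actE_tmul_mul M h, ← LinearMap.rTensor_comp_apply]
  congr 2
  ext c
  exact M.targetAct_mul h r z c

/-- The product is `r` times `Δ(a) ▷ (s ⊗ b)`; the latter is fixed by `E` and left multiplication by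
`r` commutes with `E ▷`. -/
theorem actE_sharpMul (h : ∀ a, H'.Δ a = flip (H.Δ a)) (t u : R ⊗[ℂ] A) :
    M.actE (M.sharpMul t u) = M.sharpMul t u := by
  suffices h₀ : M.sharpMul.compr₂ (M.actEHom h) = M.sharpMul from
    LinearMap.congr_fun (LinearMap.congr_fun h₀ t) u
  refine TensorProduct.ext' fun r a => TensorProduct.ext' fun s b => ?_
  rw [LinearMap.compr₂_apply, actEHom_apply, sharpMul_tmul_eq, actE_rTensor_mulLeft M h,
    comulAct_tmul, actE_rTensor M h, δ₁_apply, left_E_T₁]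

/-- Both bracketings equal `∑ r(a₍₁₎ ▷ s)(a₍₂₎b₍₁₎ ▷ t) ⊗ a₍₃₎b₍₂₎c`; the pentagon equation
identifies the two ways of forming these legs. -/
theorem sharpMul_assoc_tmul (h : ∀ a, H'.Δ a = flip (H.Δ a)) (r s t : R) (a b c : A) :
    M.sharpMul (M.sharpMul (r ⊗ₜ a) (s ⊗ₜ b)) (t ⊗ₜ c) =
      M.sharpMul (r ⊗ₜ a) (M.sharpMul (s ⊗ₜ b) (t ⊗ₜ c)) := by
  have hl : M.sharpMul (M.sharpMul (r ⊗ₜ a) (s ⊗ₜ b)) (t ⊗ₜ c) =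
      (mulLeft ℂ r ∘ₗ M.mulAct s t).rTensor A ((TensorProduct.assoc ℂ A A A).symm
        ((H.δ₁ c).lTensor A (H.δ₁ b a))) := by
    rw [sharpMul_tmul, ← δ₁_apply]
    refine TensorProduct.induction_eq (f := M.sharpMul.flip (t ⊗ₜ c) ∘ₗ
      (mulLeft ℂ r ∘ₗ M.act.flip s).rTensor A) (g := (mulLeft ℂ r ∘ₗ M.mulAct s t).rTensor A ∘ₗ
      (TensorProduct.assoc ℂ A A A).symm.toLinearMap ∘ₗ (H.δ₁ c).lTensor A) (fun x y => ?_) _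
    simp only [LinearMap.comp_apply, LinearMap.flip_apply, LinearMap.rTensor_tmul,
      LinearMap.lTensor_tmul, LinearEquiv.coe_coe]
    rw [sharpMul_tmul, ← δ₁_apply]
    exact TensorProduct.induction_eq
      (f := (mulLeft ℂ (r * M.act x s) ∘ₗ M.act.flip t).rTensor A)
      (g := (mulLeft ℂ r ∘ₗ M.mulAct s t).rTensor A ∘ₗ
        (TensorProduct.assoc ℂ A A A).symm.toLinearMap ∘ₗ TensorProduct.mk ℂ A (A ⊗[ℂ] A) x)
      (fun u v => by simp) _
  have hr : ∀ w : A ⊗[ℂ] A, M.sharpMul (r ⊗ₜ a) ((mulLeft ℂ s ∘ₗ M.act.flip t).rTensor A w) =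
      (mulLeft ℂ r ∘ₗ M.mulAct s t).rTensor A (H.comul₃Mul a w) := by
    refine TensorProduct.induction_eq (f := M.sharpMul (r ⊗ₜ a) ∘ₗ
      (mulLeft ℂ s ∘ₗ M.act.flip t).rTensor A)
      (g := (mulLeft ℂ r ∘ₗ M.mulAct s t).rTensor A ∘ₗ H.comul₃Mul a) fun p q => ?_
    rw [LinearMap.comp_apply, LinearMap.comp_apply, LinearMap.rTensor_tmul, sharpMul_tmul,
      comul₃Mul_tmul, ← LinearMap.rTensor_comp_apply, δ₁_apply]
    congr 2
    ext x
    simp only [LinearMap.comp_apply, LinearMap.flip_apply, LinearMap.mulLeft_apply,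
      act_mul_act M h]
  rw [hl, ← H.assoc_comul₃Mul_δ₁, LinearEquiv.symm_apply_apply, ← hr, sharpMul_tmul, δ₁_apply]

theorem sharpMul_assoc (h : ∀ a, H'.Δ a = flip (H.Δ a)) (x y z : R ⊗[ℂ] A) :
    M.sharpMul (M.sharpMul x y) z = M.sharpMul x (M.sharpMul y z) := by
  induction x with
  | zero => simp
  | add x₁ x₂ h₁ h₂ => simp only [map_add, LinearMap.add_apply, h₁, h₂]
  | tmul r a =>
    induction y with
    | zero => simp
    | add x₁ x₂ h₁ h₂ => simp only [map_add, LinearMap.add_apply, h₁, h₂]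
    | tmul s b =>
      induction z with
      | zero => simp
      | add x₁ x₂ h₁ h₂ => simp only [map_add, h₁, h₂]
      | tmul t c => exact M.sharpMul_assoc_tmul h r s t a b c

end ModuleAlgebra

end WeakMultiplierHopfAlgebra

section

variable {M P Q V : Type*} [AddCommGroup M] [Module ℂ M] [AddCommGroup P] [Module ℂ P]
  [AddCommGroup Q] [Module ℂ Q] [AddCommGroup V] [Module ℂ V]

theorem TensorProduct.lTensor_assoc_symm (g : M →ₗ[ℂ] V) (z : P ⊗[ℂ] (Q ⊗[ℂ] M)) :
    g.lTensor (P ⊗[ℂ] Q) ((TensorProduct.assoc ℂ P Q M).symm z) =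
      (TensorProduct.assoc ℂ P Q V).symm ((g.lTensor Q).lTensor P z) := by
  rw [LinearEquiv.eq_symm_apply, ← TensorProduct.lTensor_lTensor_assoc,
    LinearEquiv.apply_symm_apply]

theorem TensorProduct.rTensor_lTensor_assoc_symm (g : Q →ₗ[ℂ] V) (z : P ⊗[ℂ] (Q ⊗[ℂ] M)) :
    (g.lTensor P).rTensor M ((TensorProduct.assoc ℂ P Q M).symm z) =
      (TensorProduct.assoc ℂ P V M).symm ((g.rTensor M).lTensor P z) := by
  rw [LinearEquiv.eq_symm_apply, ← TensorProduct.lTensor_rTensor_assoc,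
    LinearEquiv.apply_symm_apply]

end

/-! ### Non-degeneracy of the product. -/

namespace WeakMultiplierHopfAlgebra

open MultiplierAlgebra

namespace ModuleAlgebra

variable {A : Type*} [NonUnitalRing A] [Module ℂ A] [IsScalarTower ℂ A A] [SMulCommClass ℂ A A]
variable {R : Type*} [NonUnitalRing R] [Module ℂ R] [IsScalarTower ℂ R R] [SMulCommClass ℂ R R]
variable {V : Type*} [AddCommGroup V] [Module ℂ V]
variable {H H' : WeakMultiplierHopfAlgebra A} (M : H.ModuleAlgebra R)

/-- Cancelling `r` in `R` leaves `Δ(a) ▷ t = 0` for all `a`. The `(d ⊗ 1)Δ(a)` span `(A ⊗ A)E`, so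
`A ⊗ A` annihilates `E ▷ t`. -/
theorem actE_eq_zero_of_sharpMul_left (h : ∀ a, H'.Δ a = flip (H.Δ a))
    (hR : NonDegenerateProduct R) (t : R ⊗[ℂ] A) (ht : ∀ u, M.sharpMul u t = 0) :
    M.actE t = 0 := by
  have h₁ : ∀ a, M.comulAct a t = 0 := fun a => hR.eq_of_rTensor_mulLeft fun r => by
    rw [← sharpMul_tmul_eq, ht, map_zero]
  refine M.eq_zero_of_act₂ h _ fun z => ?_
  rw [act₂_actE M h]
  obtain ⟨u, hu⟩ : right H.E z ∈ LinearMap.range H.T₂ := H.range_T₂ ▸ ⟨z, rfl⟩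
  rw [← hu]
  refine TensorProduct.induction_eq (f := M.act₂.flip t ∘ₗ H.T₂) (g := 0) (fun d a => ?_) u
  have h₂ : M.act₂ (H.T₂ (d ⊗ₜ a)) t = (M.act d).rTensor A (M.comulAct a t) := by
    refine TensorProduct.induction_eq (f := M.act₂ (H.T₂ (d ⊗ₜ a)))
      (g := (M.act d).rTensor A ∘ₗ M.comulAct a) (fun s b => ?_) t
    rw [act₂_tmul, ← rTensor_mulLeft_T₁, LinearMap.comp_apply, comulAct_tmul, δ₁_apply,
      ← LinearMap.rTensor_comp_apply, ← LinearMap.rTensor_comp_apply]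
    congr 2
    ext p
    simp [M.mul_act]
  rw [LinearMap.comp_apply, LinearMap.flip_apply, h₂, h₁, map_zero, LinearMap.zero_apply]

/-- `(r·ε_t(c))(a ▷ s) = r(ε_t(c)a ▷ s)`. -/
theorem targetAct_mul_act (h : ∀ a, H'.Δ a = flip (H.Δ a)) (r s : R) (c a : A) :
    M.targetAct r c * M.act a s = r * M.act (H.targetMap c a) s := by
  refine LinearMap.congr_fun (M.unital.ext (f := mulRight ℂ (M.act a s) ∘ₗ
    (M.targetActHom h).flip c) (g := mulRight ℂ (M.act (H.targetMap c a) s)) fun p r => ?_) r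
  have h₁ := M.mulAct_left_E h r s (H.sourceMap' c p ⊗ₜ a)
  rw [left_E_sourceMap'_tmul h, mulAct_left_E M h, mulAct_tmul, mulAct_tmul,
    ← targetAct_act M h] at h₁
  exact h₁.symm

theorem actE_lTensor_mulRight (h : ∀ a, H'.Δ a = flip (H.Δ a)) (y : A) (t : R ⊗[ℂ] A) :
    M.actE ((mulRight ℂ y).lTensor R t) = (mulRight ℂ y).lTensor R (M.actE t) := by
  refine TensorProduct.induction_eq (f := M.actEHom h ∘ₗ (mulRight ℂ y).lTensor R)
    (g := (mulRight ℂ y).lTensor R ∘ₗ M.actEHom h) (fun r a => LinearMap.congr_fun (M.unital.ext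
      (f := (M.actEHom h ∘ₗ (mulRight ℂ y).lTensor R) ∘ₗ (TensorProduct.mk ℂ R A).flip a)
      (g := ((mulRight ℂ y).lTensor R ∘ₗ M.actEHom h) ∘ₗ (TensorProduct.mk ℂ R A).flip a)
      fun x s => ?_) r) t
  simp only [LinearMap.comp_apply, TensorProduct.mk_apply, LinearMap.lTensor_tmul, actEHom_apply,
    LinearMap.mulRight_apply, LinearMap.flip_apply]
  rw [actE_act_tmul M h, actE_act_tmul M h, ← TensorProduct.rTensor_lTensor_comm,
    ← left_lTensor_mulRight H.nondegenerate]
  rfl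

/-- The map `r ⊗ p ↦ (z ↦ r(p ▷ z))`. -/
noncomputable def mulActHom : R ⊗[ℂ] A →ₗ[ℂ] R →ₗ[ℂ] R :=
  TensorProduct.lift (((LinearMap.llcomp ℂ R R R).compl₁₂ (LinearMap.mul ℂ R) M.act))

@[simp]
theorem mulActHom_tmul (r z : R) (p : A) : M.mulActHom (r ⊗ₜ p) z = r * M.act p z := rfl

theorem mulActHom_flip_act (d : A) (z : R) :
    M.mulActHom.flip (M.act d z) = M.mulActHom.flip z ∘ₗ (mulRight ℂ d).lTensor R :=
  TensorProduct.ext' fun r p => by simp [M.mul_act]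

theorem sharpMul_tmul_right (t : R ⊗[ℂ] A) (z : R) (y : A) :
    M.sharpMul t (z ⊗ₜ y) = (M.mulActHom.flip z).rTensor A
      ((TensorProduct.assoc ℂ R A A).symm ((H.δ₁ y).lTensor R t)) := by
  refine TensorProduct.induction_eq (f := M.sharpMul.flip (z ⊗ₜ y))
    (g := (M.mulActHom.flip z).rTensor A ∘ₗ (TensorProduct.assoc ℂ R A A).symm.toLinearMap ∘ₗ
      (H.δ₁ y).lTensor R) (fun r a => ?_) t
  simp only [LinearMap.comp_apply, LinearMap.flip_apply, LinearMap.lTensor_tmul,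
    LinearEquiv.coe_coe]
  rw [sharpMul_tmul, ← δ₁_apply]
  exact TensorProduct.induction_eq (f := (mulLeft ℂ r ∘ₗ M.act.flip z).rTensor A)
    (g := (M.mulActHom.flip z).rTensor A ∘ₗ (TensorProduct.assoc ℂ R A A).symm.toLinearMap ∘ₗ
      TensorProduct.mk ℂ R (A ⊗[ℂ] A) r) (fun x y => by simp) _

/-- The map `a ↦ ∑ a₍₁₎ ⊗ S(a₍₂₎)b ⊗ a₍₃₎y`. -/
noncomputable def antipodeComul (H : WeakMultiplierHopfAlgebra A) (b y : A) :
    A →ₗ[ℂ] A ⊗[ℂ] (A ⊗[ℂ] A) :=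
  (TensorProduct.assoc ℂ A A A).toLinearMap ∘ₗ
    (H.R₁ ∘ₗ (TensorProduct.mk ℂ A A).flip b).rTensor A ∘ₗ H.δ₁ y

theorem rTensor_mulRight_antipodeComul (h : ∀ a, H'.Δ a = flip (H.Δ a)) (b y d : A) :
    (mulRight ℂ d).rTensor (A ⊗[ℂ] A) ∘ₗ antipodeComul H b y =
      ((H.antipodeMul.flip b).rTensor A ∘ₗ H.δ₁ y).lTensor A ∘ₗ H'.δ₄ d := by
  have h₁ : (mulRight ℂ d).rTensor A ∘ₗ H.R₁ ∘ₗ (TensorProduct.mk ℂ A A).flip b =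
      (H.antipodeMul.flip b).lTensor A ∘ₗ H'.δ₄ d :=
    LinearMap.ext fun c => rTensor_mulRight_R₁ h c b d
  ext a
  simp only [antipodeComul, LinearMap.comp_apply, LinearEquiv.coe_coe]
  rw [TensorProduct.rTensor_assoc, ← LinearMap.rTensor_comp_apply, h₁,
    LinearMap.rTensor_comp_apply, ← TensorProduct.lTensor_rTensor_assoc, isColinear_δ₄ h,
    LinearMap.lTensor_comp_apply]

/-- The map `f ⊗ v ⊗ q ↦ f(v ▷ s) ⊗ q`. -/
noncomputable def evalAct (s : R) : (R →ₗ[ℂ] R) ⊗[ℂ] (A ⊗[ℂ] A) →ₗ[ℂ] R ⊗[ℂ] A :=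
  (TensorProduct.lift ((LinearMap.id : (R →ₗ[ℂ] R) →ₗ[ℂ] (R →ₗ[ℂ] R)).compl₂
    (M.act.flip s))).rTensor A ∘ₗ (TensorProduct.assoc ℂ (R →ₗ[ℂ] R) A A).symm.toLinearMap

/-- For `t = r ⊗ a` the left side is `∑ r(a₍₁₎S(a₍₂₎)b ▷ s) ⊗ a₍₃₎y = ∑ r(ε_t(a₍₁₎)b ▷ s) ⊗ a₍₂₎y`.
Moving `ε_t(a₍₁₎)` onto `r` yields the formula for `E ▷ (r ⊗ ay)`. -/
theorem evalAct_mulActHom (h : ∀ a, H'.Δ a = flip (H.Δ a)) (s : R) (b y : A) (t : R ⊗[ℂ] A) :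
    M.evalAct s (M.mulActHom.rTensor (A ⊗[ℂ] A) ((TensorProduct.assoc ℂ R A (A ⊗[ℂ] A)).symm
      ((antipodeComul H b y).lTensor R t))) =
      (mulRight ℂ (M.act b s)).rTensor A ((mulRight ℂ y).lTensor R (M.actE t)) := by
  rw [← actE_lTensor_mulRight M h]
  refine TensorProduct.induction_eq (f := M.evalAct s ∘ₗ M.mulActHom.rTensor (A ⊗[ℂ] A) ∘ₗ
    (TensorProduct.assoc ℂ R A (A ⊗[ℂ] A)).symm.toLinearMap ∘ₗ (antipodeComul H b y).lTensor R)
    (g := (mulRight ℂ (M.act b s)).rTensor A ∘ₗ M.actEHom h ∘ₗ (mulRight ℂ y).lTensor R)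
    (fun r a => ?_) t
  simp only [LinearMap.comp_apply, LinearMap.lTensor_tmul, actEHom_apply, LinearMap.mulRight_apply,
    LinearEquiv.coe_coe, antipodeComul]
  rw [actE_tmul_mul M h, ← LinearMap.rTensor_comp_apply]
  refine TensorProduct.induction_eq (f := M.evalAct s ∘ₗ M.mulActHom.rTensor (A ⊗[ℂ] A) ∘ₗ
    (TensorProduct.assoc ℂ R A (A ⊗[ℂ] A)).symm.toLinearMap ∘ₗ
    TensorProduct.mk ℂ R (A ⊗[ℂ] (A ⊗[ℂ] A)) r ∘ₗ (TensorProduct.assoc ℂ A A A).toLinearMap ∘ₗ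
    (H.R₁ ∘ₗ (TensorProduct.mk ℂ A A).flip b).rTensor A)
    (g := (mulRight ℂ (M.act b s) ∘ₗ M.targetActHom h r).rTensor A) (fun p q => ?_) _
  simp only [LinearMap.comp_apply, LinearMap.rTensor_tmul, LinearEquiv.coe_coe,
    LinearMap.mulRight_apply, targetActHom_apply, targetAct_mul_act M h, ← mul'_R₁_tmul,
    LinearMap.flip_apply, TensorProduct.mk_apply]
  exact TensorProduct.induction_eq (f := M.evalAct s ∘ₗ M.mulActHom.rTensor (A ⊗[ℂ] A) ∘ₗ
    (TensorProduct.assoc ℂ R A (A ⊗[ℂ] A)).symm.toLinearMap ∘ₗ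
    TensorProduct.mk ℂ R (A ⊗[ℂ] (A ⊗[ℂ] A)) r ∘ₗ (TensorProduct.assoc ℂ A A A).toLinearMap ∘ₗ
    (TensorProduct.mk ℂ (A ⊗[ℂ] A) A).flip q)
    (g := (TensorProduct.mk ℂ R A).flip q ∘ₗ mulLeft ℂ r ∘ₗ M.act.flip s ∘ₗ LinearMap.mul' ℂ A)
    (fun u v => by simp [evalAct, M.mul_act]) _

/-- The hypothesis says that `∑ r(a₍₁₎ ▷ z) ⊗ a₍₂₎y` vanishes for every fixed `z`. To substitute the
varying `S(a₍₂₎)b ▷ s` for `z`, the first leg is kept as a map `R → R` until the whole tensor is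
known to vanish; then `evalAct_mulActHom` recovers `E ▷ t`. -/
theorem actE_eq_zero_of_sharpMul_right (h : ∀ a, H'.Δ a = flip (H.Δ a))
    (hR : NonDegenerateProduct R) (t : R ⊗[ℂ] A) (ht : ∀ u, M.sharpMul t u = 0) :
    M.actE t = 0 := by
  have h₁ : ∀ (d : A) (z : R), (M.mulActHom.flip z).rTensor A
      ((TensorProduct.assoc ℂ R A A).symm ((H'.δ₄ d).lTensor R t)) = 0 := by
    intro d z
    refine H.nondegenerate.eq_of_lTensor_mulRight fun y => ?_
    have h₂ : (mulRight ℂ y).lTensor A ∘ₗ H'.δ₄ d = (mulRight ℂ d).rTensor A ∘ₗ H.δ₁ y :=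
      LinearMap.ext fun a => (rTensor_mulRight_δ₁ h a d y).symm
    rw [map_zero, ← TensorProduct.rTensor_lTensor_comm, TensorProduct.lTensor_assoc_symm,
      ← LinearMap.lTensor_comp_apply, h₂, LinearMap.lTensor_comp_apply,
      ← TensorProduct.rTensor_lTensor_assoc_symm, ← LinearMap.rTensor_comp_apply,
      ← mulActHom_flip_act, ← sharpMul_tmul_right, ht]
  -- Tested on `d ▷ z`, the first two legs become `a₍₁₎d` and `S(a₍₂₎)b`, so the expression is a
  -- linear image of the tensor that vanishes by `h₁`.
  have h₃ : ∀ (b y : A), M.mulActHom.rTensor (A ⊗[ℂ] A)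
      ((TensorProduct.assoc ℂ R A (A ⊗[ℂ] A)).symm ((antipodeComul H b y).lTensor R t)) = 0 := by
    intro b y
    refine TensorProduct.rTensor_eq_zero_of_flip _ _ fun z => ?_
    refine LinearMap.congr_fun (M.unital.ext (f := (LinearMap.rTensorHom (A ⊗[ℂ] A) ∘ₗ
      M.mulActHom.flip).flip ((TensorProduct.assoc ℂ R A (A ⊗[ℂ] A)).symm
      ((antipodeComul H b y).lTensor R t))) (g := 0) fun d z => ?_) z
    change (M.mulActHom.flip (M.act d z)).rTensor (A ⊗[ℂ] A) _ = 0
    rw [mulActHom_flip_act, LinearMap.rTensor_comp_apply,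
      TensorProduct.rTensor_lTensor_assoc_symm, ← LinearMap.lTensor_comp_apply,
      rTensor_mulRight_antipodeComul h, LinearMap.lTensor_comp_apply,
      ← TensorProduct.lTensor_assoc_symm, TensorProduct.rTensor_lTensor_comm, h₁, map_zero]
  refine H.nondegenerate.eq_of_lTensor_mulRight fun y => hR.eq_of_rTensor_mulRight fun s => ?_
  rw [map_zero, map_zero]
  refine LinearMap.congr_fun (M.unital.ext (f := (LinearMap.rTensorHom A ∘ₗ
    (LinearMap.mul ℂ R).flip).flip ((mulRight ℂ y).lTensor R (M.actE t))) (g := 0)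
    fun b s => ?_) s
  have h₄ := M.evalAct_mulActHom h s b y t
  rw [h₃, map_zero] at h₄
  exact h₄.symm

end ModuleAlgebra

end WeakMultiplierHopfAlgebra

theorem mainTheorem6 {A R : Type*}
    [NonUnitalRing A] [Module ℂ A] [IsScalarTower ℂ A A] [SMulCommClass ℂ A A]
    [NonUnitalRing R] [Module ℂ R] [IsScalarTower ℂ R R] [SMulCommClass ℂ R R]
    (H : WeakMultiplierHopfAlgebra A) (hH : H.IsRegular)
    (hR : NonDegenerateProduct R) (M : H.ModuleAlgebra R) :
    ∃ μ : M.TensorOverTarget →ₗ[ℂ] M.TensorOverTarget →ₗ[ℂ] M.TensorOverTarget,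
      (∀ (r s : R) (a b : A),
        μ (M.balancing.mkQ (r ⊗ₜ a)) (M.balancing.mkQ (s ⊗ₜ b)) =
          M.balancing.mkQ (M.sharpMul (r ⊗ₜ a) (s ⊗ₜ b))) ∧
      (∀ x y z, μ (μ x y) z = μ x (μ y z)) ∧
      (∀ x, (∀ y, μ x y = 0) → x = 0) ∧
      (∀ x, (∀ y, μ y x = 0) → x = 0) ∧
      ∃ f : M.TensorOverTarget ≃ₗ[ℂ] M.smash,
        (∀ (r : R) (a : A), (f (M.balancing.mkQ (r ⊗ₜ a)) : R ⊗[ℂ] A) = M.actE (r ⊗ₜ a)) ∧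
        (∀ x y, (f (μ x y) : R ⊗[ℂ] A) = M.sharpMul (f x) (f y)) := by
  obtain ⟨-, -, H', h⟩ := hH
  have hmem : ∀ t, t ∈ M.balancing ↔ M.actE t = 0 := fun t => by
    rw [← M.ker_actEHom h]; rfl
  have hleft : ∀ t ∈ M.balancing, ∀ u, M.sharpMul t u = 0 := fun t ht u => by
    rw [← M.sharpMul_actE_left h, (hmem t).1 ht, map_zero, LinearMap.zero_apply]
  have hright : ∀ t ∈ M.balancing, ∀ u, M.sharpMul u t = 0 := fun t ht u => by
    rw [← M.sharpMul_actE_right h, (hmem t).1 ht, map_zero]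
  let μ₁ : M.TensorOverTarget →ₗ[ℂ] R ⊗[ℂ] A →ₗ[ℂ] M.TensorOverTarget :=
    M.balancing.liftQ (M.sharpMul.compr₂ M.balancing.mkQ) fun t ht =>
      LinearMap.ext fun u => by simp [hleft t ht u]
  let μ : M.TensorOverTarget →ₗ[ℂ] M.TensorOverTarget →ₗ[ℂ] M.TensorOverTarget :=
    (M.balancing.liftQ μ₁.flip fun t ht => LinearMap.ext fun u => by
      obtain ⟨u, rfl⟩ := M.balancing.mkQ_surjective u
      change M.balancing.mkQ (M.sharpMul u t) = 0
      rw [hright t ht u, map_zero]).flip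
  have hμ : ∀ t u, μ (M.balancing.mkQ t) (M.balancing.mkQ u) = M.balancing.mkQ (M.sharpMul t u) :=
    fun t u => rfl
  have hzero : ∀ t u, μ (M.balancing.mkQ t) (M.balancing.mkQ u) = 0 → M.sharpMul t u = 0 := by
    -- Products are fixed by `E ▷`, whose kernel is the balancing subspace, so a product that
    -- vanishes in the quotient already vanishes in `R ⊗ A`.
    intro t u htu
    rw [hμ, Submodule.mkQ_apply, Submodule.Quotient.mk_eq_zero, hmem, M.actE_sharpMul h] at htu
    exact htu
  let f : M.TensorOverTarget ≃ₗ[ℂ] M.smash :=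
    (Submodule.quotEquivOfEq _ _ (M.ker_actEHom h).symm).trans
      ((M.actEHom h).quotKerEquivRange.trans (LinearEquiv.ofEq _ _ (M.range_actEHom h)))
  have hf : ∀ t, (f (M.balancing.mkQ t) : R ⊗[ℂ] A) = M.actE t := fun t => rfl
  refine ⟨μ, fun r s a b => hμ _ _, fun x y z => ?_, fun x hx => ?_, fun x hx => ?_, f,
    fun r a => hf _, fun x y => ?_⟩
  · obtain ⟨x, rfl⟩ := M.balancing.mkQ_surjective x
    obtain ⟨y, rfl⟩ := M.balancing.mkQ_surjective y
    obtain ⟨z, rfl⟩ := M.balancing.mkQ_surjective z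
    rw [hμ, hμ, hμ, hμ, M.sharpMul_assoc h]
  · obtain ⟨x, rfl⟩ := M.balancing.mkQ_surjective x
    rw [Submodule.mkQ_apply, Submodule.Quotient.mk_eq_zero, hmem]
    exact M.actE_eq_zero_of_sharpMul_right h hR x fun u => hzero x u (hx _)
  · obtain ⟨x, rfl⟩ := M.balancing.mkQ_surjective x
    rw [Submodule.mkQ_apply, Submodule.Quotient.mk_eq_zero, hmem]
    exact M.actE_eq_zero_of_sharpMul_left h hR x fun u => hzero u x (hx _)
  · obtain ⟨x, rfl⟩ := M.balancing.mkQ_surjective x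
    obtain ⟨y, rfl⟩ := M.balancing.mkQ_surjective y
    rw [hμ, hf, hf, hf, M.actE_sharpMul h, M.sharpMul_actE_left h, M.sharpMul_actE_right h]
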